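/- Let $(M,H)$ be a cooriented contact manifold of dimension $2n+1$ with a compatible almost CR structure $J$, i.e. a complex structure $J$ of $H$ such that for one (hence any) contact form $\theta$ (positive with respect to the coorientation) the Levi form $h(X,Y)=d\theta(X,JY)$ is a positive-definite Hermitian form on $H$. Write $\mathbb{C}H=H^{1,0}\oplus H^{0,1}$ for the splitting into the $(\pm i)$-eigenspaces of $J$, with local frames $Z_\alpha$, $Z_{\bar\alpha}=\overline{Z_\alpha}$ and $h_{\alpha\bar\beta}=h(Z_\alpha,Z_{\bar\beta})$. Let $\mathcal{E}(1,1)=\mathcal{E}(1,0)\otimes\overline{\mathcal{E}(1,0)}$, where $\mathcal{E}(1,0)$ is the dual of an $(n+2)$-nd root of the canonical bundle $\bigwedge^{n+1}(H^{0,1})^\perp$. A contact form $\theta$ trivializes $\mathcal{E}(1,1)$ by $|\zeta|^{-2/(n+2)}$, where $\zeta=\theta\wedge\theta^1\wedge\dots\wedge\theta^n$ for any unitary admissible coframe $(\theta^\alpha)$, i.e. one dual to a unitary frame of $H^{1,0}$ and vanishing on $H^{0,1}$ and on the Reeb field $T$ ($\theta(T)=1$, $d\theta(T,\cdot)=0$).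 Thus $f\in\operatorname{Re}\mathcal{E}(1,1)$ becomes a real function, again denoted $f$, and $\hat f=e^uf$ for $\hat\theta=e^u\theta$. Given $\theta$, let $\nabla$ be the Tanaka--Webster connection: the connection of $TM$ preserving $TM=H\oplus\mathbb{R}T$, with $T$, $J$, $h$ parallel, whose torsion $\tau$ satisfies $\tau(Z_\alpha,Z_\beta)\in H^{0,1}$, $\tau(Z_\alpha,Z_{\bar\beta})=ih_{\alpha\bar\beta}T$ and $\tau(T,Z_\alpha)=A_\alpha{}^{\bar\beta}Z_{\bar\beta}\in H^{0,1}$. Let $N$ be the Nijenhuis tensor, $[Z_\alpha,Z_\beta]=-N^{\bar\gamma}{}_{\alpha\beta}Z_{\bar\gamma}$ mod $H^{1,0}$, and lower indices by $A_{\alpha\beta}=h_{\beta\bar\gamma}A_\alpha{}^{\bar\gamma}$, $N_{\gamma\alpha\beta}=h_{\gamma\bar\sigma}N^{\bar\sigma}{}_{\alpha\beta}$. The CR Killing operator $D\colon\operatorname{Re}\mathcal{E}(1,1)\to\operatorname{Re}(\mathcal{E}_{(\alpha\beta)}(1,1)\oplus\mathcal{E}_{(\bar\alpha\bar\beta)}(1,1))$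 is $$Df=\bigl(i\nabla_{(\alpha}\nabla_{\beta)}f-A_{\alpha\beta}f+iN_{(\alpha\beta)\gamma}\nabla^\gamma f,\ \text{its complex conjugate}\bigr).$$ Let $f\in\operatorname{Re}\mathcal{E}(1,1)$, and let $X_f$ be its contact Hamiltonian vector field, defined by $\theta(X_f)=f$ and $d\theta(X_f,Y)=-df(Y)$ for $Y\in H$. Let $\mathrm{Fl}_t$ be the (local) flow of $X_f$ and $J_t=(\mathrm{Fl}_t^{-1})_*\circ J\circ(\mathrm{Fl}_t)_*$. Then at each point $p\in M$, for all $t$ sufficiently near $0$, $J_t$ is a complex structure of $H_p$ whose Levi form is a positive-definite Hermitian form, and it has a unique deformation tensor, i.e. a complex linear map $\varphi_t\colon H^{1,0}_p\to H^{0,1}_p$ such that the $i$-eigenspace of $J_t$ on $\mathbb{C}H_p$ is $\{Z+\varphi_t(Z)\mid Z\in H^{1,0}_p\}$. The derivative $\psi=\left.\frac{d}{dt}\varphi_t\right|_{t=0}$ exists and, with its upper index lowered by the Levi form, $\psi_{\alpha\beta}=h_{\beta\bar\gamma}\psi_\alpha{}^{\bar\gamma}$, it satisfies $$\psi=Df,$$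 where $Df$ is computed with any contact form $\theta$. -/

import Mathlib

open Set Filter Bundle Topology Module VectorField
open scoped Manifold ContDiff

noncomputable section

/-! ### Complexification of a real vector space -/

/-- The complexification `ℂ ⊗ V` of a real vector space: elements are `re + i im`. -/
@[ext]
structure Cplx (V : Type*) where
  re : V
  im : V

namespace Cplx

variable {V : Type*} [AddCommGroup V]

instance : Zero (Cplx V) := ⟨⟨0, 0⟩⟩
instance : Add (Cplx V) := ⟨fun Z W => ⟨Z.re + W.re, Z.im + W.im⟩⟩
instance : Neg (Cplx V) := ⟨fun Z => ⟨-Z.re, -Z.im⟩⟩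
@[simp] theorem zero_re : (0 : Cplx V).re = 0 := rfl
@[simp] theorem zero_im : (0 : Cplx V).im = 0 := rfl
@[simp] theorem add_re (Z W : Cplx V) : (Z + W).re = Z.re + W.re := rfl
@[simp] theorem add_im (Z W : Cplx V) : (Z + W).im = Z.im + W.im := rfl
@[simp] theorem neg_re (Z : Cplx V) : (-Z).re = -Z.re := rfl
@[simp] theorem neg_im (Z : Cplx V) : (-Z).im = -Z.im := rfl
instance : AddCommGroup (Cplx V) where
  add_assoc a b c := by ext <;> simp [add_assoc]
  zero_add a := by ext <;> simp
  add_zero a := by ext <;> simp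
  add_comm a b := by ext <;> simp [add_comm]
  neg_add_cancel a := by ext <;> simp
  nsmul := nsmulRec
  zsmul := zsmulRec

variable [Module ℝ V]

instance : SMul ℂ (Cplx V) :=
  ⟨fun c Z => ⟨c.re • Z.re - c.im • Z.im, c.re • Z.im + c.im • Z.re⟩⟩

@[simp] theorem smul_re (c : ℂ) (Z : Cplx V) : (c • Z).re = c.re • Z.re - c.im • Z.im := rfl
@[simp] theorem smul_im (c : ℂ) (Z : Cplx V) : (c • Z).im = c.re • Z.im + c.im • Z.re := rfl

instance : Module ℂ (Cplx V) where
  one_smul Z := by ext <;> simp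
  mul_smul a b Z := by ext <;> simp <;> module
  smul_zero a := by ext <;> simp
  smul_add a Z W := by ext <;> simp <;> module
  add_smul a b Z := by ext <;> simp <;> module
  zero_smul Z := by ext <;> simp

/-- A real vector, regarded as a complex one. -/
def ofReal (v : V) : Cplx V := ⟨v, 0⟩

/-- Complex conjugation. -/
def conj (Z : Cplx V) : Cplx V := ⟨Z.re, -Z.im⟩

/-- The complex-bilinear extension of a real-bilinear scalar-valued map. -/
def bilin (B : V → V → ℝ) (Z W : Cplx V) : ℂ :=
  ⟨B Z.re W.re - B Z.im W.im, B Z.re W.im + B Z.im W.re⟩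

/-- The complex-bilinear extension of a real-bilinear vector-valued map. -/
def bilinV (B : V → V → V) (Z W : Cplx V) : Cplx V :=
  ⟨B Z.re W.re - B Z.im W.im, B Z.re W.im + B Z.im W.re⟩

/-- The complex-linear extension of a real covector. -/
def covec (α : V →ₗ[ℝ] ℝ) : Cplx V →ₗ[ℂ] ℂ where
  toFun Z := ⟨α Z.re, α Z.im⟩
  map_add' Z W := by apply Complex.ext <;> simp
  map_smul' c Z := by apply Complex.ext <;> simp

/-- The exterior product `c 0 ∧ c 1 ∧ ⋯` of complex covectors (determinant convention). -/
def wedge {k : ℕ} (c : Fin k → (Cplx V →ₗ[ℂ] ℂ)) : Cplx V [⋀^Fin k]→ₗ[ℂ] ℂ :=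
  (Matrix.detRowAlternating (n := Fin k) (R := ℂ)).compLinearMap (LinearMap.pi c)

end Cplx

/-! ### Vector fields, 1-forms, flows -/

section Manifold

variable (E : Type*) [NormedAddCommGroup E] [NormedSpace ℝ E]
  (M : Type*) [TopologicalSpace M] [ChartedSpace E M]

/-- Vector fields on `M` (not necessarily smooth). -/
abbrev VField := ∀ x : M, TangentSpace 𝓘(ℝ, E) x

/-- Sections of the complexified tangent bundle (not necessarily smooth). -/
abbrev CVField := ∀ x : M, Cplx (TangentSpace 𝓘(ℝ, E) x)

/-- 1-forms on `M` (not necessarily smooth). -/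
abbrev OneForm := ∀ x : M, TangentSpace 𝓘(ℝ, E) x →L[ℝ] ℝ

variable {E M} [IsManifold 𝓘(ℝ, E) ∞ M]

def VField.Smooth (X : VField E M) : Prop :=
  ContMDiff 𝓘(ℝ, E) 𝓘(ℝ, E).tangent ∞ (fun x => (⟨x, X x⟩ : TangentBundle 𝓘(ℝ, E) M))

def CVField.Smooth (Z : CVField E M) : Prop :=
  VField.Smooth (fun x => (Z x).re) ∧ VField.Smooth (fun x => (Z x).im)

def OneForm.Smooth (θ : OneForm E M) : Prop :=
  ContMDiff 𝓘(ℝ, E) (𝓘(ℝ, E).prod 𝓘(ℝ, E →L[ℝ] ℝ)) ∞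
    (fun x => TotalSpace.mk' (E →L[ℝ] ℝ)
      (E := fun x : M => TangentSpace 𝓘(ℝ, E) x →L[ℝ] ℝ) x (θ x))

/-- The exterior derivative `dθ(v, w) = v(θ(W)) - w(θ(V)) - θ([V, W])` of a 1-form at `x`, where
`V`, `W` are vector fields, smooth near `x`, extending the tangent vectors `v`, `w`. -/
def OneForm.d (θ : OneForm E M) (x : M) (v w : TangentSpace 𝓘(ℝ, E) x) : ℝ :=
  mvfderiv 𝓘(ℝ, E) (fun y => θ y (FiberBundle.extend E w y)) x v
    - mvfderiv 𝓘(ℝ, E) (fun y => θ y (FiberBundle.extend E v y)) x w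
    - θ x (mlieBracket 𝓘(ℝ, E) (FiberBundle.extend E v) (FiberBundle.extend E w) x)

/-- The derivative `Zg` of a complex function along a complex tangent vector. -/
def cderiv (g : M → ℂ) {x : M} (Z : Cplx (TangentSpace 𝓘(ℝ, E) x)) : ℂ :=
  mvfderiv 𝓘(ℝ, E) g x Z.re + Complex.I * mvfderiv 𝓘(ℝ, E) g x Z.im

/-- The complex-bilinear extension of the Lie bracket to complex vector fields. -/
def cbracket (Z W : CVField E M) (x : M) : Cplx (TangentSpace 𝓘(ℝ, E) x) :=
  ⟨mlieBracket 𝓘(ℝ, E) (fun y => (Z y).re) (fun y => (W y).re) x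
      - mlieBracket 𝓘(ℝ, E) (fun y => (Z y).im) (fun y => (W y).im) x,
    mlieBracket 𝓘(ℝ, E) (fun y => (Z y).re) (fun y => (W y).im) x
      + mlieBracket 𝓘(ℝ, E) (fun y => (Z y).im) (fun y => (W y).re) x⟩

/-- The complex-bilinear extension `∇_Z W` of a connection of `TM` (Mathlib writes `∇ Y x (X x)`
for `∇_X Y`). -/
def ccov (nab : CovariantDerivative 𝓘(ℝ, E) E (TangentSpace 𝓘(ℝ, E) : M → Type _))
    (Z W : CVField E M) (x : M) : Cplx (TangentSpace 𝓘(ℝ, E) x) :=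
  ⟨nab (fun y => (W y).re) x (Z x).re - nab (fun y => (W y).im) x (Z x).im,
    nab (fun y => (W y).im) x (Z x).re + nab (fun y => (W y).re) x (Z x).im⟩

/-- `Fl`, restricted to the open set `𝒟 ⊆ ℝ × M`, is a (local) flow of the vector field `X`:
`t ↦ Fl t x` is, on an open interval around `0`, the integral curve of `X` starting at `x`.
If `X` is complete, `𝒟 = ℝ × M` is allowed. -/
structure IsFlow (X : VField E M) (𝒟 : Set (ℝ × M)) (Fl : ℝ → M → M) : Prop where
  isOpen : IsOpen 𝒟
  zero_mem : ∀ x, ((0 : ℝ), x) ∈ 𝒟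
  interval : ∀ x, IsPreconnected {t : ℝ | (t, x) ∈ 𝒟}
  smooth : ContMDiffOn (𝓘(ℝ, ℝ).prod 𝓘(ℝ, E)) 𝓘(ℝ, E) ∞ (fun q : ℝ × M => Fl q.1 q.2) 𝒟
  map_zero : ∀ x, Fl 0 x = x
  integral : ∀ x, IsMIntegralCurveOn (fun t => Fl t x) X {t : ℝ | (t, x) ∈ 𝒟}

/-! ### Contact structures and compatible almost CR structures -/

variable (E M) in
/-- A cooriented contact structure `H` on `M`. The coorientation is recorded by the set `pos x` of
positive elements of the line of covectors at `x` annihilating `H x`. -/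
structure ContactStructure where
  H : ∀ x : M, Submodule ℝ (TangentSpace 𝓘(ℝ, E) x)
  pos : ∀ x : M, Set (TangentSpace 𝓘(ℝ, E) x →L[ℝ] ℝ)
  contact : ∃ θ : OneForm E M, θ.Smooth ∧ ∀ x,
    θ x ≠ 0 ∧ (∀ v, v ∈ H x ↔ θ x v = 0) ∧ pos x = {α | ∃ c : ℝ, 0 < c ∧ α = c • θ x} ∧
      ∀ v ∈ H x, (∀ w ∈ H x, θ.d x v w = 0) → v = 0

namespace ContactStructure

variable (C : ContactStructure E M)

/-- The contact forms of the cooriented contact structure. -/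
def IsContactForm (θ : OneForm E M) : Prop := θ.Smooth ∧ ∀ x, θ x ∈ C.pos x

/-- `T` is the Reeb vector field of `θ`. -/
structure IsReeb (θ : OneForm E M) (T : VField E M) : Prop where
  smooth : VField.Smooth T
  apply : ∀ x, θ x (T x) = 1
  contract : ∀ x v, θ.d x (T x) v = 0

/-- An endomorphism `j` of `T_xM` restricts to a complex structure of `H x` for which the Levi form
`(v, w) ↦ dθ(v, j w)` is a positive definite Hermitian form on `H x`. Only the restriction of `j`
to `H x` matters. -/
structure IsCompatibleAt (x : M)
    (j : TangentSpace 𝓘(ℝ, E) x →ₗ[ℝ] TangentSpace 𝓘(ℝ, E) x) : Prop where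
  maps : ∀ v ∈ C.H x, j v ∈ C.H x
  sq : ∀ v ∈ C.H x, j (j v) = -v
  symm : ∀ θ, C.IsContactForm θ → ∀ v ∈ C.H x, ∀ w ∈ C.H x, θ.d x v (j w) = θ.d x w (j v)
  herm : ∀ θ, C.IsContactForm θ → ∀ v ∈ C.H x, ∀ w ∈ C.H x,
    θ.d x (j v) (j (j w)) = θ.d x v (j w)
  posDef : ∀ θ, C.IsContactForm θ → ∀ v ∈ C.H x, v ≠ 0 → 0 < θ.d x v (j v)

/-- `H^{1,0}` at `x`: the `i`-eigenspace of `j` on `ℂH`. -/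
def H10 (x : M) (j : TangentSpace 𝓘(ℝ, E) x →ₗ[ℝ] TangentSpace 𝓘(ℝ, E) x) :
    Submodule ℂ (Cplx (TangentSpace 𝓘(ℝ, E) x)) where
  carrier := {Z | Z.re ∈ C.H x ∧ Z.im ∈ C.H x ∧
    (⟨j Z.re, j Z.im⟩ : Cplx (TangentSpace 𝓘(ℝ, E) x)) = Complex.I • Z}
  zero_mem' := by
    refine ⟨Submodule.zero_mem _, Submodule.zero_mem _, ?_⟩
    ext <;> simp
  add_mem' := by
    rintro Z W ⟨h1, h2, h3⟩ ⟨h4, h5, h6⟩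
    refine ⟨Submodule.add_mem _ h1 h4, Submodule.add_mem _ h2 h5, ?_⟩
    rw [smul_add, ← h3, ← h6]
    ext <;> simp
  smul_mem' := by
    rintro c Z ⟨h1, h2, h3⟩
    refine ⟨Submodule.sub_mem _ (Submodule.smul_mem _ _ h1) (Submodule.smul_mem _ _ h2),
      Submodule.add_mem _ (Submodule.smul_mem _ _ h2) (Submodule.smul_mem _ _ h1), ?_⟩
    rw [smul_comm, ← h3]
    ext <;> simp

/-- `H^{0,1}` at `x`: the `(-i)`-eigenspace of `j` on `ℂH`. -/
def H01 (x : M) (j : TangentSpace 𝓘(ℝ, E) x →ₗ[ℝ] TangentSpace 𝓘(ℝ, E) x) :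
    Submodule ℂ (Cplx (TangentSpace 𝓘(ℝ, E) x)) where
  carrier := {Z | Z.re ∈ C.H x ∧ Z.im ∈ C.H x ∧
    (⟨j Z.re, j Z.im⟩ : Cplx (TangentSpace 𝓘(ℝ, E) x)) = (-Complex.I) • Z}
  zero_mem' := by
    refine ⟨Submodule.zero_mem _, Submodule.zero_mem _, ?_⟩
    ext <;> simp
  add_mem' := by
    rintro Z W ⟨h1, h2, h3⟩ ⟨h4, h5, h6⟩
    refine ⟨Submodule.add_mem _ h1 h4, Submodule.add_mem _ h2 h5, ?_⟩
    rw [smul_add, ← h3, ← h6]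
    ext <;> simp
  smul_mem' := by
    rintro c Z ⟨h1, h2, h3⟩
    refine ⟨Submodule.sub_mem _ (Submodule.smul_mem _ _ h1) (Submodule.smul_mem _ _ h2),
      Submodule.add_mem _ (Submodule.smul_mem _ _ h2) (Submodule.smul_mem _ _ h1), ?_⟩
    rw [smul_comm, ← h3]
    ext <;> simp

/-- `φ : H^{1,0} → H^{0,1}` (formed with `j`) is the deformation tensor at `x` of the complex
structure `j'` of `H x` relative to `j`: the `(1,0)`-space of `j'` is `{Z + φ(Z) | Z ∈ H^{1,0}}`. -/
def IsDeformationTensor (x : M) (j j' : TangentSpace 𝓘(ℝ, E) x →ₗ[ℝ] TangentSpace 𝓘(ℝ, E) x)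
    (φ : C.H10 x j →ₗ[ℂ] C.H01 x j) : Prop :=
  ∀ W, W ∈ C.H10 x j' ↔
    ∃ Z : C.H10 x j, W = (Z : Cplx (TangentSpace 𝓘(ℝ, E) x)) + φ Z

end ContactStructure

/-- A compatible almost CR structure on the contact manifold `(M, H)`: a smooth complex structure
of `H` whose Levi form is a positive definite Hermitian form. Here `J x` is an endomorphism
of `T_xM`, of which only the restriction to `H x` is meaningful and used. -/
structure AlmostCR (C : ContactStructure E M) where
  J : ∀ x : M, TangentSpace 𝓘(ℝ, E) x →ₗ[ℝ] TangentSpace 𝓘(ℝ, E) x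
  smooth : ∀ X : VField E M, VField.Smooth X → (∀ x, X x ∈ C.H x) →
    VField.Smooth (fun x => J x (X x))
  compatible : ∀ x, C.IsCompatibleAt x (J x)

namespace AlmostCR

variable {C : ContactStructure E M} (S : AlmostCR C)

/-- The Levi form `h(v, w) = dθ(v, J w)`. -/
def levi (θ : OneForm E M) (x : M) (v w : TangentSpace 𝓘(ℝ, E) x) : ℝ := θ.d x v (S.J x w)

/-- The complex-bilinear extension of the Levi form. -/
def clevi (θ : OneForm E M) (x : M) (Z W : Cplx (TangentSpace 𝓘(ℝ, E) x)) : ℂ :=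
  Cplx.bilin (S.levi θ x) Z W

/-- The projection `ℂH = H^{1,0} ⊕ H^{0,1} → H^{0,1}`, `V ↦ (V + i J V) / 2`. -/
def proj01 (x : M) (V : Cplx (TangentSpace 𝓘(ℝ, E) x)) : Cplx (TangentSpace 𝓘(ℝ, E) x) :=
  (1 / 2 : ℂ) • (V + Complex.I • (⟨S.J x V.re, S.J x V.im⟩ : Cplx (TangentSpace 𝓘(ℝ, E) x)))

/-- Smooth sections of `H^{1,0}`. -/
def IsSection10 (Z : CVField E M) : Prop := CVField.Smooth Z ∧ ∀ x, Z x ∈ C.H10 x (S.J x)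

/-! #### Densities of weight `(1,1)` -/

/-- The fibre at `x` of the canonical bundle: complex `(n+1)`-forms that vanish when contracted
with an element of `H^{0,1}`, where `dim M = 2n+1`. -/
def canonical (n : ℕ) (x : M) :
    Submodule ℂ (Cplx (TangentSpace 𝓘(ℝ, E) x) [⋀^Fin (n + 1)]→ₗ[ℂ] ℂ) where
  carrier := {ζ | ∀ v : Fin (n + 1) → Cplx (TangentSpace 𝓘(ℝ, E) x),
    v 0 ∈ C.H01 x (S.J x) → ζ v = 0}
  zero_mem' := by intro v _; rfl
  add_mem' := by
    intro a b ha hb v hv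
    rw [AlternatingMap.add_apply, ha v hv, hb v hv, add_zero]
  smul_mem' := by
    intro c a ha v hv
    rw [AlternatingMap.smul_apply, ha v hv, smul_zero]

/-- `(c α)` is a unitary admissible coframe at `x` with respect to `θ`: it is dual to a unitary frame
of `H^{1,0}` and annihilates `H^{0,1}` and the Reeb direction. -/
def IsUnitaryCoframe (θ : OneForm E M) (n : ℕ) (x : M)
    (c : Fin n → (Cplx (TangentSpace 𝓘(ℝ, E) x) →ₗ[ℂ] ℂ)) : Prop :=
  (∃ Z : Fin n → Cplx (TangentSpace 𝓘(ℝ, E) x), (∀ a, Z a ∈ C.H10 x (S.J x)) ∧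
    (∀ a b, S.clevi θ x (Z a) (Z b).conj = if a = b then 1 else 0) ∧
    ∀ a b, c a (Z b) = if a = b then 1 else 0) ∧
  (∀ a, ∀ V ∈ C.H01 x (S.J x), c a V = 0) ∧
  ∀ a, ∀ v : TangentSpace 𝓘(ℝ, E) x, (∀ w, θ.d x v w = 0) → c a (Cplx.ofReal v) = 0

/-- `f` is the trivialization with respect to `θ` of the `(1,1)`-density given by the function `F`
on the canonical bundle: `f` is the value of `F` at `ζ = θ ∧ θ¹ ∧ ⋯ ∧ θⁿ`, for `(θ^α)` any unitary
admissible coframe. -/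
def Trivializes (n : ℕ) (F : ∀ x : M, S.canonical n x → ℝ) (θ : OneForm E M) (f : M → ℝ) : Prop :=
  ∀ x c, S.IsUnitaryCoframe θ n x c → ∀ ζ : S.canonical n x,
    (ζ : Cplx (TangentSpace 𝓘(ℝ, E) x) [⋀^Fin (n + 1)]→ₗ[ℂ] ℂ)
      = Cplx.wedge (Fin.cons (Cplx.covec (θ x).toLinearMap) c) → f x = F x ζ

/-- Smooth sections of `Re 𝓔(1,1)`, where `𝓔(1,1) = 𝓔(1,0) ⊗ conj 𝓔(1,0)` and `𝓔(1,0)` is the dual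
of an `(n+2)`-nd root of the canonical bundle `K`. A real element of the fibre of `𝓔(1,1)` at `x`
is the same as a real function `F` of the nonzero `ζ ∈ K_x` (its coefficient with respect to
`|ζ|^{-2/(n+2)}`) with `F(λ ζ) = |λ|^{2/(n+2)} F(ζ)`; the value at `ζ = 0` has no meaning. -/
structure Density (n : ℕ) where
  toFun : ∀ x : M, S.canonical n x → ℝ
  homog : ∀ x (l : ℂ) (ζ : S.canonical n x), l ≠ 0 → ζ ≠ 0 →
    toFun x (l • ζ) = ‖l‖ ^ ((2 : ℝ) / (n + 2)) * toFun x ζ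
  smooth : ∀ θ f, C.IsContactForm θ → S.Trivializes n toFun θ f →
    ContMDiff 𝓘(ℝ, E) 𝓘(ℝ, ℝ) ∞ f

/-- `X` is the contact Hamiltonian vector field of the density `F`: in terms of a contact form `θ`
and the trivialization `f` of `F`, `θ(X) = f` and `dθ(X, Y) = -df(Y)` for `Y ∈ H`. -/
def IsContactHamiltonian {n : ℕ} (F : S.Density n) (X : VField E M) : Prop :=
  VField.Smooth X ∧ ∃ θ f, C.IsContactForm θ ∧ S.Trivializes n F.toFun θ f ∧
    ∀ x, θ x (X x) = f x ∧ ∀ v ∈ C.H x, θ.d x (X x) v = -mvfderiv 𝓘(ℝ, E) f x v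

/-- `J_t = (Fl_t⁻¹)_* ∘ J ∘ (Fl_t)_*` at `p`. -/
def transport (φ : M → M) (p : M) :
    TangentSpace 𝓘(ℝ, E) p →ₗ[ℝ] TangentSpace 𝓘(ℝ, E) p :=
  (mfderiv 𝓘(ℝ, E) 𝓘(ℝ, E) φ p).inverse.toLinearMap ∘ₗ S.J (φ p) ∘ₗ
    (mfderiv 𝓘(ℝ, E) 𝓘(ℝ, E) φ p).toLinearMap

/-! #### Pseudohermitian geometry and the CR Killing operator -/

section TanakaWebster

variable [FiniteDimensional ℝ E]

/-- `nab` is the Tanaka–Webster connection of `θ` (with Reeb vector field `T`): it preserves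
`TM = H ⊕ ℝT`, makes `T`, `J`, `h` parallel, and its torsion `τ` satisfies
`τ(Z, W) ∈ H^{0,1}`, `τ(Z, V) = i h(Z, V) T`, `τ(T, Z) ∈ H^{0,1}` for `Z, W ∈ H^{1,0}`,
`V ∈ H^{0,1}`. -/
structure IsTanakaWebster (θ : OneForm E M) (T : VField E M)
    (nab : CovariantDerivative 𝓘(ℝ, E) E (TangentSpace 𝓘(ℝ, E) : M → Type _)) : Prop where
  preserves : ∀ Y : VField E M, VField.Smooth Y → (∀ x, Y x ∈ C.H x) → ∀ x v, nab Y x v ∈ C.H x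
  reeb : ∀ x v, nab T x v = 0
  complex : ∀ Y : VField E M, VField.Smooth Y → (∀ x, Y x ∈ C.H x) →
    ∀ x v, nab (fun y => S.J y (Y y)) x v = S.J x (nab Y x v)
  metric : ∀ Y W : VField E M, VField.Smooth Y → (∀ x, Y x ∈ C.H x) →
    VField.Smooth W → (∀ x, W x ∈ C.H x) → ∀ x v,
      mvfderiv 𝓘(ℝ, E) (fun y => S.levi θ y (Y y) (W y)) x v
        = S.levi θ x (nab Y x v) (W x) + S.levi θ x (Y x) (nab W x v)
  torsion_two : ∀ x, ∀ Z ∈ C.H10 x (S.J x), ∀ W ∈ C.H10 x (S.J x),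
    Cplx.bilinV (fun v w => nab.torsion x v w) Z W ∈ C.H01 x (S.J x)
  torsion_mixed : ∀ x, ∀ Z ∈ C.H10 x (S.J x), ∀ V ∈ C.H01 x (S.J x),
    Cplx.bilinV (fun v w => nab.torsion x v w) Z V
      = (Complex.I * S.clevi θ x Z V) • Cplx.ofReal (T x)
  torsion_reeb : ∀ x, ∀ Z ∈ C.H10 x (S.J x),
    Cplx.bilinV (fun v w => nab.torsion x v w) (Cplx.ofReal (T x)) Z ∈ C.H01 x (S.J x)

/-- The Tanaka–Webster torsion tensor `A_{αβ} Z^α W^β = h(W, A(Z))`, where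
`A(Z) = A_α^{β̄} Z^α Z_{β̄} = τ(T, Z)`. -/
def torsionA (θ : OneForm E M) (T : VField E M)
    (nab : CovariantDerivative 𝓘(ℝ, E) E (TangentSpace 𝓘(ℝ, E) : M → Type _))
    (Z W : CVField E M) (x : M) : ℂ :=
  S.clevi θ x (W x)
    (Cplx.bilinV (fun v w => nab.torsion x v w) (Cplx.ofReal (T x)) (Z x))

/-- The lowered Nijenhuis tensor `N_{γαβ} V^γ Z^α W^β = h(V, N(Z, W))`, where `N(Z, W)` is minus the
`(0,1)`-part of `[Z, W]`, for sections `Z`, `W` of `H^{1,0}` and `V ∈ H^{1,0}` at `x`. -/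
def nijenhuis (θ : OneForm E M) (x : M) (V : Cplx (TangentSpace 𝓘(ℝ, E) x))
    (Z W : CVField E M) : ℂ :=
  S.clevi θ x V (-S.proj01 x (cbracket Z W x))

/-- The second covariant derivative `Z^α W^β ∇_α ∇_β f = Z(Wf) - (∇_Z W)f`. -/
def hessian (nab : CovariantDerivative 𝓘(ℝ, E) E (TangentSpace 𝓘(ℝ, E) : M → Type _))
    (f : M → ℝ) (Z W : CVField E M) (x : M) : ℂ :=
  cderiv (fun y => cderiv (fun z => (f z : ℂ)) (W y)) (Z x)
    - cderiv (fun z => (f z : ℂ)) (ccov nab Z W x)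

/-- The section `f^γ Z_γ = (∇^γ f) Z_γ` of `H^{1,0}`: the unique `G ∈ H^{1,0}` with `h(G, V) = Vf` for
all `V ∈ H^{0,1}`. -/
def grad10 (θ : OneForm E M) (f : M → ℝ) (x : M) : Cplx (TangentSpace 𝓘(ℝ, E) x) :=
  Classical.epsilon fun G => G ∈ C.H10 x (S.J x) ∧
    ∀ V ∈ C.H01 x (S.J x), S.clevi θ x G V = cderiv (fun z => (f z : ℂ)) V

/-- The CR Killing operator, trivialized by `θ`: the contraction with `Z^α W^β` of
`i ∇_{(α} ∇_{β)} f - A_{αβ} f + i N_{(αβ)γ} ∇^γ f`, for sections `Z`, `W` of `H^{1,0}`. This is the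
`(αβ)`-component of `Df`; as `Df` is real, its other component is the complex conjugate. -/
def crKilling (θ : OneForm E M) (T : VField E M)
    (nab : CovariantDerivative 𝓘(ℝ, E) E (TangentSpace 𝓘(ℝ, E) : M → Type _))
    (f : M → ℝ) (Z W : CVField E M) (x : M) : ℂ :=
  Complex.I * ((hessian nab f Z W x + hessian nab f W Z x) / 2)
    - S.torsionA θ T nab Z W x * f x
    + Complex.I * ((S.nijenhuis θ x (Z x) W (S.grad10 θ f)
        + S.nijenhuis θ x (W x) Z (S.grad10 θ f)) / 2)

end TanakaWebster

end AlmostCR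

end Manifold

end

open Set Filter Bundle Topology Module VectorField
open scoped Manifold ContDiff

set_option linter.unusedSectionVars false
set_option linter.unusedVariables false

/-! Let `Z` be a section of `H^{1,0}`. Its pullback `U_t` under `Fl_t` lies in the `(1,0)`-space of
`J_t`, so `φ_t` sends the `(1,0)`-part of `U_t` to its `(0,1)`-part. At `t = 0` one has `U_0 = Z`
and `φ_0 = 0`, while `U_t` has derivative `[X, Z]`; hence `ψ(Z)` is the `(0,1)`-part of `[X, Z]`.
Since `dθ` vanishes on `H^{1,0} × H^{1,0}` and `J = -i` on `H^{0,1}`, lowering the index removes the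
projection: `h(W, ψ(Z)) = -i dθ(W, [X, Z])`. This is `IsFlow.hasDerivAt_deformationTensor`, up to
the factor `-i`.

It remains to expand this bracket with the Tanaka–Webster connection
(`IsTanakaWebster.dC_cbracket_eq`). Write `X = Y + fT` with `Y` in `H`, so that `df(V) = dθ(V, Y)`
on `H`, and use `[X, Z] = ∇_X Z - ∇_Z X - τ(X, Z)`. Paired with `W ∈ H^{1,0}` under `dθ`, all of
`H^{1,0}` and `T` drop out, in particular `∇_X Z`. As `dθ` is parallel on `H`, the term `∇_Z X`
gives the Hessian of `f`. The summand `f τ(T, Z)` gives `A`, and `τ(Y, Z)` gives the Nijenhuis term,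
because `Y = iG - i conj G` with `G = f^γ Z_γ` and `τ(conj G, Z)` is a multiple of `T`. The result
is automatically symmetric in `Z` and `W`: the Lie derivative along `X` of `dθ` is a multiple of
`dθ` on `H`, so isotropy of `H^{1,0}` gives `dθ([X, Z], W) + dθ(Z, [X, W]) = 0`. Averaging over both
orders yields `crKilling_eq`.

For the existence statement, the flow of a contact field multiplies `θ`, and `dθ` on `H`, by the
same positive factor (`IsFlow.eventually_conformal`), so `J_t` is again compatible. Its
`(1,0)`-space meets `H^{0,1}` trivially by positivity of both Levi forms, so it is a graph over
`H^{1,0}` (`existsUnique_deformationTensor`). Finally, `X` is specified through one contact form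
only; `Density.trivializes_eq_mul` shows that `f` and `θ(X)` rescale alike, so any `θ` may be used.
-/

noncomputable section

/-! ### Exterior derivative of a 1-form as a tensor. -/

section OneFormCalculus

variable {E : Type*} [NormedAddCommGroup E] [NormedSpace ℝ E]
  {M : Type*} [TopologicalSpace M] [ChartedSpace E M] [IsManifold 𝓘(ℝ, E) ∞ M]

/-- The vector field `X` is differentiable at `x`. -/
abbrev VField.DiffAt (X : VField E M) (x : M) : Prop :=
  MDifferentiableAt 𝓘(ℝ, E) 𝓘(ℝ, E).tangent
    (fun y => (⟨y, X y⟩ : TangentBundle 𝓘(ℝ, E) M)) x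

/-- The vector field `X` is smooth at `x`. -/
abbrev VField.SmoothAt (X : VField E M) (x : M) : Prop :=
  ContMDiffAt 𝓘(ℝ, E) 𝓘(ℝ, E).tangent ∞
    (fun y => (⟨y, X y⟩ : TangentBundle 𝓘(ℝ, E) M)) x

theorem VField.Smooth.diffAt {X : VField E M} (hX : X.Smooth) (x : M) : X.DiffAt x :=
  (hX x).mdifferentiableAt (by simp)

theorem VField.SmoothAt.diffAt {X : VField E M} {x : M} (hX : X.SmoothAt x) : X.DiffAt x :=
  hX.mdifferentiableAt (by simp)

theorem VField.DiffAt.smul {X : VField E M} {f : M → ℝ} {x : M}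
    (hf : MDifferentiableAt 𝓘(ℝ, E) 𝓘(ℝ, ℝ) f x) (hX : X.DiffAt x) :
    VField.DiffAt (fun y => f y • X y) x :=
  hf.smul_section hX

theorem VField.Smooth.neg {X : VField E M} (hX : X.Smooth) : VField.Smooth (fun y => -X y) :=
  ContMDiff.neg_section hX

theorem VField.Smooth.sub {X Y : VField E M} (hX : X.Smooth) (hY : Y.Smooth) :
    VField.Smooth (fun y => X y - Y y) :=
  ContMDiff.sub_section hX hY

theorem VField.Smooth.smul {X : VField E M} {f : M → ℝ} (hf : ContMDiff 𝓘(ℝ, E) 𝓘(ℝ, ℝ) ∞ f)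
    (hX : X.Smooth) : VField.Smooth (fun y => f y • X y) :=
  ContMDiff.smul_section hf hX

theorem VField.Smooth.const_smul {X : VField E M} (c : ℝ) (hX : X.Smooth) :
    VField.Smooth (fun y => c • X y) :=
  ContMDiff.const_smul_section hX

omit [IsManifold 𝓘(ℝ, E) ∞ M] in
theorem isManifold_minSmoothness [IsManifold 𝓘(ℝ, E) ∞ M] (k : ℕ) :
    IsManifold 𝓘(ℝ, E) (minSmoothness ℝ k) M := by
  rw [minSmoothness_of_isRCLikeNormedField]
  exact IsManifold.of_le (n := ∞) (by exact_mod_cast le_top)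

theorem VField.Smooth.mlieBracket [CompleteSpace E] {X Y : VField E M} (hX : X.Smooth)
    (hY : Y.Smooth) : VField.Smooth (mlieBracket 𝓘(ℝ, E) X Y) := by
  have : IsManifold 𝓘(ℝ, E) (minSmoothness ℝ 2) M := isManifold_minSmoothness 2
  have : IsManifold 𝓘(ℝ, E) (((⊤ : ℕ∞) : ℕ∞ω) + 1) M := by simpa
  exact ContDiff.mlieBracket_vectorField (m := ⊤) (n := ⊤) hX hY (by simp)

theorem OneForm.Smooth.contMDiffAt_apply {θ : OneForm E M} (hθ : θ.Smooth) {X : VField E M} {x : M}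
    (hX : X.SmoothAt x) : ContMDiffAt 𝓘(ℝ, E) 𝓘(ℝ, ℝ) ∞ (fun y => θ y (X y)) x := by
  have := ContMDiffAt.clm_bundle_apply (F₁ := E) (F₂ := ℝ)
    (E₁ := fun x : M => TangentSpace 𝓘(ℝ, E) x) (E₂ := fun _ : M => ℝ) (b := fun y : M => y)
    (ϕ := θ) (v := X) (hθ x) hX
  exact (contMDiffAt_section x).1 this

theorem OneForm.Smooth.mdifferentiableAt_apply {θ : OneForm E M} (hθ : θ.Smooth) {X : VField E M}
    {x : M} (hX : X.DiffAt x) : MDifferentiableAt 𝓘(ℝ, E) 𝓘(ℝ, ℝ) (fun y => θ y (X y)) x := by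
  have := MDifferentiableAt.clm_bundle_apply (F₁ := E) (F₂ := ℝ)
    (E₁ := fun x : M => TangentSpace 𝓘(ℝ, E) x) (E₂ := fun _ : M => ℝ) (b := fun y : M => y)
    (ϕ := θ) (v := X) ((hθ x).mdifferentiableAt (by simp)) hX
  exact (mdifferentiableAt_section (F := ℝ) (E := fun _ : M => ℝ) 𝓘(ℝ, E)
    (fun y => θ y (X y))).1 this

namespace OneForm

theorem d_swap (θ : OneForm E M) (x : M) (v w : TangentSpace 𝓘(ℝ, E) x) :
    θ.d x v w = -θ.d x w v := by
  unfold OneForm.d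
  rw [mlieBracket_swap_apply, map_neg]
  ring

theorem d_self (θ : OneForm E M) (x : M) (v : TangentSpace 𝓘(ℝ, E) x) : θ.d x v v = 0 := by
  linarith [θ.d_swap x v v]

/-- The expression defining the exterior derivative, as an operation on vector fields. -/
def dField (θ : OneForm E M) (x : M) (V W : VField E M) : ℝ :=
  mvfderiv 𝓘(ℝ, E) (fun y => θ y (W y)) x (V x) - mvfderiv 𝓘(ℝ, E) (fun y => θ y (V y)) x (W x)
    - θ x (mlieBracket 𝓘(ℝ, E) V W x)

theorem dField_swap (θ : OneForm E M) (x : M) (V W : VField E M) :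
    θ.dField x V W = -θ.dField x W V := by
  unfold OneForm.dField
  rw [mlieBracket_swap_apply, map_neg]
  ring

variable [FiniteDimensional ℝ E]

/-- When `V` is multiplied by `f`, the term `(Wf) θ(V)` from differentiating `θ(fV)` cancels the one
from the bracket. This frees `OneForm.d` from the particular extensions in its definition. -/
theorem Smooth.tensorialAt_left {θ : OneForm E M} (hθ : θ.Smooth) {x : M} {W : VField E M}
    (hW : W.DiffAt x) : TensorialAt 𝓘(ℝ, E) E (fun V : VField E M => θ.dField x V W) x where
  smul {f V} hf hV := by
    have : CompleteSpace E := FiniteDimensional.complete ℝ E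
    have h1 : (fun y => θ y ((f • V) y)) = f • (fun y => θ y (V y)) := by
      ext y; simp
    unfold dField
    rw [h1, mvfderiv_smul hf (hθ.mdifferentiableAt_apply hV), mlieBracket_smul_left hf hV]
    simp
    ring
  add {V V'} hV hV' := by
    have : CompleteSpace E := FiniteDimensional.complete ℝ E
    have h1 : (fun y => θ y ((V + V') y)) = (fun y => θ y (V y)) + (fun y => θ y (V' y)) := by
      ext y; simp
    unfold dField
    rw [h1, mvfderiv_add (hθ.mdifferentiableAt_apply hV) (hθ.mdifferentiableAt_apply hV'),
      mlieBracket_add_left hV hV']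
    simp
    ring

theorem Smooth.tensorialAt_right {θ : OneForm E M} (hθ : θ.Smooth) {x : M} {V : VField E M}
    (hV : V.DiffAt x) : TensorialAt 𝓘(ℝ, E) E (fun W : VField E M => θ.dField x V W) x where
  smul {f W} hf hW := by
    have := (hθ.tensorialAt_left hV).smul hf hW
    rw [dField_swap, this, θ.dField_swap x V W]
    simp
  add {W W'} hW hW' := by
    have := (hθ.tensorialAt_left hV).add hW hW'
    rw [dField_swap, this, θ.dField_swap x V W, θ.dField_swap x V W']
    ring

theorem Smooth.d_eq_mkHom₂ {θ : OneForm E M} (hθ : θ.Smooth) (x : M)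
    (v w : TangentSpace 𝓘(ℝ, E) x) :
    θ.d x v w = TensorialAt.mkHom₂ (θ.dField x) x (fun _ h => hθ.tensorialAt_left h)
      (fun _ h => hθ.tensorialAt_right h) v w := by
  rw [TensorialAt.mkHom₂_apply_eq_extend]
  simp [OneForm.d, dField]

/-- The exterior derivative may be computed with any extensions of the tangent vectors. -/
theorem Smooth.d_apply {θ : OneForm E M} (hθ : θ.Smooth) {x : M} {V W : VField E M}
    (hV : V.DiffAt x) (hW : W.DiffAt x) : θ.d x (V x) (W x) = θ.dField x V W := by
  rw [hθ.d_eq_mkHom₂, TensorialAt.mkHom₂_apply _ _ hV hW]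

theorem Smooth.d_add_left {θ : OneForm E M} (hθ : θ.Smooth) (x : M)
    (u v w : TangentSpace 𝓘(ℝ, E) x) : θ.d x (u + v) w = θ.d x u w + θ.d x v w := by
  simp [hθ.d_eq_mkHom₂]

theorem Smooth.d_add_right {θ : OneForm E M} (hθ : θ.Smooth) (x : M)
    (u v w : TangentSpace 𝓘(ℝ, E) x) : θ.d x u (v + w) = θ.d x u v + θ.d x u w := by
  simp [hθ.d_eq_mkHom₂]

theorem Smooth.d_smul_left {θ : OneForm E M} (hθ : θ.Smooth) (x : M) (c : ℝ)
    (v w : TangentSpace 𝓘(ℝ, E) x) : θ.d x (c • v) w = c * θ.d x v w := by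
  simp [hθ.d_eq_mkHom₂]

theorem Smooth.d_smul_right {θ : OneForm E M} (hθ : θ.Smooth) (x : M) (c : ℝ)
    (v w : TangentSpace 𝓘(ℝ, E) x) : θ.d x v (c • w) = c * θ.d x v w := by
  simp [hθ.d_eq_mkHom₂]

theorem Smooth.d_neg_left {θ : OneForm E M} (hθ : θ.Smooth) (x : M)
    (v w : TangentSpace 𝓘(ℝ, E) x) : θ.d x (-v) w = -θ.d x v w := by
  simp [hθ.d_eq_mkHom₂]

theorem Smooth.d_neg_right {θ : OneForm E M} (hθ : θ.Smooth) (x : M)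
    (v w : TangentSpace 𝓘(ℝ, E) x) : θ.d x v (-w) = -θ.d x v w := by
  simp [hθ.d_eq_mkHom₂]

theorem Smooth.d_sub_left {θ : OneForm E M} (hθ : θ.Smooth) (x : M)
    (u v w : TangentSpace 𝓘(ℝ, E) x) : θ.d x (u - v) w = θ.d x u w - θ.d x v w := by
  simp [hθ.d_eq_mkHom₂]

theorem Smooth.d_sub_right {θ : OneForm E M} (hθ : θ.Smooth) (x : M)
    (u v w : TangentSpace 𝓘(ℝ, E) x) : θ.d x u (v - w) = θ.d x u v - θ.d x u w := by
  simp [hθ.d_eq_mkHom₂]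

theorem Smooth.d_zero_left {θ : OneForm E M} (hθ : θ.Smooth) (x : M)
    (w : TangentSpace 𝓘(ℝ, E) x) : θ.d x 0 w = 0 := by
  simp [hθ.d_eq_mkHom₂]

/-- The exterior derivative of a multiple of a 1-form. -/
theorem Smooth.d_smul {θ θ' : OneForm E M} (hθ : θ.Smooth) {l : M → ℝ} (h : ∀ x, θ' x = l x • θ x)
    {x : M} (hl : MDifferentiableAt 𝓘(ℝ, E) 𝓘(ℝ, ℝ) l x) (v w : TangentSpace 𝓘(ℝ, E) x) :
    θ'.d x v w = l x * θ.d x v w + mvfderiv 𝓘(ℝ, E) l x v * θ x w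
      - mvfderiv 𝓘(ℝ, E) l x w * θ x v := by
  have key : ∀ u : TangentSpace 𝓘(ℝ, E) x, (fun y => θ' y (FiberBundle.extend E u y))
      = l • (fun y => θ y (FiberBundle.extend E u y)) := by
    intro u; ext y; simp [h]
  have hd : ∀ u : TangentSpace 𝓘(ℝ, E) x, MDifferentiableAt 𝓘(ℝ, E) 𝓘(ℝ, ℝ)
      (fun y => θ y (FiberBundle.extend E u y)) x := fun u =>
    hθ.mdifferentiableAt_apply (FiberBundle.mdifferentiableAt_extend 𝓘(ℝ, E) E u)
  unfold OneForm.d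
  rw [key, key, mvfderiv_smul hl (hd _), mvfderiv_smul hl (hd _), h]
  simp
  ring

end OneForm

end OneFormCalculus

/-! ### Contact forms and contact vector fields. -/

section ContactForms

variable {E : Type*} [NormedAddCommGroup E] [NormedSpace ℝ E]
  {M : Type*} [TopologicalSpace M] [ChartedSpace E M] [IsManifold 𝓘(ℝ, E) ∞ M]
  {C : ContactStructure E M}

namespace ContactStructure

theorem IsContactForm.exists_smul {θ θ' : OneForm E M} (hθ : C.IsContactForm θ)
    (hθ' : C.IsContactForm θ') : ∃ l : M → ℝ, (∀ x, 0 < l x) ∧ (∀ x, θ' x = l x • θ x) ∧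
      ∀ x, MDifferentiableAt 𝓘(ℝ, E) 𝓘(ℝ, ℝ) l x := by
  obtain ⟨θ₀, -, h₀⟩ := C.contact
  have h1 : ∀ x, ∃ c : ℝ, 0 < c ∧ θ x = c • θ₀ x := fun x => by
    have := hθ.2 x
    rwa [(h₀ x).2.2.1] at this
  have h2 : ∀ x, ∃ c : ℝ, 0 < c ∧ θ' x = c • θ₀ x := fun x => by
    have := hθ'.2 x
    rwa [(h₀ x).2.2.1] at this
  choose a ha ha' using h1
  choose b hb hb' using h2
  have hl : ∀ x, θ' x = (b x / a x) • θ x := fun x => by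
    rw [hb', ha', smul_smul, div_mul_cancel₀ _ (ha x).ne']
  refine ⟨fun x => b x / a x, fun x => div_pos (hb x) (ha x), hl, fun x => ?_⟩
  -- Pointwise choice says nothing about regularity of the factor. Near `x` it equals `θ'(V) / θ(V)`
  -- for a local field `V` with `θ(V) ≠ 0`, which is differentiable.
  obtain ⟨v, hv⟩ : ∃ v, θ x v ≠ 0 := by
    by_contra! hcon
    refine (h₀ x).1 ?_
    ext v
    have := hcon v
    rw [ha'] at this
    simpa [(ha x).ne'] using this
  have hV := FiberBundle.mdifferentiableAt_extend 𝓘(ℝ, E) E v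
  have hd := hθ.1.mdifferentiableAt_apply hV
  have hd' := hθ'.1.mdifferentiableAt_apply hV
  have hne : θ x (FiberBundle.extend E v x) ≠ 0 := by simpa using hv
  have hq : MDifferentiableAt 𝓘(ℝ, E) 𝓘(ℝ, ℝ) (fun y => θ' y (FiberBundle.extend E v y)
      / θ y (FiberBundle.extend E v y)) x := by
    have h1 : DifferentiableAt ℝ (fun z : ℝ => z⁻¹) (θ x (FiberBundle.extend E v x)) :=
      differentiableAt_inv hne
    simp_rw [div_eq_mul_inv]
    exact hd'.mul (h1.mdifferentiableAt.comp x hd)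
  refine hq.congr_of_eventuallyEq ?_
  filter_upwards [hd.continuousAt.eventually_ne hne] with y hy
  rw [hl y]
  simp [hy]

theorem IsContactForm.mem_iff {θ : OneForm E M} (hθ : C.IsContactForm θ) {x : M}
    {v : TangentSpace 𝓘(ℝ, E) x} : v ∈ C.H x ↔ θ x v = 0 := by
  obtain ⟨θ₀, h, h₀⟩ := C.contact
  obtain ⟨c, hc, hc'⟩ : ∃ c : ℝ, 0 < c ∧ θ x = c • θ₀ x := by
    have := hθ.2 x
    rwa [(h₀ x).2.2.1] at this
  rw [(h₀ x).2.1, hc']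
  simp [hc.ne']

theorem IsContactForm.ne_zero {θ : OneForm E M} (hθ : C.IsContactForm θ) (x : M) : θ x ≠ 0 := by
  obtain ⟨θ₀, h, h₀⟩ := C.contact
  obtain ⟨c, hc, hc'⟩ : ∃ c : ℝ, 0 < c ∧ θ x = c • θ₀ x := by
    have := hθ.2 x
    rwa [(h₀ x).2.2.1] at this
  rw [hc']
  exact smul_ne_zero hc.ne' (h₀ x).1

theorem exists_isContactForm (C : ContactStructure E M) : ∃ θ, C.IsContactForm θ := by
  obtain ⟨θ₀, h, h₀⟩ := C.contact
  exact ⟨θ₀, h, fun x => by rw [(h₀ x).2.2.1]; exact ⟨1, one_pos, (one_smul _ _).symm⟩⟩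

variable [FiniteDimensional ℝ E]

theorem IsContactForm.d_eq_mul {θ θ' : OneForm E M} (hθ : C.IsContactForm θ) {l : M → ℝ}
    (h : ∀ x, θ' x = l x • θ x) {x : M} (hl : MDifferentiableAt 𝓘(ℝ, E) 𝓘(ℝ, ℝ) l x)
    {v w : TangentSpace 𝓘(ℝ, E) x} (hv : v ∈ C.H x) (hw : w ∈ C.H x) :
    θ'.d x v w = l x * θ.d x v w := by
  rw [hθ.1.d_smul h hl, hθ.mem_iff.1 hv, hθ.mem_iff.1 hw]
  ring

/-- An infinitesimal automorphism of the contact structure. -/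
def IsContactField (C : ContactStructure E M) (X : VField E M) : Prop :=
  ∀ θ, C.IsContactForm θ → ∀ x, ∀ v ∈ C.H x,
    θ.d x (X x) v = -mvfderiv 𝓘(ℝ, E) (fun y => θ y (X y)) x v

/-- The condition does not depend on the contact form: for `θ' = lθ` the extra term `-dl(v) θ(X)` in
`dθ'(X, v)` is the one produced by the product rule in `-d(l θ(X))(v)`. -/
theorem IsContactForm.isContactField {θ : OneForm E M} (hθ : C.IsContactForm θ) {X : VField E M}
    (hX : X.Smooth)
    (h : ∀ x, ∀ v ∈ C.H x, θ.d x (X x) v = -mvfderiv 𝓘(ℝ, E) (fun y => θ y (X y)) x v) :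
    C.IsContactField X := by
  intro θ' hθ' x v hv
  obtain ⟨l, -, hl, hl'⟩ := hθ.exists_smul hθ'
  have hf : (fun y => θ' y (X y)) = l • (fun y => θ y (X y)) := by ext y; simp [hl]
  rw [hθ.1.d_smul hl (hl' x), h x v hv, hf,
    mvfderiv_smul (hl' x) (hθ.1.mdifferentiableAt_apply (hX.diffAt x)), hθ.mem_iff.1 hv]
  simp
  ring

/-- With `θ(V) = 0`, the formula for `dθ(X, V)` reduces to `-V(θ(X)) - θ([X, V])`, and the contact
condition says that the first term is everything. -/
theorem IsContactField.apply_mlieBracket {X : VField E M} (hX : C.IsContactField X)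
    (hXs : X.Smooth) {θ : OneForm E M} (hθ : C.IsContactForm θ) {V : VField E M} (hV : V.Smooth)
    (hVH : ∀ x, V x ∈ C.H x) (x : M) : θ x (mlieBracket 𝓘(ℝ, E) X V x) = 0 := by
  have h1 := hX θ hθ x (V x) (hVH x)
  have h2 : (fun y => θ y (V y)) = fun _ => 0 := by ext y; exact hθ.mem_iff.1 (hVH y)
  rw [hθ.1.d_apply (hXs.diffAt x) (hV.diffAt x), OneForm.dField, h2, mvfderiv_const] at h1
  simp at h1
  exact h1

theorem IsContactField.mlieBracket_mem {X : VField E M} (hX : C.IsContactField X)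
    (hXs : X.Smooth) {V : VField E M} (hV : V.Smooth)
    (hVH : ∀ x, V x ∈ C.H x) (x : M) : mlieBracket 𝓘(ℝ, E) X V x ∈ C.H x := by
  obtain ⟨θ, hθ⟩ := C.exists_isContactForm
  exact hθ.mem_iff.2 (hX.apply_mlieBracket hXs hθ hV hVH x)

theorem IsContactForm.d_eq_neg_apply_mlieBracket {θ : OneForm E M} (hθ : C.IsContactForm θ)
    {V W : VField E M} (hV : V.Smooth) (hVH : ∀ x, V x ∈ C.H x) (hW : W.Smooth)
    (hWH : ∀ x, W x ∈ C.H x) (x : M) :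
    θ.d x (V x) (W x) = -θ x (mlieBracket 𝓘(ℝ, E) V W x) := by
  have h2 : ∀ U : VField E M, (∀ x, U x ∈ C.H x) → (fun y => θ y (U y)) = fun _ => 0 :=
    fun U hU => by ext y; exact hθ.mem_iff.1 (hU y)
  rw [hθ.1.d_apply (hV.diffAt x) (hW.diffAt x), OneForm.dField, h2 V hVH, h2 W hWH, mvfderiv_const]
  simp

/-- The Lie derivative of `dθ` along a contact field is a multiple of `dθ` on `H`. -/
theorem IsContactField.d_mlieBracket_congr {X : VField E M} (hX : C.IsContactField X)
    (hXs : X.Smooth) {θ : OneForm E M} (hθ : C.IsContactForm θ) {A B A' B' : VField E M}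
    (hA : A.Smooth) (hAH : ∀ x, A x ∈ C.H x) (hB : B.Smooth) (hBH : ∀ x, B x ∈ C.H x)
    (hA' : A'.Smooth) (hAH' : ∀ x, A' x ∈ C.H x) (hB' : B'.Smooth) (hBH' : ∀ x, B' x ∈ C.H x)
    (h : ∀ x, θ.d x (A x) (B x) = θ.d x (A' x) (B' x)) (x : M) :
    θ.d x (mlieBracket 𝓘(ℝ, E) X A x) (B x) + θ.d x (A x) (mlieBracket 𝓘(ℝ, E) X B x)
      = θ.d x (mlieBracket 𝓘(ℝ, E) X A' x) (B' x)
        + θ.d x (A' x) (mlieBracket 𝓘(ℝ, E) X B' x) := by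
  have : CompleteSpace E := FiniteDimensional.complete ℝ E
  have : IsManifold 𝓘(ℝ, E) (minSmoothness ℝ 3) M := isManifold_minSmoothness 3
  -- On `H` the form `dθ` is `-θ` of the bracket, so the left side is a sum of double brackets,
  -- which the Jacobi identity collapses to one.
  have key : ∀ {A B : VField E M}, A.Smooth → (∀ x, A x ∈ C.H x) → B.Smooth →
      (∀ x, B x ∈ C.H x) →
      θ.d x (mlieBracket 𝓘(ℝ, E) X A x) (B x) + θ.d x (A x) (mlieBracket 𝓘(ℝ, E) X B x)
        = -θ x (mlieBracket 𝓘(ℝ, E) X (mlieBracket 𝓘(ℝ, E) A B) x) := by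
    intro A B hA hAH hB hBH
    have hs : ∀ {Y : VField E M}, Y.Smooth → ContMDiffAt 𝓘(ℝ, E) 𝓘(ℝ, E).tangent
        (minSmoothness ℝ 2) (fun y => (⟨y, Y y⟩ : TangentBundle 𝓘(ℝ, E) M)) x := fun hY =>
      (hY x).of_le (by
        rw [minSmoothness_of_isRCLikeNormedField]
        exact WithTop.coe_le_coe.2 (le_top : (2 : ℕ∞) ≤ ⊤))
    rw [leibniz_identity_mlieBracket_apply (hs hXs) (hs hA) (hs hB), map_add,
      hθ.d_eq_neg_apply_mlieBracket (hXs.mlieBracket hA) (hX.mlieBracket_mem hXs hA hAH) hB hBH,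
      hθ.d_eq_neg_apply_mlieBracket hA hAH (hXs.mlieBracket hB) (hX.mlieBracket_mem hXs hB hBH)]
    ring
  rw [key hA hAH hB hBH, key hA' hAH' hB' hBH']
  have hsub : (fun y => mlieBracket 𝓘(ℝ, E) A B y - mlieBracket 𝓘(ℝ, E) A' B' y)
      = mlieBracket 𝓘(ℝ, E) A B + (-1 : ℝ) • mlieBracket 𝓘(ℝ, E) A' B' := by
    ext y; simp [sub_eq_add_neg]
  -- Equality of the two `dθ` values means that `[A, B] - [A', B']` lies in `H`; bracketing with a
  -- contact field keeps it there.
  have h0 := hX.apply_mlieBracket hXs hθ ((hA.mlieBracket hB).sub (hA'.mlieBracket hB'))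
    (fun y => by
      rw [hθ.mem_iff, map_sub]
      have := h y
      rw [hθ.d_eq_neg_apply_mlieBracket hA hAH hB hBH,
        hθ.d_eq_neg_apply_mlieBracket hA' hAH' hB' hBH'] at this
      linarith) x
  rw [hsub, mlieBracket_add_right ((hA.mlieBracket hB).diffAt x)
    (W₁ := (-1 : ℝ) • mlieBracket 𝓘(ℝ, E) A' B')
    (VField.DiffAt.smul mdifferentiableAt_const ((hA'.mlieBracket hB').diffAt x)),
    mlieBracket_const_smul_right ((hA'.mlieBracket hB').diffAt x)] at h0
  simp at h0
  linarith

end ContactStructure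

end ContactForms

/-! ### Flows on open subsets of a normed space. -/

section LocalFlow

variable {E : Type*} [NormedAddCommGroup E] [NormedSpace ℝ E]

/-- `Φ` is a smooth local flow, on the open set `O` of times and initial values, of the smooth vector
field `X` on the open set `U` of a normed space. -/
structure IsLocalFlow (X : E → E) (U : Set E) (O : Set (ℝ × E)) (Φ : ℝ × E → E) : Prop where
  isOpen_domain : IsOpen U
  isOpen : IsOpen O
  contDiffOn_field : ContDiffOn ℝ ∞ X U
  contDiffOn : ContDiffOn ℝ ∞ Φ O
  mapsTo : MapsTo Φ O U
  map_zero : ∀ x, ((0 : ℝ), x) ∈ O → Φ (0, x) = x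
  hasDerivAt : ∀ t x, (t, x) ∈ O → HasDerivAt (fun s => Φ (s, x)) (X (Φ (t, x))) t

/-- Differentiate `c⁻¹ c = 1`, valid near `t` because units form an open set. -/
theorem hasDerivAt_ringInverse_of_eq_one {R : Type*} [NormedRing R] [NormedAlgebra ℝ R]
    [HasSummableGeomSeries R] {c : ℝ → R} {c' : R} {t : ℝ} (h1 : c t = 1) (hc : HasDerivAt c c' t) :
    HasDerivAt (fun s => Ring.inverse (c s)) (-c') t := by
  have h2 : DifferentiableAt ℝ (Ring.inverse : R → R) (c t) := by
    rw [h1]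
    exact (contDiffAt_ringInverse ℝ (n := 1) (1 : Rˣ)).differentiableAt one_ne_zero
  have h3 : DifferentiableAt ℝ (fun s => Ring.inverse (c s)) t := h2.comp t hc.differentiableAt
  have h4 := h3.hasDerivAt.mul hc
  have h5 : ∀ᶠ s in 𝓝 t, Ring.inverse (c s) * c s = 1 := by
    have : ∀ᶠ s in 𝓝 t, IsUnit (c s) :=
      hc.continuousAt.eventually (Units.isOpen.eventually_mem (by
        change IsUnit (c t)
        rw [h1]
        exact isUnit_one))
    filter_upwards [this] with s hs using Ring.inverse_mul_cancel _ hs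
  have h6 := h4.unique ((hasDerivAt_const t (1 : R)).congr_of_eventuallyEq h5)
  rw [h1, Ring.inverse_one, mul_one, one_mul] at h6
  rw [← eq_neg_of_add_eq_zero_left h6]
  exact h3.hasDerivAt

namespace IsLocalFlow

variable {X : E → E} {U : Set E} {O : Set (ℝ × E)} {Φ : ℝ × E → E}

/-- The derivative of the flow with respect to the initial value. -/
abbrev spaceDeriv (Φ : ℝ × E → E) (q : ℝ × E) : E →L[ℝ] E :=
  (fderiv ℝ Φ q).comp (ContinuousLinearMap.inr ℝ ℝ E)

section

variable (h : IsLocalFlow X U O Φ)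
include h

theorem contDiffAt {q : ℝ × E} (hq : q ∈ O) : ContDiffAt ℝ ∞ Φ q :=
  h.contDiffOn.contDiffAt (h.isOpen.mem_nhds hq)

theorem hasFDerivAt {q : ℝ × E} (hq : q ∈ O) : HasFDerivAt Φ (fderiv ℝ Φ q) q :=
  ((h.contDiffAt hq).differentiableAt (by simp)).hasFDerivAt

theorem contDiffAt_fderiv {q : ℝ × E} (hq : q ∈ O) : ContDiffAt ℝ ∞ (fderiv ℝ Φ) q :=
  (h.contDiffAt hq).fderiv_right (m := ∞) (by simp)

theorem hasFDerivAt_fderiv {q : ℝ × E} (hq : q ∈ O) :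
    HasFDerivAt (fderiv ℝ Φ) (fderiv ℝ (fderiv ℝ Φ) q) q :=
  ((h.contDiffAt_fderiv hq).differentiableAt (by simp)).hasFDerivAt

theorem hasFDerivAt_slice {t : ℝ} {x : E} (hq : (t, x) ∈ O) :
    HasFDerivAt (fun y => Φ (t, y)) (spaceDeriv Φ (t, x)) x :=
  (h.hasFDerivAt hq).comp x (hasFDerivAt_prodMk_right t x)

theorem fderiv_symm {q : ℝ × E} (hq : q ∈ O) (v w : ℝ × E) :
    fderiv ℝ (fderiv ℝ Φ) q v w = fderiv ℝ (fderiv ℝ Φ) q w v :=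
  ((h.contDiffAt hq).isSymmSndFDerivAt (by
    rw [minSmoothness_of_isRCLikeNormedField]
    exact WithTop.coe_le_coe.2 (le_top : (2 : ℕ∞) ≤ ⊤))) v w

theorem hasFDerivAt_field {y : E} (hy : y ∈ U) : HasFDerivAt X (fderiv ℝ X y) y :=
  (((h.contDiffOn_field y hy).contDiffAt (h.isOpen_domain.mem_nhds hy)).differentiableAt
    (by simp)).hasFDerivAt

theorem fderiv_time {q : ℝ × E} (hq : q ∈ O) : fderiv ℝ Φ q (1, 0) = X (Φ q) := by
  have h1 := (h.hasFDerivAt hq).comp_hasDerivAt q.1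
    ((hasDerivAt_id q.1).prodMk (hasDerivAt_const q.1 q.2))
  exact h1.unique (h.hasDerivAt q.1 q.2 hq)

/-- The linearized flow equation. -/
theorem hasDerivAt_spaceDeriv {t : ℝ} {x : E} (hq : (t, x) ∈ O) :
    HasDerivAt (fun s => spaceDeriv Φ (s, x))
      ((fderiv ℝ X (Φ (t, x))).comp (spaceDeriv Φ (t, x))) t := by
  have h1 : HasDerivAt (fun s => fderiv ℝ Φ (s, x)) (fderiv ℝ (fderiv ℝ Φ) (t, x) (1, 0)) t :=
    (h.hasFDerivAt_fderiv hq).comp_hasDerivAt t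
      ((hasDerivAt_id t).prodMk (hasDerivAt_const t x))
  have h2 := h1.clm_comp (hasDerivAt_const t (ContinuousLinearMap.inr ℝ ℝ E))
  convert h2 using 1
  ext v
  -- The time derivative of the space derivative is a mixed second derivative of `Φ`. By symmetry it
  -- is the space derivative of `∂_t Φ = X ∘ Φ`, computed here in two ways.
  have h3 : HasFDerivAt (fun q => fderiv ℝ Φ q (1, 0))
      ((fderiv ℝ (fderiv ℝ Φ) (t, x)).flip (1, 0)) (t, x) :=
    ((h.hasFDerivAt_fderiv hq).clm_apply
      (hasFDerivAt_const ((1 : ℝ), (0 : E)) (t, x))).congr_fderiv (by ext <;> simp)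
  have h4 : HasFDerivAt (fun q => X (Φ q)) ((fderiv ℝ X (Φ (t, x))).comp (fderiv ℝ Φ (t, x)))
      (t, x) := (h.hasFDerivAt_field (h.mapsTo hq)).comp _ (h.hasFDerivAt hq)
  have h5 : (fun q => fderiv ℝ Φ q (1, 0)) =ᶠ[𝓝 (t, x)] fun q => X (Φ q) := by
    filter_upwards [h.isOpen.mem_nhds hq] with q hq using h.fderiv_time hq
  have h6 := h3.unique (h4.congr_of_eventuallyEq h5)
  have h7 := congrArg (fun A : ℝ × E →L[ℝ] E => A (0, v)) h6
  simp at h7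
  simp [h.fderiv_symm hq (1, 0) (0, v), h7]

theorem spaceDeriv_zero {x : E} (hx : ((0 : ℝ), x) ∈ O) :
    spaceDeriv Φ (0, x) = ContinuousLinearMap.id ℝ E := by
  have h1 : (fun y => Φ (0, y)) =ᶠ[𝓝 x] id := by
    have : ∀ᶠ y in 𝓝 x, ((0 : ℝ), y) ∈ O :=
      (Continuous.prodMk_right (0 : ℝ)).continuousAt.eventually (h.isOpen.mem_nhds hx)
    filter_upwards [this] with y hy using h.map_zero y hy
  exact (h.hasFDerivAt_slice hx).unique ((hasFDerivAt_id x).congr_of_eventuallyEq h1)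

/-- The pullback of a vector field by the flow is differentiated by the Lie bracket. -/
theorem hasDerivAt_pullback [CompleteSpace E] {V : E → E} {x : E} (hx : ((0 : ℝ), x) ∈ O)
    (hV : DifferentiableAt ℝ V x) :
    HasDerivAt (fun s => (spaceDeriv Φ (s, x)).inverse (V (Φ (s, x))))
      (lieBracket ℝ X V x) 0 := by
  have h0 := h.spaceDeriv_zero hx
  have h1 := h.hasDerivAt_spaceDeriv hx
  rw [h0, h.map_zero x hx, ContinuousLinearMap.comp_id] at h1
  -- At time `0` the space derivative is the identity, so its inverse has derivative `-DX`; with the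
  -- product rule this gives `DV(X) - DX(V) = [X, V]`.
  have h3 := hasDerivAt_ringInverse_of_eq_one h0 h1
  have h4 : HasDerivAt (fun s => Φ (s, x)) (X x) 0 := by
    have := h.hasDerivAt 0 x hx
    rwa [h.map_zero x hx] at this
  have h5 : HasDerivAt (fun s => V (Φ (s, x))) (fderiv ℝ V x (X x)) 0 := by
    have hV' : HasFDerivAt V (fderiv ℝ V x) (Φ (0, x)) := by
      rw [h.map_zero x hx]; exact hV.hasFDerivAt
    exact hV'.comp_hasDerivAt (0 : ℝ) h4
  have h6 := h3.clm_apply h5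
  simp only [ContinuousLinearMap.ringInverse_eq_inverse, h0, h.map_zero x hx] at h6
  exact h6.congr_deriv (by simp [lieBracket, sub_eq_neg_add])

end

section OneForm

variable (h : IsLocalFlow X U O Φ) {η : E → E →L[ℝ] ℝ} (hη : ContDiffOn ℝ ∞ η U)
include h hη

theorem hasFDerivAt_form {y : E} (hy : y ∈ U) : HasFDerivAt η (fderiv ℝ η y) y :=
  (((hη y hy).contDiffAt (h.isOpen_domain.mem_nhds hy)).differentiableAt (by simp)).hasFDerivAt

theorem continuousAt_pairing {q : ℝ × E} (hq : q ∈ O) (v : E) :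
    ContinuousAt (fun q => η (Φ q) (spaceDeriv Φ q v)) q := by
  have h1 : ContinuousAt (fun q => η (Φ q)) q :=
    (h.hasFDerivAt_form hη (h.mapsTo hq)).continuousAt.comp (f := Φ) (h.contDiffAt hq).continuousAt
  have h2 : ContinuousAt (fun q => spaceDeriv Φ q v) q :=
    ((h.contDiffAt_fderiv hq).continuousAt).clm_apply continuousAt_const
  exact h1.clm_apply h2

theorem hasDerivAt_pairing {t : ℝ} {x : E} (hq : (t, x) ∈ O) (v : E) :
    HasDerivAt (fun s => η (Φ (s, x)) (spaceDeriv Φ (s, x) v))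
      (fderiv ℝ η (Φ (t, x)) (X (Φ (t, x))) (spaceDeriv Φ (t, x) v)
        + η (Φ (t, x)) (fderiv ℝ X (Φ (t, x)) (spaceDeriv Φ (t, x) v))) t := by
  have h1 : HasDerivAt (fun s => η (Φ (s, x))) (fderiv ℝ η (Φ (t, x)) (X (Φ (t, x)))) t :=
    (h.hasFDerivAt_form hη (h.mapsTo hq)).comp_hasDerivAt t (h.hasDerivAt t x hq)
  have h2 := (h.hasDerivAt_spaceDeriv hq).clm_apply (hasDerivAt_const t v)
  exact (h1.clm_apply h2).congr_deriv (by rw [_root_.map_zero, add_zero]; rfl)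

/-- If the Lie derivative of `η` along `X` vanishes on the kernel of `η`, then the flow preserves `η`
up to positive factors. -/
theorem eventually_pairing_eq (hX : ∀ y ∈ U, ∀ u, η y u = 0 →
      fderiv ℝ η y (X y) u + η y (fderiv ℝ X y u) = 0)
    {x₀ : E} (hx₀ : ((0 : ℝ), x₀) ∈ O) {w : E} (hw : η x₀ w ≠ 0) :
    ∀ᶠ q in 𝓝 ((0 : ℝ), x₀), q ∈ O ∧ η q.2 w ≠ 0 ∧
      0 < η (Φ q) (spaceDeriv Φ q w) / η q.2 w ∧
      ∀ v, η (Φ q) (spaceDeriv Φ q v) = η (Φ q) (spaceDeriv Φ q w) / η q.2 w * η q.2 v := by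
  have hxU : x₀ ∈ U := by simpa [h.map_zero _ hx₀] using h.mapsTo hx₀
  have hs0 : ∀ x v, ((0 : ℝ), x) ∈ O → η (Φ (0, x)) (spaceDeriv Φ (0, x) v) = η x v := by
    intro x v hx
    rw [h.spaceDeriv_zero hx, h.map_zero x hx]; rfl
  have hc1 : ContinuousAt (fun q : ℝ × E => η q.2 w) (0, x₀) :=
    ((h.hasFDerivAt_form hη hxU).continuousAt.comp (f := Prod.snd) (x := ((0 : ℝ), x₀))
      continuousAt_snd).clm_apply continuousAt_const
  have hc2 := h.continuousAt_pairing hη hx₀ w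
  have hev : ∀ᶠ q in 𝓝 ((0 : ℝ), x₀), q ∈ O ∧ 0 < η (Φ q) (spaceDeriv Φ q w) * η q.2 w := by
    refine (h.isOpen.eventually_mem hx₀).and ((hc2.mul hc1).eventually_const_lt ?_)
    change 0 < η (Φ (0, x₀)) (spaceDeriv Φ (0, x₀) w) * η x₀ w
    rw [hs0 x₀ w hx₀]
    exact mul_self_pos.2 hw
  rw [Metric.eventually_nhds_iff_ball] at hev
  obtain ⟨ε, hε, hball⟩ := hev
  filter_upwards [Metric.ball_mem_nhds _ hε] with q hq
  obtain ⟨t, x⟩ := q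
  -- In the sup metric a ball is a box, so for fixed `x` all times `s` with `|s| < ε`, in particular
  -- those between `0` and `t`, stay in the good region.
  have hbox : ∀ s ∈ Metric.ball (0 : ℝ) ε, (s, x) ∈ Metric.ball ((0 : ℝ), x₀) ε := by
    intro s hs
    simp only [Metric.mem_ball, Prod.dist_eq, max_lt_iff] at hq hs ⊢
    exact ⟨hs, hq.2⟩
  have ht : t ∈ Metric.ball (0 : ℝ) ε := by
    simp only [Metric.mem_ball, Prod.dist_eq, max_lt_iff] at hq ⊢
    exact hq.1
  have h0 : (0 : ℝ) ∈ Metric.ball (0 : ℝ) ε := Metric.mem_ball_self hε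
  obtain ⟨hqO, hqpos⟩ := hball _ hq
  have hne : η x w ≠ 0 := fun h0 => by simp [h0] at hqpos
  refine ⟨hqO, hne, ?_, fun v => ?_⟩
  · have : η (Φ (t, x)) (spaceDeriv Φ (t, x) w) / η x w
        = (η (Φ (t, x)) (spaceDeriv Φ (t, x) w) * η x w) / (η x w) ^ 2 := by
      field_simp
    rw [this]
    exact div_pos hqpos (by positivity)
  · set g : E → ℝ → ℝ := fun v s => η (Φ (s, x)) (spaceDeriv Φ (s, x) v) with hg
    have hgw : ∀ s ∈ Metric.ball (0 : ℝ) ε, g w s ≠ 0 := fun s hs h0 => by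
      have := (hball _ (hbox s hs)).2
      simp only [hg] at h0
      rw [h0, zero_mul] at this
      exact lt_irrefl _ this
    have hder : ∀ s ∈ Metric.ball (0 : ℝ) ε, HasDerivAt (fun s => g v s / g w s) 0 s := by
      intro s hs
      have hO := (hball _ (hbox s hs)).1
      refine ((h.hasDerivAt_pairing hη hO v).fun_div (h.hasDerivAt_pairing hη hO w)
        (hgw s hs)).congr_deriv ?_
      -- The numerator in the quotient rule is the Lie derivative of `η` evaluated on `g_w DΦ(v) -
      -- g_v DΦ(w)`, a vector in `ker η`, so it vanishes and the ratio `g_v / g_w` is constant in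
      -- time.
      have h2 := hX _ (h.mapsTo hO) (η (Φ (s, x)) (spaceDeriv Φ (s, x) w) • spaceDeriv Φ (s, x) v
        - η (Φ (s, x)) (spaceDeriv Φ (s, x) v) • spaceDeriv Φ (s, x) w) (by simp; ring)
      simp only [map_sub, map_smul, smul_eq_mul] at h2
      rw [div_eq_zero_iff]
      left
      linear_combination h2
    have hconst : g v t / g w t = g v 0 / g w 0 := by
      refine Metric.isOpen_ball.is_const_of_deriv_eq_zero (convex_ball _ _).isPreconnected
        (fun s hs => (hder s hs).differentiableAt.differentiableWithinAt)
        (fun s hs => (hder s hs).deriv) ht h0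
    have hO0 := (hball _ (hbox 0 h0)).1
    simp only [hg, hs0 x _ hO0] at hconst
    have := hgw t ht
    simp only [hg] at this
    change η (Φ (t, x)) (spaceDeriv Φ (t, x) v) = η (Φ (t, x)) (spaceDeriv Φ (t, x) w) / η x w * η x v
    field_simp at hconst ⊢
    linear_combination hconst

/-- The flow of a contact field scales `η` and, on its kernel, `dη` by the same positive factor. -/
theorem eventually_conformal (hX : ∀ y ∈ U, ∀ u, η y u = 0 →
      fderiv ℝ η y (X y) u + η y (fderiv ℝ X y u) = 0)
    {x₀ : E} (hx₀ : ((0 : ℝ), x₀) ∈ O) (hne : η x₀ ≠ 0) :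
    ∀ᶠ t in 𝓝 (0 : ℝ), ∃ l : ℝ, 0 < l ∧
      (∀ v, η (Φ (t, x₀)) (spaceDeriv Φ (t, x₀) v) = l * η x₀ v) ∧
      ∀ v w, η x₀ v = 0 → η x₀ w = 0 →
        fderiv ℝ η (Φ (t, x₀)) (spaceDeriv Φ (t, x₀) v) (spaceDeriv Φ (t, x₀) w)
          - fderiv ℝ η (Φ (t, x₀)) (spaceDeriv Φ (t, x₀) w) (spaceDeriv Φ (t, x₀) v)
        = l * (fderiv ℝ η x₀ v w - fderiv ℝ η x₀ w v) := by
  obtain ⟨w₀, hw₀⟩ : ∃ w, η x₀ w ≠ 0 := by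
    by_contra! hcon
    exact hne (by ext v; simp [hcon])
  have hxU : x₀ ∈ U := by simpa [h.map_zero _ hx₀] using h.mapsTo hx₀
  -- For fixed small `t` the identity `Φ_t^* η = l η` is needed on a whole neighbourhood of `x₀`,
  -- since it is about to be differentiated in `x`.
  have hev := (h.eventually_pairing_eq hη hX hx₀ hw₀).curry_nhds
  filter_upwards [hev] with t ht
  obtain ⟨hO, hne', hpos, heq⟩ := ht.self_of_nhds
  refine ⟨_, hpos, heq, ?_⟩
  set l : E → ℝ := fun x => η (Φ (t, x)) (spaceDeriv Φ (t, x) w₀) / η x w₀ with hl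
  have hpair : ∀ v, HasFDerivAt (fun x => η (Φ (t, x)) (spaceDeriv Φ (t, x) v))
      ((η (Φ (t, x₀))).comp ((fderiv ℝ (fderiv ℝ Φ) (t, x₀)).comp
          (ContinuousLinearMap.inr ℝ ℝ E) |>.flip (0, v))
        + ((fderiv ℝ η (Φ (t, x₀))).comp (spaceDeriv Φ (t, x₀))).flip
            (spaceDeriv Φ (t, x₀) v)) x₀ := by
    intro v
    have h1 : HasFDerivAt (fun x => η (Φ (t, x)))
      ((fderiv ℝ η (Φ (t, x₀))).comp (spaceDeriv Φ (t, x₀))) x₀ :=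
      (h.hasFDerivAt_form hη (h.mapsTo hO)).comp x₀ (h.hasFDerivAt_slice hO)
    have h2 : HasFDerivAt (fun x => fderiv ℝ Φ (t, x)) ((fderiv ℝ (fderiv ℝ Φ) (t, x₀)).comp
        (ContinuousLinearMap.inr ℝ ℝ E)) x₀ :=
      (h.hasFDerivAt_fderiv hO).comp x₀ (hasFDerivAt_prodMk_right t x₀)
    have h3 := h2.clm_apply (hasFDerivAt_const ((0 : ℝ), v) x₀)
    exact (h1.clm_apply h3).congr_fderiv (by ext u; simp)
  have hform : ∀ v, HasFDerivAt (fun x => η x v) ((fderiv ℝ η x₀).flip v) x₀ := by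
    intro v
    exact ((h.hasFDerivAt_form hη hxU).clm_apply (hasFDerivAt_const v x₀)).congr_fderiv
      (by ext u; simp)
  have hld : DifferentiableAt ℝ l x₀ := by
    simp only [hl, div_eq_mul_inv]
    exact (hpair w₀).differentiableAt.mul ((hform w₀).differentiableAt.inv hne')
  -- Derivative of `Φ_t^* η = l η` in the direction `v`; the term with `dl` carries the factor `η(w)
  -- = 0`.
  have key : ∀ v w, η x₀ w = 0 →
      η (Φ (t, x₀)) (fderiv ℝ (fderiv ℝ Φ) (t, x₀) (0, v) (0, w))
        + fderiv ℝ η (Φ (t, x₀)) (spaceDeriv Φ (t, x₀) v) (spaceDeriv Φ (t, x₀) w)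
        = l x₀ * fderiv ℝ η x₀ v w := by
    intro v w hw
    have h1 : (fun x => η (Φ (t, x)) (spaceDeriv Φ (t, x) w)) =ᶠ[𝓝 x₀] fun x => l x * η x w := by
      filter_upwards [ht] with x hx using hx.2.2.2 w
    have h2 := (hpair w).unique ((hld.hasFDerivAt.mul (hform w)).congr_of_eventuallyEq h1)
    have h3 := congrArg (fun A : E →L[ℝ] ℝ => A v) h2
    simpa [hw] using h3
  intro v w hv hw
  have h1 := key v w hw
  have h2 := key w v hv
  -- Antisymmetrizing in `v, w` removes the second derivative of `Φ_t` and leaves `dη`.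
  rw [h.fderiv_symm hO] at h2
  change _ = l x₀ * _
  linear_combination h1 - h2

end OneForm

end IsLocalFlow

end LocalFlow

/-! ### Vector fields, forms and brackets read in a chart. -/

section ChartDictionary

variable {E : Type*} [NormedAddCommGroup E] [NormedSpace ℝ E]
  {M : Type*} [TopologicalSpace M] [ChartedSpace E M] [IsManifold 𝓘(ℝ, E) ∞ M]

/-- The derivative of the preferred chart at `p`. -/
def chartDeriv (p q : M) : TangentSpace 𝓘(ℝ, E) q →L[ℝ] E :=
  mfderiv 𝓘(ℝ, E) 𝓘(ℝ, E) (extChartAt 𝓘(ℝ, E) p) q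

/-- A vector field, read in the preferred chart at `p`. -/
def chartField (p : M) (V : VField E M) (y : E) : E :=
  (fun q => chartDeriv (E := E) p q (V q)) ((extChartAt 𝓘(ℝ, E) p).symm y)

/-- A 1-form, read in the preferred chart at `p`. -/
def chartForm (p : M) (θ : OneForm E M) (y : E) : E →L[ℝ] ℝ :=
  (fun q => (θ q).comp (chartDeriv (E := E) p q).inverse) ((extChartAt 𝓘(ℝ, E) p).symm y)

variable {p q : M}

theorem chartDeriv_isInvertible (hq : q ∈ (extChartAt 𝓘(ℝ, E) p).source) :
    (chartDeriv (E := E) p q).IsInvertible :=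
  have : IsManifold 𝓘(ℝ, E) 1 M := IsManifold.of_le (n := ∞) (by simp)
  isInvertible_mfderiv_extChartAt hq

theorem chartDeriv_inverse_apply (hq : q ∈ (extChartAt 𝓘(ℝ, E) p).source)
    (v : TangentSpace 𝓘(ℝ, E) q) : (chartDeriv (E := E) p q).inverse (chartDeriv (E := E) p q v) = v := by
  obtain ⟨e, he⟩ := chartDeriv_isInvertible hq
  rw [← he]
  simp

theorem chartDeriv_apply_inverse (hq : q ∈ (extChartAt 𝓘(ℝ, E) p).source)
    (v : E) : chartDeriv (E := E) p q ((chartDeriv (E := E) p q).inverse v) = v := by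
  obtain ⟨e, he⟩ := chartDeriv_isInvertible hq
  rw [← he]
  simp

theorem chartField_extChartAt (hq : q ∈ (extChartAt 𝓘(ℝ, E) p).source) (V : VField E M) :
    chartField p V (extChartAt 𝓘(ℝ, E) p q) = chartDeriv (E := E) p q (V q) := by
  unfold chartField
  rw [(extChartAt 𝓘(ℝ, E) p).left_inv hq]

theorem chartForm_extChartAt (hq : q ∈ (extChartAt 𝓘(ℝ, E) p).source) (θ : OneForm E M)
    (v : TangentSpace 𝓘(ℝ, E) q) :
    chartForm p θ (extChartAt 𝓘(ℝ, E) p q) (chartDeriv (E := E) p q v) = θ q v := by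
  unfold chartForm
  rw [(extChartAt 𝓘(ℝ, E) p).left_inv hq]
  simp [chartDeriv_inverse_apply hq]

theorem contMDiffAt_extChartAt_symm {y : E} (hy : y ∈ (extChartAt 𝓘(ℝ, E) p).target) :
    ContMDiffAt 𝓘(ℝ, E) 𝓘(ℝ, E) ∞ (extChartAt 𝓘(ℝ, E) p).symm y :=
  (contMDiffOn_extChartAt_symm p y hy).contMDiffAt ((isOpen_extChartAt_target p).mem_nhds hy)

/-- The derivative of the inverse of the preferred chart at `p`. -/
def chartSymmDeriv (p : M) (y : E) :
    E →L[ℝ] TangentSpace 𝓘(ℝ, E) ((extChartAt 𝓘(ℝ, E) p).symm y) :=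
  mfderiv 𝓘(ℝ, E) 𝓘(ℝ, E) (extChartAt 𝓘(ℝ, E) p).symm y

theorem chartSymmDeriv_eq {y : E} (hy : y ∈ (extChartAt 𝓘(ℝ, E) p).target) :
    chartSymmDeriv p y = (chartDeriv (E := E) p ((extChartAt 𝓘(ℝ, E) p).symm y)).inverse := by
  have : IsManifold 𝓘(ℝ, E) 1 M := IsManifold.of_le (n := ∞) (by simp)
  have h1 := mfderiv_extChartAt_comp_mfderivWithin_extChartAt_symm (I := 𝓘(ℝ, E)) hy
  rw [ModelWithCorners.range_eq_univ, mfderivWithin_univ] at h1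
  ext v
  have h2 : chartDeriv (E := E) p ((extChartAt 𝓘(ℝ, E) p).symm y) (chartSymmDeriv p y v) = v :=
    congrArg (fun A : E →L[ℝ] E => A v) h1
  rw [← chartDeriv_inverse_apply ((extChartAt 𝓘(ℝ, E) p).map_target hy) (chartSymmDeriv p y v), h2]

theorem chartSymmDeriv_isInvertible {y : E} (hy : y ∈ (extChartAt 𝓘(ℝ, E) p).target) :
    (chartSymmDeriv p y).IsInvertible := by
  obtain ⟨e, he⟩ := chartDeriv_isInvertible ((extChartAt 𝓘(ℝ, E) p).map_target hy)
  exact ⟨e.symm, by rw [chartSymmDeriv_eq hy, ← he, ContinuousLinearMap.inverse_equiv]⟩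

theorem chartField_eq_mpullback {y : E} (hy : y ∈ (extChartAt 𝓘(ℝ, E) p).target)
    (V : VField E M) : chartField p V y
      = mpullback 𝓘(ℝ, E) 𝓘(ℝ, E) (extChartAt 𝓘(ℝ, E) p).symm V y := by
  change _ = (chartSymmDeriv p y).inverse (V ((extChartAt 𝓘(ℝ, E) p).symm y))
  obtain ⟨e, he⟩ := chartDeriv_isInvertible ((extChartAt 𝓘(ℝ, E) p).map_target hy)
  rw [chartSymmDeriv_eq hy, ← he, ContinuousLinearMap.inverse_equiv,
    ContinuousLinearMap.inverse_equiv]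
  unfold chartField
  simp only [← he]
  rfl

/-- The vector field near `p` with constant coefficients in the preferred chart at `p`. -/
def constField (p : M) (v : E) : VField E M := fun q => (chartDeriv (E := E) p q).inverse v

variable [CompleteSpace E]

theorem chartField_contDiffAt {y : E} (hy : y ∈ (extChartAt 𝓘(ℝ, E) p).target)
    {V : VField E M} (hV : V.SmoothAt ((extChartAt 𝓘(ℝ, E) p).symm y)) :
    ContDiffAt ℝ ∞ (chartField p V) y := by
  have : IsManifold 𝓘(ℝ, E) 1 M := IsManifold.of_le (n := ∞) (by simp)
  have h1 := ContMDiffAt.mpullback_vectorField_preimage (I := 𝓘(ℝ, E)) (n := ∞)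
    hV (contMDiffAt_extChartAt_symm hy) (chartSymmDeriv_isInvertible (E := E) hy) (by simp)
  have h2 := contMDiffAt_vectorSpace_iff_contDiffAt.1 h1
  refine h2.congr_of_eventuallyEq ?_
  filter_upwards [(isOpen_extChartAt_target p).mem_nhds hy] with z hz
    using chartField_eq_mpullback hz V

theorem constField_smoothAt (hq : q ∈ (extChartAt 𝓘(ℝ, E) p).source) (v : E) :
    VField.SmoothAt (constField p v) q := by
  have : IsManifold 𝓘(ℝ, E) 1 M := IsManifold.of_le (n := ∞) (by simp)
  have h0 : ContMDiffAt 𝓘(ℝ, E) 𝓘(ℝ, E).tangent ∞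
      (fun y : E => (⟨y, v⟩ : TangentBundle 𝓘(ℝ, E) E)) (extChartAt 𝓘(ℝ, E) p q) :=
    contMDiffAt_vectorSpace_iff_contDiffAt.2 contDiffAt_const
  exact ContMDiffAt.mpullback_vectorField_preimage (I := 𝓘(ℝ, E)) (n := ∞)
    h0 (contMDiffAt_extChartAt' (by simpa using hq)) (isInvertible_mfderiv_extChartAt hq) (by simp)

/-- Naturality of the Lie bracket under pullback by the inverse chart. -/
theorem chartField_mlieBracket {y : E} (hy : y ∈ (extChartAt 𝓘(ℝ, E) p).target)
    {V W : VField E M} (hV : V.DiffAt ((extChartAt 𝓘(ℝ, E) p).symm y))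
    (hW : W.DiffAt ((extChartAt 𝓘(ℝ, E) p).symm y)) :
    chartField p (mlieBracket 𝓘(ℝ, E) V W) y
      = lieBracket ℝ (chartField p V) (chartField p W) y := by
  have : IsManifold 𝓘(ℝ, E) (minSmoothness ℝ 2) M := isManifold_minSmoothness 2
  rw [chartField_eq_mpullback hy, mpullback_mlieBracket hV hW
    ((contMDiffAt_extChartAt_symm hy).of_le (m := minSmoothness ℝ 2) (by
      rw [minSmoothness_of_isRCLikeNormedField]
      exact WithTop.coe_le_coe.2 (le_top : (2 : ℕ∞) ≤ ⊤))) le_rfl,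
    ← mlieBracketWithin_univ, mlieBracketWithin_eq_lieBracketWithin]
  have key : ∀ A B : E → E, A =ᶠ[𝓝 y] chartField p V → B =ᶠ[𝓝 y] chartField p W →
      lieBracketWithin ℝ A B univ y = lieBracket ℝ (chartField p V) (chartField p W) y := by
    intro A B hA hB
    rw [lieBracketWithin_univ]
    exact hA.lieBracket_vectorField_eq hB
  refine key _ _ ?_ ?_
  all_goals
    filter_upwards [(isOpen_extChartAt_target p).mem_nhds hy] with z hz
      using (chartField_eq_mpullback hz _).symm

theorem mvfderiv_eq_fderiv_chart (hq : q ∈ (extChartAt 𝓘(ℝ, E) p).source) {f : M → ℝ}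
    (hf : MDifferentiableAt 𝓘(ℝ, E) 𝓘(ℝ, ℝ) f q) (v : TangentSpace 𝓘(ℝ, E) q) :
    mvfderiv 𝓘(ℝ, E) f q v
      = fderiv ℝ (f ∘ (extChartAt 𝓘(ℝ, E) p).symm) (extChartAt 𝓘(ℝ, E) p q)
        (chartDeriv (E := E) p q v) := by
  obtain ⟨y, hy, rfl⟩ : ∃ y ∈ (extChartAt 𝓘(ℝ, E) p).target, (extChartAt 𝓘(ℝ, E) p).symm y = q :=
    ⟨_, (extChartAt 𝓘(ℝ, E) p).map_source hq, (extChartAt 𝓘(ℝ, E) p).left_inv hq⟩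
  rw [(extChartAt 𝓘(ℝ, E) p).right_inv hy]
  have h1 : _ = mvfderiv 𝓘(ℝ, E) f _ (chartSymmDeriv p y
      (chartDeriv (E := E) p ((extChartAt 𝓘(ℝ, E) p).symm y) v)) :=
    mvfderiv_comp_apply (I := 𝓘(ℝ, E)) (I' := 𝓘(ℝ, E)) y hf
    ((contMDiffAt_extChartAt_symm hy).mdifferentiableAt (by simp))
    (chartDeriv (E := E) p ((extChartAt 𝓘(ℝ, E) p).symm y) v)
  rw [chartSymmDeriv_eq hy, chartDeriv_inverse_apply hq] at h1
  rw [← h1, mvfderiv, mfderiv_eq_fderiv]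
  rfl

/-- In finite dimensions it suffices to evaluate on fixed vectors, and these values are the pairings
of `θ` with the fields `constField`. -/
theorem OneForm.Smooth.chartForm_contDiffOn [FiniteDimensional ℝ E] {θ : OneForm E M} (hθ : θ.Smooth) :
    ContDiffOn ℝ ∞ (chartForm p θ) (extChartAt 𝓘(ℝ, E) p).target := by
  rw [contDiffOn_clm_apply]
  intro v y hy
  have h1 := hθ.contMDiffAt_apply
    (constField_smoothAt ((extChartAt 𝓘(ℝ, E) p).map_target hy) v)
  exact (h1.comp y (contMDiffAt_extChartAt_symm hy)).contDiffAt.contDiffWithinAt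

/-- The exterior derivative of a 1-form, read in a chart. -/
theorem OneForm.Smooth.d_eq_chart [FiniteDimensional ℝ E] {θ : OneForm E M} (hθ : θ.Smooth)
    (hq : q ∈ (extChartAt 𝓘(ℝ, E) p).source) (v w : TangentSpace 𝓘(ℝ, E) q) :
    θ.d q v w
      = fderiv ℝ (chartForm p θ) (extChartAt 𝓘(ℝ, E) p q) (chartDeriv (E := E) p q v) (chartDeriv (E := E) p q w)
        - fderiv ℝ (chartForm p θ) (extChartAt 𝓘(ℝ, E) p q) (chartDeriv (E := E) p q w)
            (chartDeriv (E := E) p q v) := by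
  have hc : ∀ u : TangentSpace 𝓘(ℝ, E) q, constField p (chartDeriv (E := E) p q u) q = u := fun u =>
    chartDeriv_inverse_apply hq u
  have hs : ∀ u : E, VField.DiffAt (constField p u) q := fun u =>
    (constField_smoothAt hq u).diffAt
  have hy := (extChartAt 𝓘(ℝ, E) p).map_source hq
  -- Fields with constant coefficients commute, so evaluating `dθ` on them leaves only the
  -- antisymmetrized derivative of the coefficients.
  have hb : ∀ u u' : E, mlieBracket 𝓘(ℝ, E) (constField p u) (constField p u') q = 0 := by
    intro u u'
    have h1 : ∀ u : E, chartField p (constField p u) =ᶠ[𝓝 (extChartAt 𝓘(ℝ, E) p q)]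
        fun _ => u := by
      intro u
      filter_upwards [(isOpen_extChartAt_target p).mem_nhds hy] with z hz
      exact chartDeriv_apply_inverse ((extChartAt 𝓘(ℝ, E) p).map_target hz) u
    have h2 := chartField_mlieBracket hy (V := constField p u) (W := constField p u')
      (by rw [(extChartAt 𝓘(ℝ, E) p).left_inv hq]; exact hs u)
      (by rw [(extChartAt 𝓘(ℝ, E) p).left_inv hq]; exact hs u')
    rw [(h1 u).lieBracket_vectorField_eq (h1 u'), chartField_extChartAt hq] at h2
    rw [← chartDeriv_inverse_apply hq (mlieBracket 𝓘(ℝ, E) _ _ q), h2]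
    simp [lieBracket]
  have hd : ∀ u u' : TangentSpace 𝓘(ℝ, E) q,
      mvfderiv 𝓘(ℝ, E) (fun x => θ x (constField p (chartDeriv (E := E) p q u) x)) q u'
        = fderiv ℝ (chartForm p θ) (extChartAt 𝓘(ℝ, E) p q) (chartDeriv (E := E) p q u')
            (chartDeriv (E := E) p q u) := by
    intro u u'
    rw [mvfderiv_eq_fderiv_chart hq (hθ.mdifferentiableAt_apply (hs _))]
    have h3 : HasFDerivAt (chartForm p θ) _ (extChartAt 𝓘(ℝ, E) p q) :=
      (((hθ.chartForm_contDiffOn _ hy).contDiffAt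
        ((isOpen_extChartAt_target p).mem_nhds hy)).differentiableAt (by simp)).hasFDerivAt
    have h4 := (h3.clm_apply (hasFDerivAt_const (chartDeriv (E := E) p q u) _)).fderiv
    change fderiv ℝ (fun y => chartForm p θ y (chartDeriv (E := E) p q u)) _ _ = _
    rw [h4]
    simp
  have h := hθ.d_apply (hs (chartDeriv (E := E) p q v)) (hs (chartDeriv (E := E) p q w))
  rw [OneForm.dField, hb, map_zero, sub_zero, hc, hc, hd, hd] at h
  exact h

end ChartDictionary

/-! ### Flows on the manifold: invertibility, Lie derivative, conformality. -/

section ManifoldFlow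

variable {E : Type*} [NormedAddCommGroup E] [NormedSpace ℝ E] [FiniteDimensional ℝ E]
  {M : Type*} [TopologicalSpace M] [ChartedSpace E M] [IsManifold 𝓘(ℝ, E) ∞ M]

namespace IsFlow

variable {X : VField E M} {𝒟 : Set (ℝ × M)} {Fl : ℝ → M → M}

/-- The flow, read in the preferred chart at `p`. -/
def chartFlow (Fl : ℝ → M → M) (p : M) (q : ℝ × E) : E :=
  extChartAt 𝓘(ℝ, E) p (Fl q.1 ((extChartAt 𝓘(ℝ, E) p).symm q.2))

/-- The domain of the flow read in the preferred chart at `p`. -/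
def chartDomain (𝒟 : Set (ℝ × M)) (Fl : ℝ → M → M) (p : M) : Set (ℝ × E) :=
  (univ ×ˢ (extChartAt 𝓘(ℝ, E) p).target) ∩
    (fun q : ℝ × E => (q.1, (extChartAt 𝓘(ℝ, E) p).symm q.2)) ⁻¹'
      (𝒟 ∩ (fun q : ℝ × M => Fl q.1 q.2) ⁻¹' (extChartAt 𝓘(ℝ, E) p).source)

variable (h : IsFlow X 𝒟 Fl)
include h

theorem isLocalFlow (hX : X.Smooth) (p : M) :
    IsLocalFlow (chartField p X) (extChartAt 𝓘(ℝ, E) p).target (chartDomain 𝒟 Fl p)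
      (chartFlow Fl p) where
  isOpen_domain := isOpen_extChartAt_target p
  isOpen := by
    have h1 : IsOpen (𝒟 ∩ (fun q : ℝ × M => Fl q.1 q.2) ⁻¹' (extChartAt 𝓘(ℝ, E) p).source) :=
      h.smooth.continuousOn.isOpen_inter_preimage h.isOpen (isOpen_extChartAt_source p)
    refine ContinuousOn.isOpen_inter_preimage ?_ (isOpen_univ.prod (isOpen_extChartAt_target p)) h1
    exact continuousOn_fst.prodMk
      ((continuousOn_extChartAt_symm p).comp continuousOn_snd fun q hq => hq.2)
  contDiffOn_field := fun y hy =>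
    have : CompleteSpace E := FiniteDimensional.complete ℝ E
    (chartField_contDiffAt hy (hX _)).contDiffWithinAt
  contDiffOn := by
    rw [← contMDiffOn_iff_contDiffOn]
    have h1 : ContMDiffOn 𝓘(ℝ, ℝ × E) (𝓘(ℝ, ℝ).prod 𝓘(ℝ, E)) ∞
        (fun q : ℝ × E => (q.1, (extChartAt 𝓘(ℝ, E) p).symm q.2)) (chartDomain 𝒟 Fl p) := by
      refine ContMDiffOn.prodMk contDiff_fst.contMDiff.contMDiffOn ?_
      exact (contMDiffOn_extChartAt_symm p).comp contDiff_snd.contMDiff.contMDiffOn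
        fun q hq => hq.1.2
    have h2 := h.smooth.comp h1 fun q hq => hq.2.1
    refine (contMDiffOn_extChartAt (x := p)).comp h2 fun q hq => ?_
    have := hq.2.2
    rw [mem_preimage, extChartAt_source] at this
    exact this
  mapsTo := fun q hq => (extChartAt 𝓘(ℝ, E) p).map_source hq.2.2
  map_zero := fun x hx => by
    simp only [chartFlow, h.map_zero]
    exact (extChartAt 𝓘(ℝ, E) p).right_inv hx.1.2
  hasDerivAt := fun t x hx => by
    set z := (extChartAt 𝓘(ℝ, E) p).symm x with hz
    have h1 := h.integral z t hx.2.1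
    have h2 : {s : ℝ | (s, z) ∈ 𝒟} ∈ 𝓝 t :=
      (Continuous.prodMk_left z).continuousAt.preimage_mem_nhds (h.isOpen.mem_nhds hx.2.1)
    have h3 := h1.hasMFDerivAt h2
    have hs : Fl t z ∈ (extChartAt 𝓘(ℝ, E) p).source := hx.2.2
    have h4 : HasMFDerivAt 𝓘(ℝ, E) 𝓘(ℝ, E) (extChartAt 𝓘(ℝ, E) p) (Fl t z)
        (chartDeriv (E := E) p (Fl t z)) :=
      (mdifferentiableAt_extChartAt (by simpa using hs)).hasMFDerivAt
    have h5 : HasFDerivAt (fun s => chartFlow Fl p (s, x)) ((chartDeriv (E := E) p (Fl t z)).comp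
        (ContinuousLinearMap.smulRight (1 : ℝ →L[ℝ] ℝ) (X (Fl t z)))) t :=
      (h4.comp t h3).hasFDerivAt
    refine (HasFDerivAt.hasDerivAt (F := E) h5).congr_deriv ?_
    rw [chartFlow, chartField_extChartAt hs]
    change chartDeriv (E := E) p (Fl t z) ((1 : ℝ) • X (Fl t z)) = _
    rw [one_smul]

theorem eventually_mem (p : M) : ∀ᶠ t in 𝓝 (0 : ℝ), (t, p) ∈ 𝒟 ∧
    Fl t p ∈ (extChartAt 𝓘(ℝ, E) p).source := by
  have h1 : ∀ᶠ q in 𝓝 ((0 : ℝ), p), q ∈ 𝒟 ∧ Fl q.1 q.2 ∈ (extChartAt 𝓘(ℝ, E) p).source := by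
    refine (h.isOpen.eventually_mem (h.zero_mem p)).and ?_
    have hc : ContinuousAt (fun q : ℝ × M => Fl q.1 q.2) (0, p) :=
      h.smooth.continuousOn.continuousAt (h.isOpen.mem_nhds (h.zero_mem p))
    refine hc.eventually ((isOpen_extChartAt_source p).eventually_mem ?_)
    simp [h.map_zero]
  exact (Continuous.prodMk_left p).continuousAt.eventually h1

theorem mdifferentiableAt {t : ℝ} {q : M} (hq : (t, q) ∈ 𝒟) :
    MDifferentiableAt 𝓘(ℝ, E) 𝓘(ℝ, E) (Fl t) q := by
  have h1 : ContMDiffAt (𝓘(ℝ, ℝ).prod 𝓘(ℝ, E)) 𝓘(ℝ, E) ∞ (fun q : ℝ × M => Fl q.1 q.2) (t, q) :=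
    h.smooth.contMDiffAt (h.isOpen.mem_nhds hq)
  have h2 : ContMDiffAt 𝓘(ℝ, E) (𝓘(ℝ, ℝ).prod 𝓘(ℝ, E)) ∞ (fun x : M => (t, x)) q :=
    contMDiffAt_const.prodMk contMDiffAt_id
  exact (h1.comp q h2).mdifferentiableAt (by simp)

/-- The chain rule for the flow conjugated by the chart; it transports the results on local flows
back to `M`. -/
theorem chartDeriv_comp_mfderiv (hX : X.Smooth) {p q : M} {t : ℝ} (hq : (t, q) ∈ 𝒟)
    (hqs : q ∈ (extChartAt 𝓘(ℝ, E) p).source) (hqs' : Fl t q ∈ (extChartAt 𝓘(ℝ, E) p).source) :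
    (chartDeriv (E := E) p (Fl t q)).comp (mfderiv 𝓘(ℝ, E) 𝓘(ℝ, E) (Fl t) q)
      = (IsLocalFlow.spaceDeriv (chartFlow Fl p) (t, extChartAt 𝓘(ℝ, E) p q)).comp
        (chartDeriv (E := E) p q) := by
  have hA : ∀ x ∈ (extChartAt 𝓘(ℝ, E) p).source, HasMFDerivAt 𝓘(ℝ, E) 𝓘(ℝ, E)
      (extChartAt 𝓘(ℝ, E) p) x (chartDeriv (E := E) p x) := fun x hx =>
    (mdifferentiableAt_extChartAt (by simpa using hx)).hasMFDerivAt
  have h1 := (hA _ hqs').comp q (h.mdifferentiableAt hq).hasMFDerivAt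
  have hO : (t, extChartAt 𝓘(ℝ, E) p q) ∈ chartDomain 𝒟 Fl p := by
    refine ⟨⟨mem_univ _, (extChartAt 𝓘(ℝ, E) p).map_source hqs⟩, ?_⟩
    simp only [mem_preimage, (extChartAt 𝓘(ℝ, E) p).left_inv hqs]
    exact ⟨hq, hqs'⟩
  have h2 := ((h.isLocalFlow hX p).hasFDerivAt_slice hO).hasMFDerivAt.comp q (hA q hqs)
  refine hasMFDerivAt_unique h1 (h2.congr_of_eventuallyEq ?_)
  filter_upwards [(isOpen_extChartAt_source p).mem_nhds hqs] with x hx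
  simp only [Function.comp_apply, chartFlow, (extChartAt 𝓘(ℝ, E) p).left_inv hx]

theorem zero_mem_chartDomain (p : M) :
    ((0 : ℝ), extChartAt 𝓘(ℝ, E) p p) ∈ chartDomain 𝒟 Fl p := by
  refine ⟨⟨mem_univ _, mem_extChartAt_target p⟩, ?_⟩
  simp only [mem_preimage, extChartAt_to_inv]
  refine ⟨h.zero_mem p, ?_⟩
  simp only [mem_preimage, h.map_zero]
  exact mem_extChartAt_source p

/-- The space derivative is the identity at `t = 0` and units are open; the manifold derivative is
its conjugate by invertible chart derivatives. -/
theorem eventually_isInvertible (hX : X.Smooth) (p : M) : ∀ᶠ t in 𝓝 (0 : ℝ),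
    (IsLocalFlow.spaceDeriv (chartFlow Fl p) (t, extChartAt 𝓘(ℝ, E) p p)).IsInvertible ∧
    (mfderiv 𝓘(ℝ, E) 𝓘(ℝ, E) (Fl t) p).IsInvertible := by
  have : CompleteSpace E := FiniteDimensional.complete ℝ E
  have hL := h.isLocalFlow hX p
  have h0 := h.zero_mem_chartDomain p
  have hc := (hL.hasDerivAt_spaceDeriv h0).continuousAt
  have hu : ∀ᶠ t in 𝓝 (0 : ℝ),
      IsUnit (IsLocalFlow.spaceDeriv (chartFlow Fl p) (t, extChartAt 𝓘(ℝ, E) p p)) := by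
    refine hc.eventually (Units.isOpen.eventually_mem ?_)
    change IsUnit (IsLocalFlow.spaceDeriv (chartFlow Fl p) (0, extChartAt 𝓘(ℝ, E) p p))
    rw [hL.spaceDeriv_zero h0]
    exact isUnit_one
  filter_upwards [hu, h.eventually_mem p] with t ht ht'
  obtain ⟨u, hu⟩ := ht
  have h1 : (IsLocalFlow.spaceDeriv (chartFlow Fl p)
      (t, extChartAt 𝓘(ℝ, E) p p)).IsInvertible := by
    rw [← hu]
    exact ContinuousLinearMap.IsInvertible.of_inverse (g := ((u⁻¹ : (E →L[ℝ] E)ˣ) : E →L[ℝ] E))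
      u.mul_inv u.inv_mul
  refine ⟨h1, ?_⟩
  have h2 := h.chartDeriv_comp_mfderiv hX ht'.1 (mem_extChartAt_source p) ht'.2
  have h3 := (chartDeriv_isInvertible ht'.2).inverse.comp
    (h1.comp (chartDeriv_isInvertible (mem_extChartAt_source p)))
  have h4 : (chartDeriv (E := E) p (Fl t p)).inverse.comp ((chartDeriv (E := E) p (Fl t p)).comp
      (mfderiv 𝓘(ℝ, E) 𝓘(ℝ, E) (Fl t) p)) = mfderiv 𝓘(ℝ, E) 𝓘(ℝ, E) (Fl t) p := by
    ext v
    exact chartDeriv_inverse_apply ht'.2 _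
  rwa [← h2, h4] at h3

/-- The pullback of a vector field by the flow is differentiated by the Lie bracket. -/
theorem hasDerivAt_pullback (hX : X.Smooth) {V : VField E M} (hV : V.Smooth) (p : M)
    (ℓ : TangentSpace 𝓘(ℝ, E) p →ₗ[ℝ] ℝ) :
    HasDerivAt (fun t => ℓ ((mfderiv 𝓘(ℝ, E) 𝓘(ℝ, E) (Fl t) p).inverse (V (Fl t p))))
      (ℓ (mlieBracket 𝓘(ℝ, E) X V p)) 0 := by
  have : CompleteSpace E := FiniteDimensional.complete ℝ E
  have hp := mem_extChartAt_source (I := 𝓘(ℝ, E)) p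
  have hpt := mem_extChartAt_target (I := 𝓘(ℝ, E)) p
  have h1 := (h.isLocalFlow hX p).hasDerivAt_pullback (V := chartField p V)
    (h.zero_mem_chartDomain p)
    ((chartField_contDiffAt hpt (hV _)).differentiableAt (by simp))
  rw [← chartField_mlieBracket hpt (hX.diffAt _) (hV.diffAt _), chartField_extChartAt hp] at h1
  -- The functional `ℓ` transferred to the model space, so that the derivative known in the chart
  -- can be composed with it.
  set L : E →L[ℝ] ℝ := LinearMap.toContinuousLinearMap
    (ℓ ∘ₗ ((chartDeriv (E := E) p p).inverse : E →ₗ[ℝ] TangentSpace 𝓘(ℝ, E) p)) with hL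
  have h2 := L.hasFDerivAt.comp_hasDerivAt (0 : ℝ) h1
  have h3 : L (chartDeriv (E := E) p p (mlieBracket 𝓘(ℝ, E) X V p))
      = ℓ (mlieBracket 𝓘(ℝ, E) X V p) := by
    simp [hL, chartDeriv_inverse_apply hp]
  rw [h3] at h2
  refine h2.congr_of_eventuallyEq ?_
  filter_upwards [h.eventually_isInvertible hX p, h.eventually_mem p] with t ht ht'
  have h4 := h.chartDeriv_comp_mfderiv hX ht'.1 hp ht'.2
  have h5 : chartField p V (chartFlow Fl p (t, extChartAt 𝓘(ℝ, E) p p))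
      = chartDeriv (E := E) p (Fl t p) (V (Fl t p)) := by
    rw [chartFlow, extChartAt_to_inv, chartField_extChartAt ht'.2]
  obtain ⟨w, hw⟩ : ∃ w, mfderiv 𝓘(ℝ, E) 𝓘(ℝ, E) (Fl t) p w = V (Fl t p) :=
    ht.2.surjective _
  have h6 : IsLocalFlow.spaceDeriv (chartFlow Fl p) (t, extChartAt 𝓘(ℝ, E) p p)
      (chartDeriv (E := E) p p w) = chartDeriv (E := E) p (Fl t p) (V (Fl t p)) := by
    rw [← hw]
    exact (congrArg (fun A : TangentSpace 𝓘(ℝ, E) p →L[ℝ] E => A w) h4).symm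
  simp only [Function.comp_apply]
  rw [h5, ← h6, ht.1.inverse_apply_self, ← hw, ht.2.inverse_apply_self]
  simp [hL, chartDeriv_inverse_apply hp]

/-- The flow of a contact field preserves a contact form, and on the contact hyperplane also its
exterior derivative, up to the same positive factor. -/
theorem eventually_conformal {C : ContactStructure E M} (hXs : X.Smooth) (hX : C.IsContactField X)
    {θ : OneForm E M} (hθ : C.IsContactForm θ) (p : M) : ∀ᶠ t in 𝓝 (0 : ℝ), ∃ l : ℝ, 0 < l ∧
      (∀ v, θ (Fl t p) (mfderiv 𝓘(ℝ, E) 𝓘(ℝ, E) (Fl t) p v) = l * θ p v) ∧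
      ∀ v ∈ C.H p, ∀ w ∈ C.H p, θ.d (Fl t p) (mfderiv 𝓘(ℝ, E) 𝓘(ℝ, E) (Fl t) p v)
        (mfderiv 𝓘(ℝ, E) 𝓘(ℝ, E) (Fl t) p w) = l * θ.d p v w := by
  have : CompleteSpace E := FiniteDimensional.complete ℝ E
  have hp := mem_extChartAt_source (I := 𝓘(ℝ, E)) p
  have hη := hθ.1.chartForm_contDiffOn (p := p)
  have hL := h.isLocalFlow hXs p
  have hne : chartForm p θ (extChartAt 𝓘(ℝ, E) p p) ≠ 0 := by
    intro h0
    refine hθ.ne_zero p ?_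
    ext v
    rw [← chartForm_extChartAt hp, h0]
    rfl
  -- In coordinates `dη(X, u) = -d(η(X))(u)` has the term `Dη(u)(X)` on both sides; cancelling it
  -- leaves the vanishing of the Lie derivative of `η` on `ker η`.
  have hcond : ∀ y ∈ (extChartAt 𝓘(ℝ, E) p).target, ∀ u, chartForm p θ y u = 0 →
      fderiv ℝ (chartForm p θ) y (chartField p X y) u
        + chartForm p θ y (fderiv ℝ (chartField p X) y u) = 0 := by
    intro y hy u hu
    obtain ⟨q, hq, rfl⟩ : ∃ q ∈ (extChartAt 𝓘(ℝ, E) p).source, extChartAt 𝓘(ℝ, E) p q = y :=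
      ⟨_, (extChartAt 𝓘(ℝ, E) p).map_target hy, (extChartAt 𝓘(ℝ, E) p).right_inv hy⟩
    obtain ⟨v, rfl⟩ := (chartDeriv_isInvertible hq).surjective u
    rw [chartForm_extChartAt hq] at hu
    have h1 := hX θ hθ q v (hθ.mem_iff.2 hu)
    rw [hθ.1.d_eq_chart hq, mvfderiv_eq_fderiv_chart hq
      (hθ.1.mdifferentiableAt_apply (hXs.diffAt q)), ← chartField_extChartAt hq X] at h1
    have h2 : (fun x => θ x (X x)) ∘ (extChartAt 𝓘(ℝ, E) p).symm
        =ᶠ[𝓝 (extChartAt 𝓘(ℝ, E) p q)] fun z => chartForm p θ z (chartField p X z) := by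
      filter_upwards [(isOpen_extChartAt_target p).mem_nhds hy] with z hz
      have hz' := (extChartAt 𝓘(ℝ, E) p).map_target hz
      change _ = θ _ ((chartDeriv (E := E) p _).inverse (chartDeriv (E := E) p _ (X _)))
      rw [chartDeriv_inverse_apply hz']
      rfl
    rw [h2.fderiv_eq,
      ((hL.hasFDerivAt_form hη hy).clm_apply (hL.hasFDerivAt_field hy)).fderiv] at h1
    simp only [_root_.add_apply, ContinuousLinearMap.comp_apply,
      ContinuousLinearMap.flip_apply] at h1
    linarith
  filter_upwards [h.eventually_mem p, hL.eventually_conformal hη hcond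
    (h.zero_mem_chartDomain p) hne] with t ht hl
  obtain ⟨l, hl0, hl1, hl2⟩ := hl
  have hΦ : chartFlow Fl p (t, extChartAt 𝓘(ℝ, E) p p) = extChartAt 𝓘(ℝ, E) p (Fl t p) := by
    rw [chartFlow, extChartAt_to_inv]
  have hS : ∀ v, IsLocalFlow.spaceDeriv (chartFlow Fl p) (t, extChartAt 𝓘(ℝ, E) p p)
      (chartDeriv (E := E) p p v)
      = chartDeriv (E := E) p (Fl t p) (mfderiv 𝓘(ℝ, E) 𝓘(ℝ, E) (Fl t) p v) := fun v =>
    (congrArg (fun A : TangentSpace 𝓘(ℝ, E) p →L[ℝ] E => A v)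
      (h.chartDeriv_comp_mfderiv hXs ht.1 hp ht.2)).symm
  refine ⟨l, hl0, fun v => ?_, fun v hv w hw => ?_⟩
  · have := hl1 (chartDeriv (E := E) p p v)
    rwa [hS, hΦ, chartForm_extChartAt ht.2, chartForm_extChartAt hp] at this
  · have := hl2 (chartDeriv (E := E) p p v) (chartDeriv (E := E) p p w)
      (by rw [chartForm_extChartAt hp]; exact hθ.mem_iff.1 hv)
      (by rw [chartForm_extChartAt hp]; exact hθ.mem_iff.1 hw)
    rwa [hS, hS, hΦ, ← hθ.1.d_eq_chart ht.2, ← hθ.1.d_eq_chart hp] at this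

end IsFlow

end ManifoldFlow

/-! ### Complexification: conjugation and complex-linear extensions. -/

namespace Cplx

variable {V : Type*} [AddCommGroup V]

@[simp] theorem sub_re (Z W : Cplx V) : (Z - W).re = Z.re - W.re := by
  rw [sub_eq_add_neg, sub_eq_add_neg]; rfl

@[simp] theorem sub_im (Z W : Cplx V) : (Z - W).im = Z.im - W.im := by
  rw [sub_eq_add_neg, sub_eq_add_neg]; rfl

@[simp] theorem conj_re (Z : Cplx V) : Z.conj.re = Z.re := rfl

@[simp] theorem conj_im (Z : Cplx V) : Z.conj.im = -Z.im := rfl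

@[simp] theorem conj_conj (Z : Cplx V) : Z.conj.conj = Z := by ext <;> simp

@[simp] theorem ofReal_re (v : V) : (ofReal v).re = v := rfl

@[simp] theorem ofReal_im (v : V) : (ofReal v).im = 0 := rfl

variable [Module ℝ V]

theorem conj_smul (c : ℂ) (Z : Cplx V) : (c • Z).conj = (starRingEnd ℂ) c • Z.conj := by
  ext <;> simp
  module

@[simp] theorem real_smul_re (r : ℝ) (Z : Cplx V) : (r • Z).re = r • Z.re :=
  (smul_re (r : ℂ) Z).trans (by simp)

@[simp] theorem real_smul_im (r : ℝ) (Z : Cplx V) : (r • Z).im = r • Z.im :=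
  (smul_im (r : ℂ) Z).trans (by simp)

/-- The complex-linear extension of a real-linear map. -/
def lift (j : V →ₗ[ℝ] V) : Cplx V →ₗ[ℂ] Cplx V where
  toFun Z := ⟨j Z.re, j Z.im⟩
  map_add' Z W := by ext <;> simp
  map_smul' c Z := by ext <;> simp

@[simp] theorem lift_re (j : V →ₗ[ℝ] V) (Z : Cplx V) : (lift j Z).re = j Z.re := rfl

@[simp] theorem lift_im (j : V →ₗ[ℝ] V) (Z : Cplx V) : (lift j Z).im = j Z.im := rfl

/-- The complex-bilinear extension of a real-bilinear form. -/
def lift₂ (B : V →ₗ[ℝ] V →ₗ[ℝ] ℝ) : Cplx V →ₗ[ℂ] Cplx V →ₗ[ℂ] ℂ :=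
  LinearMap.mk₂ ℂ (bilin fun v w => B v w)
    (fun _ _ _ => by apply Complex.ext <;> (simp [bilin]; ring))
    (fun _ _ _ => by apply Complex.ext <;> (simp [bilin]; ring))
    (fun _ _ _ => by apply Complex.ext <;> (simp [bilin]; ring))
    (fun _ _ _ => by apply Complex.ext <;> (simp [bilin]; ring))

end Cplx

/-! ### The spaces `H^{1,0}`, `H^{0,1}` and deformation tensors at a point. -/

section LinearAlgebra

variable {E : Type*} [NormedAddCommGroup E] [NormedSpace ℝ E]
  {M : Type*} [TopologicalSpace M] [ChartedSpace E M] [IsManifold 𝓘(ℝ, E) ∞ M]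

section

variable [FiniteDimensional ℝ E]

/-- The complex-bilinear extension of `dθ` at `x`. -/
def OneForm.Smooth.dC {θ : OneForm E M} (hθ : θ.Smooth) (x : M) :
    Cplx (TangentSpace 𝓘(ℝ, E) x) →ₗ[ℂ] Cplx (TangentSpace 𝓘(ℝ, E) x) →ₗ[ℂ] ℂ :=
  Cplx.lift₂ (LinearMap.mk₂ ℝ (θ.d x) (hθ.d_add_left x) (hθ.d_smul_left x) (hθ.d_add_right x)
    (hθ.d_smul_right x))

theorem OneForm.Smooth.dC_apply {θ : OneForm E M} (hθ : θ.Smooth) (x : M)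
    (Z W : Cplx (TangentSpace 𝓘(ℝ, E) x)) : hθ.dC x Z W = Cplx.bilin (θ.d x) Z W := rfl

theorem OneForm.Smooth.dC_swap {θ : OneForm E M} (hθ : θ.Smooth) (x : M)
    (Z W : Cplx (TangentSpace 𝓘(ℝ, E) x)) : hθ.dC x Z W = -hθ.dC x W Z := by
  simp only [hθ.dC_apply, Cplx.bilin]
  rw [θ.d_swap x Z.re, θ.d_swap x Z.im, θ.d_swap x Z.re, θ.d_swap x Z.im]
  apply Complex.ext
  · simp
    ring
  · simp

theorem OneForm.Smooth.dC_conj {θ : OneForm E M} (hθ : θ.Smooth) (x : M)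
    (Z W : Cplx (TangentSpace 𝓘(ℝ, E) x)) :
    hθ.dC x Z.conj W.conj = (starRingEnd ℂ) (hθ.dC x Z W) := by
  simp only [hθ.dC_apply, Cplx.bilin]
  apply Complex.ext
  · simp [hθ.d_neg_left, hθ.d_neg_right]
  · simp [hθ.d_neg_left, hθ.d_neg_right]
    ring

end

namespace ContactStructure

variable {C : ContactStructure E M} {x : M}
  {j j' : TangentSpace 𝓘(ℝ, E) x →ₗ[ℝ] TangentSpace 𝓘(ℝ, E) x}

/-- The complexification of `H` at `x`. -/
def CH (C : ContactStructure E M) (x : M) : Submodule ℂ (Cplx (TangentSpace 𝓘(ℝ, E) x)) where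
  carrier := {Z | Z.re ∈ C.H x ∧ Z.im ∈ C.H x}
  zero_mem' := ⟨Submodule.zero_mem _, Submodule.zero_mem _⟩
  add_mem' := fun h h' => ⟨Submodule.add_mem _ h.1 h'.1, Submodule.add_mem _ h.2 h'.2⟩
  smul_mem' := fun c _ h =>
    ⟨Submodule.sub_mem _ (Submodule.smul_mem _ _ h.1) (Submodule.smul_mem _ _ h.2),
      Submodule.add_mem _ (Submodule.smul_mem _ _ h.2) (Submodule.smul_mem _ _ h.1)⟩

theorem conj_mem_CH {Z : Cplx (TangentSpace 𝓘(ℝ, E) x)} (hZ : Z ∈ C.CH x) : Z.conj ∈ C.CH x :=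
  ⟨hZ.1, Submodule.neg_mem _ hZ.2⟩

theorem mem_H10_iff {Z : Cplx (TangentSpace 𝓘(ℝ, E) x)} :
    Z ∈ C.H10 x j ↔ Z ∈ C.CH x ∧ j Z.re = -Z.im ∧ j Z.im = Z.re := by
  change (_ ∧ _ ∧ _) ↔ ((_ ∧ _) ∧ _)
  rw [Cplx.ext_iff]
  simp [and_assoc]

theorem mem_H01_iff {Z : Cplx (TangentSpace 𝓘(ℝ, E) x)} :
    Z ∈ C.H01 x j ↔ Z ∈ C.CH x ∧ j Z.re = Z.im ∧ j Z.im = -Z.re := by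
  change (_ ∧ _ ∧ _) ↔ ((_ ∧ _) ∧ _)
  rw [Cplx.ext_iff]
  simp [and_assoc]

theorem H10_le_CH : C.H10 x j ≤ C.CH x := fun _ h => (mem_H10_iff.1 h).1

theorem H01_le_CH : C.H01 x j ≤ C.CH x := fun _ h => (mem_H01_iff.1 h).1

theorem conj_mem_H01 {Z : Cplx (TangentSpace 𝓘(ℝ, E) x)} (hZ : Z ∈ C.H10 x j) :
    Z.conj ∈ C.H01 x j := by
  rw [mem_H10_iff] at hZ
  rw [mem_H01_iff]
  exact ⟨conj_mem_CH hZ.1, hZ.2.1, by simp [hZ.2.2]⟩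

theorem conj_mem_H10 {Z : Cplx (TangentSpace 𝓘(ℝ, E) x)} (hZ : Z ∈ C.H01 x j) :
    Z.conj ∈ C.H10 x j := by
  rw [mem_H01_iff] at hZ
  rw [mem_H10_iff]
  exact ⟨conj_mem_CH hZ.1, by simp [hZ.2.1], by simp [hZ.2.2]⟩

/-- The projection `V ↦ (V - i j V) / 2` onto `H^{1,0}`. -/
def proj10 (j : TangentSpace 𝓘(ℝ, E) x →ₗ[ℝ] TangentSpace 𝓘(ℝ, E) x) :
    Cplx (TangentSpace 𝓘(ℝ, E) x) →ₗ[ℂ] Cplx (TangentSpace 𝓘(ℝ, E) x) :=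
  (1 / 2 : ℂ) • (LinearMap.id - Complex.I • Cplx.lift j)

/-- The projection `V ↦ (V + i j V) / 2` onto `H^{0,1}`. -/
def proj01 (j : TangentSpace 𝓘(ℝ, E) x →ₗ[ℝ] TangentSpace 𝓘(ℝ, E) x) :
    Cplx (TangentSpace 𝓘(ℝ, E) x) →ₗ[ℂ] Cplx (TangentSpace 𝓘(ℝ, E) x) :=
  (1 / 2 : ℂ) • (LinearMap.id + Complex.I • Cplx.lift j)

theorem proj10_add_proj01 (j : TangentSpace 𝓘(ℝ, E) x →ₗ[ℝ] TangentSpace 𝓘(ℝ, E) x)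
    (V : Cplx (TangentSpace 𝓘(ℝ, E) x)) : proj10 j V + proj01 j V = V := by
  simp only [proj10, proj01, LinearMap.smul_apply, LinearMap.sub_apply, LinearMap.add_apply,
    LinearMap.id_apply]
  module

theorem proj10_of_mem_H10 {Z : Cplx (TangentSpace 𝓘(ℝ, E) x)} (hZ : Z ∈ C.H10 x j) :
    proj10 j Z = Z := by
  have h : Cplx.lift j Z = Complex.I • Z := hZ.2.2
  simp only [proj10, LinearMap.smul_apply, LinearMap.sub_apply, LinearMap.id_apply, h, smul_smul,
    Complex.I_mul_I]
  module

theorem proj10_of_mem_H01 {Z : Cplx (TangentSpace 𝓘(ℝ, E) x)} (hZ : Z ∈ C.H01 x j) :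
    proj10 j Z = 0 := by
  have h : Cplx.lift j Z = (-Complex.I) • Z := hZ.2.2
  simp only [proj10, LinearMap.smul_apply, LinearMap.sub_apply, LinearMap.id_apply, h, smul_smul,
    mul_neg, Complex.I_mul_I]
  module

namespace IsCompatibleAt

variable (hj : C.IsCompatibleAt x j)
include hj

theorem lift_lift {V : Cplx (TangentSpace 𝓘(ℝ, E) x)} (hV : V ∈ C.CH x) :
    Cplx.lift j (Cplx.lift j V) = -V := by
  ext
  · simp [hj.sq _ hV.1]
  · simp [hj.sq _ hV.2]

theorem lift_mem {V : Cplx (TangentSpace 𝓘(ℝ, E) x)} (hV : V ∈ C.CH x) :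
    Cplx.lift j V ∈ C.CH x := ⟨hj.maps _ hV.1, hj.maps _ hV.2⟩

theorem proj10_mem {V : Cplx (TangentSpace 𝓘(ℝ, E) x)} (hV : V ∈ C.CH x) :
    proj10 j V ∈ C.H10 x j := by
  have h1 : proj10 j V ∈ C.CH x :=
    Submodule.smul_mem _ _ (Submodule.sub_mem _ hV (Submodule.smul_mem _ _ (hj.lift_mem hV)))
  refine ⟨h1.1, h1.2, ?_⟩
  change Cplx.lift j (proj10 j V) = Complex.I • proj10 j V
  simp only [proj10, LinearMap.smul_apply, LinearMap.sub_apply, LinearMap.id_apply, map_smul,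
    map_sub, hj.lift_lift hV]
  rw [smul_comm Complex.I, smul_sub Complex.I, smul_smul Complex.I, Complex.I_mul_I]
  module

theorem proj01_mem {V : Cplx (TangentSpace 𝓘(ℝ, E) x)} (hV : V ∈ C.CH x) :
    proj01 j V ∈ C.H01 x j := by
  have h1 : proj01 j V ∈ C.CH x :=
    Submodule.smul_mem _ _ (Submodule.add_mem _ hV (Submodule.smul_mem _ _ (hj.lift_mem hV)))
  refine ⟨h1.1, h1.2, ?_⟩
  change Cplx.lift j (proj01 j V) = (-Complex.I) • proj01 j V
  simp only [proj01, LinearMap.smul_apply, LinearMap.add_apply, LinearMap.id_apply, map_smul,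
    map_add, hj.lift_lift hV]
  rw [smul_comm (-Complex.I), smul_add (-Complex.I), smul_smul (-Complex.I), neg_mul,
    Complex.I_mul_I]
  module

theorem mk_mem_H10 {v : TangentSpace 𝓘(ℝ, E) x} (hv : v ∈ C.H x) :
    (⟨v, -j v⟩ : Cplx (TangentSpace 𝓘(ℝ, E) x)) ∈ C.H10 x j :=
  mem_H10_iff.2 ⟨⟨hv, Submodule.neg_mem _ (hj.maps v hv)⟩, by simp, by simp [hj.sq v hv]⟩

/-- Taking real parts identifies `H^{1,0}` with `H`. -/
def reEquiv : C.H10 x j ≃ₗ[ℝ] C.H x where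
  toFun Z := ⟨Z.1.re, Z.2.1⟩
  map_add' _ _ := rfl
  map_smul' r Z := Subtype.ext (Cplx.real_smul_re r Z.1)
  invFun v := ⟨⟨v, -j v⟩, hj.mk_mem_H10 v.2⟩
  left_inv Z := by
    ext
    · rfl
    · simp [(mem_H10_iff.1 Z.2).2.1]
  right_inv _ := rfl

/-- The dimension depends on `H` alone, so the `(1,0)`-spaces of any two compatible complex
structures have equal dimension. -/
theorem finrank_H10 : 2 * finrank ℂ (C.H10 x j) = finrank ℝ (C.H x) := by
  rw [← finrank_real_of_complex, hj.reEquiv.finrank_eq]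

section

variable [FiniteDimensional ℝ E]

theorem finiteDimensional_H10 : FiniteDimensional ℂ (C.H10 x j) := by
  have : FiniteDimensional ℝ (TangentSpace 𝓘(ℝ, E) x) := inferInstanceAs (FiniteDimensional ℝ E)
  have : FiniteDimensional ℝ (C.H10 x j) := hj.reEquiv.symm.finiteDimensional
  exact FiniteDimensional.right ℝ ℂ _

/-- Symmetry of the Levi form gives `dθ(jv, jw) = dθ(w, j(jv)) = -dθ(w, v)`. -/
theorem d_map_map {θ : OneForm E M} (hθ : C.IsContactForm θ) {v w : TangentSpace 𝓘(ℝ, E) x}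
    (hv : v ∈ C.H x) (hw : w ∈ C.H x) : θ.d x (j v) (j w) = θ.d x v w := by
  rw [hj.symm θ hθ _ (hj.maps v hv) w hw, hj.sq v hv, hθ.1.d_neg_right, θ.d_swap x v w]

/-- `dθ` vanishes on `H^{1,0} × H^{1,0}`. -/
theorem dC_H10_H10 {θ : OneForm E M} (hθ : C.IsContactForm θ)
    {Z W : Cplx (TangentSpace 𝓘(ℝ, E) x)} (hZ : Z ∈ C.H10 x j) (hW : W ∈ C.H10 x j) :
    hθ.1.dC x Z W = 0 := by
  rw [mem_H10_iff] at hZ hW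
  have h1 := hj.d_map_map hθ hZ.1.1 hW.1.1
  have h2 := hj.symm θ hθ _ hZ.1.1 _ hW.1.1
  rw [hZ.2.1, hW.2.1] at h1
  rw [hZ.2.1, hW.2.1, hθ.1.d_neg_right, hθ.1.d_neg_right, θ.d_swap x W.re] at h2
  rw [hθ.1.d_neg_left, hθ.1.d_neg_right] at h1
  rw [hθ.1.dC_apply]
  apply Complex.ext
  · simp only [Cplx.bilin, Complex.zero_re]; linarith
  · simp only [Cplx.bilin, Complex.zero_im]; linarith

/-- The Levi form is positive definite on `H^{1,0}`. -/
theorem dC_conj_eq {θ : OneForm E M} (hθ : C.IsContactForm θ)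
    {Z : Cplx (TangentSpace 𝓘(ℝ, E) x)} (hZ : Z ∈ C.H10 x j) :
    hθ.1.dC x Z Z.conj = Complex.I * (2 * θ.d x Z.re (j Z.re) : ℝ) := by
  rw [mem_H10_iff] at hZ
  rw [hθ.1.dC_apply, hZ.2.1, hθ.1.d_neg_right]
  apply Complex.ext
  · simp [Cplx.bilin, hθ.1.d_neg_right, OneForm.d_self]
  · simp [Cplx.bilin, hθ.1.d_neg_right, OneForm.d_self]
    rw [θ.d_swap x Z.im]
    ring

theorem eq_zero_of_re_eq_zero {Z : Cplx (TangentSpace 𝓘(ℝ, E) x)} (hZ : Z ∈ C.H10 x j)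
    (h : Z.re = 0) : Z = 0 := by
  rw [mem_H10_iff] at hZ
  have := hZ.2.1
  rw [h, map_zero, zero_eq_neg] at this
  exact Cplx.ext h this

/-- On the real part `u` of a common vector, `j` gives the imaginary part and `j'` gives its
negative. Positivity of both Levi forms would make `dθ(u, ju)` and `-dθ(u, ju)` positive unless `u =
0`. -/
theorem disjoint_H10_H01 (hj' : C.IsCompatibleAt x j') {U : Cplx (TangentSpace 𝓘(ℝ, E) x)}
    (hU : U ∈ C.H10 x j') (hU' : U ∈ C.H01 x j) : U = 0 := by
  obtain ⟨θ, hθ⟩ := C.exists_isContactForm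
  refine hj'.eq_zero_of_re_eq_zero hU ?_
  rw [mem_H10_iff] at hU
  rw [mem_H01_iff] at hU'
  by_contra hne
  have h1 := hj.posDef θ hθ _ hU.1.1 hne
  have h2 := hj'.posDef θ hθ _ hU.1.1 hne
  rw [hU'.2.1] at h1
  rw [hU.2.1, hθ.1.d_neg_right] at h2
  linarith

theorem proj_injective {Z Z' : Cplx (TangentSpace 𝓘(ℝ, E) x)} (hZ : Z ∈ C.H10 x j)
    (hZ' : Z' ∈ C.H10 x j) {V V' : Cplx (TangentSpace 𝓘(ℝ, E) x)} (hV : V ∈ C.H01 x j)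
    (hV' : V' ∈ C.H01 x j) (h : Z + V = Z' + V') : Z = Z' ∧ V = V' := by
  have h1 := congrArg (proj10 j) h
  rw [map_add, map_add, proj10_of_mem_H10 hZ, proj10_of_mem_H10 hZ', proj10_of_mem_H01 hV,
    proj10_of_mem_H01 hV', add_zero, add_zero] at h1
  subst h1
  exact ⟨rfl, add_left_cancel h⟩

/-- The deformation tensor maps the `(1,0)`-part of a deformed `(1,0)`-vector to its
`(0,1)`-part. -/
theorem deformationTensor_proj10 {φ : C.H10 x j →ₗ[ℂ] C.H01 x j}
    (hφ : C.IsDeformationTensor x j j' φ) {U : Cplx (TangentSpace 𝓘(ℝ, E) x)}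
    (hU : U ∈ C.H10 x j') :
    (φ ⟨proj10 j U, hj.proj10_mem (H10_le_CH hU)⟩ : Cplx (TangentSpace 𝓘(ℝ, E) x))
      = proj01 j U := by
  obtain ⟨Z, hZ⟩ := (hφ U).1 hU
  have h1 := hj.proj_injective (hj.proj10_mem (H10_le_CH hU)) Z.2
    (hj.proj01_mem (H10_le_CH hU)) (φ Z).2 ((proj10_add_proj01 j U).trans hZ)
  have h2 : (⟨proj10 j U, hj.proj10_mem (H10_le_CH hU)⟩ : C.H10 x j) = Z := Subtype.ext h1.1
  rw [h2, h1.2]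

/-- A compatible complex structure has a unique deformation tensor with respect to another one. -/
theorem existsUnique_deformationTensor (hj' : C.IsCompatibleAt x j') :
    ∃! φ : C.H10 x j →ₗ[ℂ] C.H01 x j, C.IsDeformationTensor x j j' φ := by
  have := hj.finiteDimensional_H10
  have := hj'.finiteDimensional_H10
  -- The two components of the inclusion of the deformed `(1,0)`-space. The kernel of `L` is its
  -- intersection with `H^{0,1}`, which is zero; by dimension `L` is bijective, and the space is the
  -- graph of `R ∘ L⁻¹`.
  let L : C.H10 x j' →ₗ[ℂ] C.H10 x j :=
    ((proj10 j).domRestrict _).codRestrict _ fun U => hj.proj10_mem (H10_le_CH U.2)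
  let R : C.H10 x j' →ₗ[ℂ] C.H01 x j :=
    ((proj01 j).domRestrict _).codRestrict _ fun U => hj.proj01_mem (H10_le_CH U.2)
  have hLR : ∀ U : C.H10 x j', (U : Cplx (TangentSpace 𝓘(ℝ, E) x)) = L U + R U := fun U =>
    (proj10_add_proj01 j U.1).symm
  have hL : Function.Injective L := by
    rw [← LinearMap.ker_eq_bot, LinearMap.ker_eq_bot']
    intro U hU
    have h1 := hLR U
    rw [hU] at h1
    refine Subtype.ext (hj.disjoint_H10_H01 hj' U.2 ?_)
    rw [h1]
    simp
  have hdim : finrank ℂ (C.H10 x j') = finrank ℂ (C.H10 x j) := by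
    have h1 := hj.finrank_H10
    have h2 := hj'.finrank_H10
    omega
  let e := LinearEquiv.ofInjectiveOfFinrankEq L hL hdim
  have he : ∀ Z, L (e.symm Z) = Z := fun Z => e.apply_symm_apply Z
  refine ⟨R ∘ₗ e.symm.toLinearMap, fun W => ⟨fun hW => ⟨L ⟨W, hW⟩, ?_⟩, ?_⟩, fun φ hφ => ?_⟩
  · have h1 : e.symm (L ⟨W, hW⟩) = ⟨W, hW⟩ := e.symm_apply_apply _
    rw [LinearMap.comp_apply, LinearEquiv.coe_coe, h1]
    exact hLR ⟨W, hW⟩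
  · rintro ⟨Z, rfl⟩
    have h1 := hLR (e.symm Z)
    rw [he] at h1
    rw [LinearMap.comp_apply, LinearEquiv.coe_coe, ← h1]
    exact (e.symm Z).2
  · ext1 Z
    refine Subtype.ext ?_
    have h1 := hj.deformationTensor_proj10 hφ (e.symm Z).2
    have h2 : (⟨proj10 j (e.symm Z).1, hj.proj10_mem (H10_le_CH (e.symm Z).2)⟩ : C.H10 x j) = Z :=
      he Z
    rw [h2] at h1
    exact h1

end

end IsCompatibleAt

/-- A conformal isomorphism pulls compatible complex structures back to such. -/
theorem IsCompatibleAt.pullback [FiniteDimensional ℝ E] {p q : M}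
    {J : TangentSpace 𝓘(ℝ, E) q →ₗ[ℝ] TangentSpace 𝓘(ℝ, E) q} (hJ : C.IsCompatibleAt q J)
    {A : TangentSpace 𝓘(ℝ, E) p →L[ℝ] TangentSpace 𝓘(ℝ, E) q} (hA : A.IsInvertible)
    {θ : OneForm E M} (hθ : C.IsContactForm θ) {l : ℝ} (hl : 0 < l)
    (h1 : ∀ v, θ q (A v) = l * θ p v)
    (h2 : ∀ v ∈ C.H p, ∀ w ∈ C.H p, θ.d q (A v) (A w) = l * θ.d p v w) :
    C.IsCompatibleAt p (A.inverse.toLinearMap ∘ₗ J ∘ₗ A.toLinearMap) := by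
  obtain ⟨e, rfl⟩ := hA
  rw [ContinuousLinearMap.inverse_equiv]
  have hH : ∀ v, e v ∈ C.H q ↔ v ∈ C.H p := fun v => by
    rw [hθ.mem_iff, hθ.mem_iff]
    have := h1 v
    simp only [ContinuousLinearEquiv.coe_coe] at this
    simp [this, hl.ne']
  have hs : ∀ v, e (e.symm v) = v := e.apply_symm_apply
  have hmaps : ∀ v ∈ C.H p, e.symm (J (e v)) ∈ C.H p := fun v hv => by
    rw [← hH, hs]
    exact hJ.maps _ ((hH v).2 hv)
  -- Compatibility quantifies over all contact forms. For `θ' = mθ` the conformal factor changes by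
  -- the ratio of the values of `m` at `q` and `p`, hence stays positive.
  have h3 : ∀ θ', C.IsContactForm θ' → ∃ l' : ℝ, 0 < l' ∧
      ∀ v ∈ C.H p, ∀ w ∈ C.H p, θ'.d q (e v) (e w) = l' * θ'.d p v w := by
    intro θ' hθ'
    obtain ⟨m, hm, hm', hmd⟩ := hθ.exists_smul hθ'
    refine ⟨m q * l / m p, div_pos (mul_pos (hm q) hl) (hm p), fun v hv w hw => ?_⟩
    rw [hθ.d_eq_mul hm' (hmd q) ((hH v).2 hv) ((hH w).2 hw), hθ.d_eq_mul hm' (hmd p) hv hw]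
    have := h2 v hv w hw
    simp only [ContinuousLinearEquiv.coe_coe] at this
    rw [this]
    field_simp [(hm p).ne']
  refine ⟨hmaps, fun v hv => ?_, fun θ' hθ' v hv w hw => ?_, fun θ' hθ' v hv w hw => ?_,
    fun θ' hθ' v hv hne => ?_⟩
  · change e.symm (J (e (e.symm (J (e v))))) = -v
    rw [hs, hJ.sq _ ((hH v).2 hv), map_neg, e.symm_apply_apply]
  · obtain ⟨l', hl', h⟩ := h3 θ' hθ'
    change θ'.d p v (e.symm (J (e w))) = θ'.d p w (e.symm (J (e v)))
    have ha := h v hv _ (hmaps w hw)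
    have hb := h w hw _ (hmaps v hv)
    rw [hs] at ha hb
    rw [hJ.symm θ' hθ' _ ((hH v).2 hv) _ ((hH w).2 hw), hb] at ha
    exact (mul_left_cancel₀ hl'.ne' ha).symm
  · obtain ⟨l', hl', h⟩ := h3 θ' hθ'
    change θ'.d p (e.symm (J (e v))) (e.symm (J (e (e.symm (J (e w))))))
      = θ'.d p v (e.symm (J (e w)))
    have ha := h _ (hmaps v hv) _ (hmaps _ (hmaps w hw))
    have hb := h v hv _ (hmaps w hw)
    rw [hs, hs, hs] at ha
    rw [hs] at hb
    rw [hJ.herm θ' hθ' _ ((hH v).2 hv) _ ((hH w).2 hw), hb] at ha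
    rw [hs]
    exact (mul_left_cancel₀ hl'.ne' ha).symm
  · obtain ⟨l', hl', h⟩ := h3 θ' hθ'
    change 0 < θ'.d p v (e.symm (J (e v)))
    have ha := h v hv _ (hmaps v hv)
    rw [hs] at ha
    have hp := hJ.posDef θ' hθ' _ ((hH v).2 hv) (by simpa using hne)
    rw [ha] at hp
    exact pos_of_mul_pos_right hp hl'.le

end ContactStructure

namespace AlmostCR

variable {C : ContactStructure E M} (S : AlmostCR C) {x : M}

theorem proj01_eq (V : Cplx (TangentSpace 𝓘(ℝ, E) x)) :
    S.proj01 x V = ContactStructure.proj01 (S.J x) V := rfl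

variable [FiniteDimensional ℝ E]

theorem clevi_eq {θ : OneForm E M} (hθ : θ.Smooth) (Z W : Cplx (TangentSpace 𝓘(ℝ, E) x)) :
    S.clevi θ x Z W = hθ.dC x Z (Cplx.lift (S.J x) W) := rfl

/-- Here `J` acts as `-i`. This turns Levi pairings into pairings under `dθ`, which no longer
involve `J`. -/
theorem clevi_of_mem_H01 {θ : OneForm E M} (hθ : θ.Smooth) (Z : Cplx (TangentSpace 𝓘(ℝ, E) x))
    {W : Cplx (TangentSpace 𝓘(ℝ, E) x)} (hW : W ∈ C.H01 x (S.J x)) :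
    S.clevi θ x Z W = -(Complex.I * hθ.dC x Z W) := by
  have h : Cplx.lift (S.J x) W = (-Complex.I) • W := hW.2.2
  rw [S.clevi_eq hθ, h, map_smul, smul_eq_mul, neg_mul]

end AlmostCR

end LinearAlgebra

/-! ### Unitary frames and densities of weight `(1,1)`. -/

theorem InnerProductSpace.Core.exists_orthonormal_basis {V : Type*} [AddCommGroup V] [Module ℂ V]
    [FiniteDimensional ℂ V] (core : InnerProductSpace.Core ℂ V) {n : ℕ} (hn : finrank ℂ V = n) :
    ∃ b : Basis (Fin n) ℂ V, ∀ i k, core.inner (b i) (b k) = if i = k then 1 else 0 := by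
  let _ : NormedAddCommGroup V := core.toNormedAddCommGroup
  let _ : InnerProductSpace ℂ V := InnerProductSpace.ofCore core.toCore
  let b := (stdOrthonormalBasis ℂ V).reindex (finCongr hn)
  refine ⟨b.toBasis, fun i k => ?_⟩
  have h := (orthonormal_iff_ite.1 b.orthonormal) i k
  rw [OrthonormalBasis.coe_toBasis]
  exact h

section Densities

variable {E : Type*} [NormedAddCommGroup E] [NormedSpace ℝ E] [FiniteDimensional ℝ E]
  {M : Type*} [TopologicalSpace M] [ChartedSpace E M] [IsManifold 𝓘(ℝ, E) ∞ M]
  {C : ContactStructure E M}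

theorem ContactStructure.finrank_H (C : ContactStructure E M) (x : M) :
    finrank ℝ (C.H x) + 1 = finrank ℝ E := by
  obtain ⟨θ, hθ⟩ := C.exists_isContactForm
  have : FiniteDimensional ℝ (TangentSpace 𝓘(ℝ, E) x) := inferInstanceAs (FiniteDimensional ℝ E)
  have h1 : C.H x = LinearMap.ker (θ x).toLinearMap := by
    ext v
    rw [hθ.mem_iff]
    rfl
  have h2 : ((θ x).toLinearMap : Module.Dual ℝ (TangentSpace 𝓘(ℝ, E) x)) ≠ 0 := fun h =>
    hθ.ne_zero x (ContinuousLinearMap.coe_injective h)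
  rw [h1]
  exact Module.Dual.finrank_ker_add_one_of_ne_zero h2

theorem ContactStructure.IsCompatibleAt.finrank_H10_eq {x : M}
    {j : TangentSpace 𝓘(ℝ, E) x →ₗ[ℝ] TangentSpace 𝓘(ℝ, E) x} (hj : C.IsCompatibleAt x j) {n : ℕ}
    (hn : finrank ℝ E = 2 * n + 1) : finrank ℂ (C.H10 x j) = n := by
  have h1 := hj.finrank_H10
  have h2 := C.finrank_H x
  omega

namespace AlmostCR

variable (S : AlmostCR C) {θ : OneForm E M} {n : ℕ}

/-- The Hermitian inner product on `H^{1,0}` given by the Levi form. -/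
abbrev leviCore (hθ : C.IsContactForm θ) (x : M) :
    InnerProductSpace.Core ℂ (C.H10 x (S.J x)) where
  -- The arguments are swapped because the inner product is conjugate-linear in its first argument.
  inner Z W := S.clevi θ x W (Z : Cplx (TangentSpace 𝓘(ℝ, E) x)).conj
  conj_inner_symm Z W := by
    rw [S.clevi_of_mem_H01 hθ.1 _ (ContactStructure.conj_mem_H01 Z.2),
      S.clevi_of_mem_H01 hθ.1 _ (ContactStructure.conj_mem_H01 W.2), map_neg, map_mul,
      ← hθ.1.dC_conj, Cplx.conj_conj, hθ.1.dC_swap]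
    simp
  re_inner_nonneg Z := by
    rw [S.clevi_of_mem_H01 hθ.1 _ (ContactStructure.conj_mem_H01 Z.2),
      (S.compatible x).dC_conj_eq hθ Z.2, ← mul_assoc, Complex.I_mul_I]
    simp only [neg_mul, one_mul, neg_neg]
    change 0 ≤ 2 * θ.d x _ _
    by_cases h : (Z : Cplx (TangentSpace 𝓘(ℝ, E) x)).re = 0
    · rw [h, hθ.1.d_zero_left, mul_zero]
    · have := (S.compatible x).posDef θ hθ _ Z.2.1 h
      positivity
  add_left Z W V := by
    rw [S.clevi_of_mem_H01 hθ.1 _ (ContactStructure.conj_mem_H01 Z.2),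
      S.clevi_of_mem_H01 hθ.1 _ (ContactStructure.conj_mem_H01 W.2),
      S.clevi_of_mem_H01 hθ.1 _ (ContactStructure.conj_mem_H01 (Z + W).2)]
    have : ((Z + W : C.H10 x (S.J x)) : Cplx (TangentSpace 𝓘(ℝ, E) x)).conj
        = (Z : Cplx (TangentSpace 𝓘(ℝ, E) x)).conj + (W : Cplx (TangentSpace 𝓘(ℝ, E) x)).conj := by
      ext <;> simp [add_comm]
    rw [this, map_add]
    ring
  smul_left Z W r := by
    rw [S.clevi_of_mem_H01 hθ.1 _ (ContactStructure.conj_mem_H01 Z.2),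
      S.clevi_of_mem_H01 hθ.1 _ (ContactStructure.conj_mem_H01 (r • Z).2)]
    rw [Submodule.coe_smul, Cplx.conj_smul, map_smul, smul_eq_mul]
    ring
  definite Z hZ := by
    change S.clevi θ x Z (Z : Cplx (TangentSpace 𝓘(ℝ, E) x)).conj = 0 at hZ
    rw [S.clevi_of_mem_H01 hθ.1 _ (ContactStructure.conj_mem_H01 Z.2),
      (S.compatible x).dC_conj_eq hθ Z.2, ← mul_assoc, Complex.I_mul_I] at hZ
    refine Subtype.ext ((S.compatible x).eq_zero_of_re_eq_zero Z.2 ?_)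
    by_contra h
    have := (S.compatible x).posDef θ hθ _ Z.2.1 h
    simp only [neg_mul, one_mul, neg_neg, Complex.ofReal_eq_zero] at hZ
    linarith

theorem exists_unitary_frame (hθ : C.IsContactForm θ) (x : M) (hn : finrank ℝ E = 2 * n + 1) :
    ∃ Z : Basis (Fin n) ℂ (C.H10 x (S.J x)), ∀ a b,
      S.clevi θ x (Z a) (Z b : Cplx (TangentSpace 𝓘(ℝ, E) x)).conj = if a = b then 1 else 0 := by
  have := (S.compatible x).finiteDimensional_H10
  obtain ⟨Z, hZ⟩ := (S.leviCore hθ x).exists_orthonormal_basis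
    ((S.compatible x).finrank_H10_eq hn)
  refine ⟨Z, fun a b => ?_⟩
  rw [← if_congr (eq_comm (a := b)) rfl rfl]
  exact hZ b a

/-- The complex covector `V ↦ h(V, conj Z)` for `Z ∈ H^{1,0}`, extended by zero to the Reeb
direction. -/
def dualCovec (hθ : C.IsContactForm θ) (x : M) (Z : Cplx (TangentSpace 𝓘(ℝ, E) x)) :
    Cplx (TangentSpace 𝓘(ℝ, E) x) →ₗ[ℂ] ℂ := (-Complex.I) • (hθ.1.dC x).flip Z.conj

theorem dualCovec_apply (hθ : C.IsContactForm θ) (x : M) (Z V : Cplx (TangentSpace 𝓘(ℝ, E) x)) :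
    dualCovec hθ x Z V = -(Complex.I * hθ.1.dC x V Z.conj) := by
  simp [dualCovec]

/-- `Trivializes` constrains `f` only where a unitary coframe exists, so one must be produced.
Contraction of `dθ` with `conj Z` kills the Reeb direction by itself, and `H^{0,1}` by isotropy. -/
theorem isUnitaryCoframe_dualCovec (hθ : C.IsContactForm θ) (x : M)
    {Z : Fin n → Cplx (TangentSpace 𝓘(ℝ, E) x)} (hZ : ∀ a, Z a ∈ C.H10 x (S.J x))
    (hu : ∀ a b, S.clevi θ x (Z a) (Z b).conj = if a = b then 1 else 0) :
    S.IsUnitaryCoframe θ n x fun a => dualCovec hθ x (Z a) := by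
  refine ⟨⟨Z, hZ, hu, fun a b => ?_⟩, fun a V hV => ?_, fun a v hv => ?_⟩
  · rw [dualCovec_apply, ← S.clevi_of_mem_H01 hθ.1 _ (ContactStructure.conj_mem_H01 (hZ a)), hu]
    simp only [eq_comm]
  · have h1 := (S.compatible x).dC_H10_H10 hθ (ContactStructure.conj_mem_H10 hV) (hZ a)
    have h2 := hθ.1.dC_conj x V.conj (Z a)
    rw [h1, Cplx.conj_conj, map_zero] at h2
    rw [dualCovec_apply, h2, mul_zero, neg_zero]
  · rw [dualCovec_apply, hθ.1.dC_apply]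
    simp only [Cplx.bilin, Cplx.ofReal_re, Cplx.ofReal_im, hv, hθ.1.d_zero_left, sub_zero,
      add_zero]
    exact neg_eq_zero.2 (mul_eq_zero_of_right Complex.I rfl)

theorem wedge_mem_canonical (hθ : C.IsContactForm θ) {x : M}
    {c : Fin n → (Cplx (TangentSpace 𝓘(ℝ, E) x) →ₗ[ℂ] ℂ)} (hc : S.IsUnitaryCoframe θ n x c) :
    Cplx.wedge (Fin.cons (Cplx.covec (θ x).toLinearMap) c) ∈ S.canonical n x := by
  intro v hv
  refine Matrix.det_eq_zero_of_row_eq_zero 0 fun k => ?_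
  change (Fin.cons (Cplx.covec (θ x).toLinearMap) c : Fin (n + 1) → _) k (v 0) = 0
  refine Fin.cases ?_ (fun a => ?_) k
  · rw [Fin.cons_zero]
    have h1 := hθ.mem_iff.1 hv.1
    have h2 := hθ.mem_iff.1 hv.2.1
    apply Complex.ext
    · exact h1
    · exact h2
  · rw [Fin.cons_succ]
    exact hc.2.1 a _ hv

/-- Evaluated on `v, Z_1, …, Z_n` with `θ(v) ≠ 0`, the determinant is triangular because `θ` kills
`Z_a`. The homogeneity of a density is assumed only at nonzero forms. -/
theorem wedge_ne_zero (hθ : C.IsContactForm θ) {x : M}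
    {c : Fin n → (Cplx (TangentSpace 𝓘(ℝ, E) x) →ₗ[ℂ] ℂ)} (hc : S.IsUnitaryCoframe θ n x c) :
    Cplx.wedge (Fin.cons (Cplx.covec (θ x).toLinearMap) c) ≠ 0 := by
  obtain ⟨⟨Z, hZ, -, hcZ⟩, -⟩ := hc
  obtain ⟨v, hv⟩ : ∃ v, θ x v ≠ 0 := by
    by_contra! hcon
    exact hθ.ne_zero x (ContinuousLinearMap.ext hcon)
  intro h0
  have h1 : Matrix.det (Matrix.of fun i k : Fin (n + 1) =>
      (Fin.cons (Cplx.covec (θ x).toLinearMap) c : Fin (n + 1) → _) k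
        ((Fin.cons (Cplx.ofReal v) Z : Fin (n + 1) → Cplx (TangentSpace 𝓘(ℝ, E) x)) i)) = 0 :=
    congrArg (fun ζ : Cplx (TangentSpace 𝓘(ℝ, E) x) [⋀^Fin (n + 1)]→ₗ[ℂ] ℂ =>
      ζ (Fin.cons (Cplx.ofReal v) Z)) h0
  have hz : ∀ i : Fin n, Cplx.covec (θ x).toLinearMap (Z i) = 0 := fun i =>
    Complex.ext (hθ.mem_iff.1 (hZ i).1) (hθ.mem_iff.1 (hZ i).2.1)
  rw [Matrix.det_of_isUpperTriangular] at h1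
  · rw [Fin.prod_univ_succ] at h1
    simp only [Matrix.of_apply, Fin.cons_zero, Fin.cons_succ, hcZ, if_true, Finset.prod_const_one,
      mul_one] at h1
    exact hv (congrArg Complex.re h1)
  · intro i k hik
    rw [Matrix.of_apply]
    induction i using Fin.cases with
    | zero => exact absurd hik (Fin.not_lt_zero k)
    | succ i =>
      induction k using Fin.cases with
      | zero => rw [Fin.cons_zero, Fin.cons_succ, hz]
      | succ k =>
        rw [Fin.cons_succ, Fin.cons_succ, hcZ, if_neg]
        rintro rfl
        exact lt_irrefl _ hik

theorem wedge_rescale {V : Type*} [AddCommGroup V] [Module ℝ V] {θ₀ θ₁ : Cplx V →ₗ[ℂ] ℂ}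
    {c₀ c₁ : Fin n → (Cplx V →ₗ[ℂ] ℂ)} {l s : ℂ} {k : Fin n → ℂ}
    (h₀ : θ₁ = l • θ₀) (h : ∀ a, c₁ a = s • c₀ a + k a • θ₀) :
    Cplx.wedge (Fin.cons θ₁ c₁) = (l * s ^ n) • Cplx.wedge (Fin.cons θ₀ c₀) := by
  ext v
  change Matrix.det (Matrix.of fun i m : Fin (n + 1) =>
    (Fin.cons θ₁ c₁ : Fin (n + 1) → _) m (v i)) = (l * s ^ n) * Matrix.det
      (Matrix.of fun i m : Fin (n + 1) => (Fin.cons θ₀ c₀ : Fin (n + 1) → _) m (v i))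
  have h2 : l * s ^ n = ∏ m, (Fin.cons l (fun _ => s) : Fin (n + 1) → ℂ) m := by
    rw [Fin.prod_univ_succ]
    simp
  rw [h2, ← Matrix.det_mul_row]
  by_cases hl : l = 0
  · rw [Matrix.det_eq_zero_of_column_eq_zero 0, Matrix.det_eq_zero_of_column_eq_zero 0]
    · intro i; simp [hl]
    · intro i; simp [h₀, hl]
  · refine (Matrix.det_transpose _).symm.trans (Eq.trans ?_ (Matrix.det_transpose _))
    -- The first row is now `lθ₀`, so the correction `k_a θ₀` is `k_a / l` times it and does not
    -- affect the determinant.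
    refine Matrix.det_eq_of_forall_row_eq_smul_add_const
      (Fin.cons 0 fun a => k a / l) 0 (Fin.cons_zero _ _) fun m i => ?_
    induction m using Fin.cases with
    | zero => simp [h₀]
    | succ a =>
      simp [h]
      field_simp

/-- For `θ' = lθ` a unitary frame is divided by `√l`, so the coframe is multiplied by `√l` modulo
`θ` and `ζ` by `l · l^{n/2} = l^{(n+2)/2}`. Homogeneity of degree `2/(n+2)` then yields exactly `l`.
-/
theorem Density.trivializes_eq_mul (F : S.Density n) (hn : finrank ℝ E = 2 * n + 1)
    (hθ : C.IsContactForm θ) {θ' : OneForm E M} (hθ' : C.IsContactForm θ') {l : M → ℝ}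
    (hl : ∀ x, 0 < l x) (h : ∀ x, θ' x = l x • θ x)
    (hd : ∀ x, MDifferentiableAt 𝓘(ℝ, E) 𝓘(ℝ, ℝ) l x) {f f' : M → ℝ}
    (hf : S.Trivializes n F.toFun θ f) (hf' : S.Trivializes n F.toFun θ' f') (x : M) :
    f' x = l x * f x := by
  obtain ⟨Z, hZ⟩ := S.exists_unitary_frame hθ x hn
  have hc := S.isUnitaryCoframe_dualCovec hθ x (fun a => (Z a).2) hZ
  set s : ℝ := √(l x) with hs
  have hs0 : 0 < s := Real.sqrt_pos.2 (hl x)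
  have hs2 : s * s = l x := Real.mul_self_sqrt (hl x).le
  have hconj : ∀ a, (((s : ℂ)⁻¹ • (Z a : Cplx (TangentSpace 𝓘(ℝ, E) x)))).conj
      = (s : ℂ)⁻¹ • (Z a : Cplx (TangentSpace 𝓘(ℝ, E) x)).conj := fun a => by
    rw [Cplx.conj_smul, map_inv₀, Complex.conj_ofReal]
  -- The term with `dl` reflects that the Reeb direction changes with the contact form; it is the
  -- source of the multiples of `θ` in the new coframe.
  have hdC : ∀ U V : Cplx (TangentSpace 𝓘(ℝ, E) x), V ∈ C.CH x → hθ'.1.dC x U V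
      = l x * hθ.1.dC x U V - Cplx.covec (mvfderiv 𝓘(ℝ, E) l x).toLinearMap V
        * Cplx.covec (θ x).toLinearMap U := by
    intro U V hV
    have h1 := hθ.mem_iff.1 hV.1
    have h2 := hθ.mem_iff.1 hV.2
    simp only [hθ.1.dC_apply, hθ'.1.dC_apply, Cplx.bilin, hθ.1.d_smul h (hd x), h1, h2]
    apply Complex.ext
    · simp [Cplx.covec]; ring
    · simp [Cplx.covec]; ring
  have hu' : ∀ a b, S.clevi θ' x ((s : ℂ)⁻¹ • (Z a : Cplx (TangentSpace 𝓘(ℝ, E) x)))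
      ((s : ℂ)⁻¹ • (Z b : Cplx (TangentSpace 𝓘(ℝ, E) x))).conj = if a = b then 1 else 0 := by
    intro a b
    have hb := ContactStructure.conj_mem_H01 (Z b).2
    have hcov : Cplx.covec (θ x).toLinearMap (Z a : Cplx (TangentSpace 𝓘(ℝ, E) x)) = 0 :=
      Complex.ext (hθ.mem_iff.1 (Z a).2.1) (hθ.mem_iff.1 (Z a).2.2.1)
    rw [hconj, S.clevi_of_mem_H01 hθ'.1 _ (Submodule.smul_mem _ _ hb),
      map_smul, map_smul, LinearMap.smul_apply, hdC _ _ (ContactStructure.H01_le_CH hb), hcov,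
      mul_zero, sub_zero, ← hZ a b, S.clevi_of_mem_H01 hθ.1 _ hb, ← hs2]
    have : (s : ℂ) ≠ 0 := by exact_mod_cast hs0.ne'
    simp only [smul_eq_mul]
    push_cast
    field_simp
  have hc' := S.isUnitaryCoframe_dualCovec hθ' x
    (fun a => Submodule.smul_mem _ (s : ℂ)⁻¹ (Z a).2) hu'
  have hw := wedge_rescale (θ₀ := Cplx.covec (θ x).toLinearMap)
    (θ₁ := Cplx.covec (θ' x).toLinearMap) (l := l x) (s := s)
    (c₀ := fun a => dualCovec hθ x (Z a))
    (c₁ := fun a => dualCovec hθ' x ((s : ℂ)⁻¹ • (Z a : Cplx (TangentSpace 𝓘(ℝ, E) x))))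
    (k := fun a => Complex.I * Cplx.covec (mvfderiv 𝓘(ℝ, E) l x).toLinearMap
      ((s : ℂ)⁻¹ • (Z a : Cplx (TangentSpace 𝓘(ℝ, E) x)).conj))
    (by
      ext V
      apply Complex.ext <;> simp [Cplx.covec, h])
    (fun a => by
      ext V
      have hb := ContactStructure.H01_le_CH (ContactStructure.conj_mem_H01 (Z a).2)
      rw [LinearMap.add_apply, LinearMap.smul_apply, LinearMap.smul_apply, dualCovec_apply,
        dualCovec_apply, hconj, hdC _ _ (Submodule.smul_mem _ _ hb), map_smul (hθ.1.dC x V), ← hs2]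
      have : (s : ℂ) ≠ 0 := by exact_mod_cast hs0.ne'
      simp only [smul_eq_mul]
      push_cast
      field_simp
      ring)
  rw [hf x _ hc ⟨_, S.wedge_mem_canonical hθ hc⟩ rfl,
    hf' x _ hc' ((l x * (s : ℂ) ^ n) • ⟨_, S.wedge_mem_canonical hθ hc⟩) hw.symm,
    F.homog x _ _ _ (fun h0 => S.wedge_ne_zero hθ hc (congrArg Subtype.val h0))]
  · congr 1
    have h1 : ‖(l x * (s : ℂ) ^ n)‖ = s ^ ((n : ℝ) + 2) := by
      rw [norm_mul, norm_pow, Complex.norm_real, Complex.norm_real, Real.norm_of_nonneg hs0.le,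
        Real.norm_of_nonneg (hl x).le, ← hs2, Real.rpow_add hs0, Real.rpow_natCast]
      norm_num
      ring
    rw [h1, ← Real.rpow_mul hs0.le, mul_div_cancel₀ _ (by positivity), ← hs2]
    norm_num
    ring
  · have h1 : (l x : ℂ) ≠ 0 := by exact_mod_cast (hl x).ne'
    have h2 : (s : ℂ) ≠ 0 := by exact_mod_cast hs0.ne'
    exact mul_ne_zero h1 (pow_ne_zero _ h2)

variable {S}

theorem IsContactHamiltonian.isContactField {F : S.Density n} {X : VField E M}
    (hX : S.IsContactHamiltonian F X) : C.IsContactField X := by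
  obtain ⟨hXs, θ, f, hθ, hf, h⟩ := hX
  have hfX : (fun y => θ y (X y)) = f := funext fun y => (h y).1
  refine hθ.isContactField hXs fun x v hv => ?_
  rw [hfX, (h x).2 v hv]

/-- The Hamiltonian condition is given for one contact form; under rescaling both `θ(X)` and `f` are
multiplied by `l`. -/
theorem IsContactHamiltonian.apply_eq {F : S.Density n} {X : VField E M}
    (hX : S.IsContactHamiltonian F X) (hn : finrank ℝ E = 2 * n + 1) (hθ : C.IsContactForm θ)
    {f : M → ℝ} (hf : S.Trivializes n F.toFun θ f) (x : M) : θ x (X x) = f x := by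
  obtain ⟨hXs, θ₀, f₀, hθ₀, hf₀, h⟩ := hX
  obtain ⟨l, hl, hl', hd⟩ := hθ₀.exists_smul hθ
  rw [F.trivializes_eq_mul S hn hθ₀ hθ hl hl' hd hf₀ hf, hl', ← (h x).1]
  rfl

end AlmostCR

end Densities

/-! ### Brackets, torsion and `dθ` for complex vector fields. -/

section ComplexCalculus

variable {E : Type*} [NormedAddCommGroup E] [NormedSpace ℝ E]
  {M : Type*} [TopologicalSpace M] [ChartedSpace E M]

theorem mvfderiv_complex {u w : M → ℝ} {x : M} (hu : MDifferentiableAt 𝓘(ℝ, E) 𝓘(ℝ, ℝ) u x)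
    (hw : MDifferentiableAt 𝓘(ℝ, E) 𝓘(ℝ, ℝ) w x) (v : TangentSpace 𝓘(ℝ, E) x) :
    mvfderiv 𝓘(ℝ, E) (fun y => (⟨u y, w y⟩ : ℂ)) x v
      = ⟨mvfderiv 𝓘(ℝ, E) u x v, mvfderiv 𝓘(ℝ, E) w x v⟩ := by
  have h1 : (fun y => (⟨u y, w y⟩ : ℂ))
      = u • (fun _ => (1 : ℂ)) + w • (fun _ => Complex.I) := by
    ext y
    apply Complex.ext <;> simp
  rw [h1, mvfderiv_add (hu.smul mdifferentiableAt_const) (hw.smul mdifferentiableAt_const),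
    mvfderiv_smul hu mdifferentiableAt_const, mvfderiv_smul hw mdifferentiableAt_const,
    mvfderiv_const, mvfderiv_const]
  apply Complex.ext <;> simp

theorem cderiv_mk {u w : M → ℝ} {x : M} (hu : MDifferentiableAt 𝓘(ℝ, E) 𝓘(ℝ, ℝ) u x)
    (hw : MDifferentiableAt 𝓘(ℝ, E) 𝓘(ℝ, ℝ) w x) (Z : Cplx (TangentSpace 𝓘(ℝ, E) x)) :
    cderiv (fun y => (⟨u y, w y⟩ : ℂ)) Z
      = ⟨mvfderiv 𝓘(ℝ, E) u x Z.re - mvfderiv 𝓘(ℝ, E) w x Z.im,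
        mvfderiv 𝓘(ℝ, E) w x Z.re + mvfderiv 𝓘(ℝ, E) u x Z.im⟩ := by
  unfold cderiv
  rw [mvfderiv_complex hu hw, mvfderiv_complex hu hw]
  apply Complex.ext
  · simp [sub_eq_add_neg]
  · simp

theorem cderiv_ofReal {f : M → ℝ} {x : M} (hf : MDifferentiableAt 𝓘(ℝ, E) 𝓘(ℝ, ℝ) f x)
    (Z : Cplx (TangentSpace 𝓘(ℝ, E) x)) :
    cderiv (fun y => (f y : ℂ)) Z = Cplx.covec (mvfderiv 𝓘(ℝ, E) f x).toLinearMap Z := by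
  refine (cderiv_mk hf (w := fun _ => (0 : ℝ)) mdifferentiableAt_const Z).trans ?_
  rw [mvfderiv_const]
  apply Complex.ext <;> simp [Cplx.covec]

variable [IsManifold 𝓘(ℝ, E) ∞ M]

theorem cbracket_ofReal (X : VField E M) (Z : CVField E M) (x : M) :
    cbracket (fun y => Cplx.ofReal (X y)) Z x
      = ⟨mlieBracket 𝓘(ℝ, E) X (fun y => (Z y).re) x,
        mlieBracket 𝓘(ℝ, E) X (fun y => (Z y).im) x⟩ := by
  have h : ∀ W : VField E M,
      mlieBracket 𝓘(ℝ, E) (fun y => (Cplx.ofReal (X y)).im) W x = 0 := fun W =>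
    congrFun (mlieBracket_zero_left (I := 𝓘(ℝ, E)) (W := W)) x
  unfold cbracket
  rw [h, h, sub_zero, add_zero]
  rfl

theorem CVField.Smooth.ofReal {X : VField E M} (hX : X.Smooth) :
    CVField.Smooth (fun y => Cplx.ofReal (X y)) := by
  refine ⟨hX, ?_⟩
  have := VField.Smooth.const_smul 0 hX
  simpa using this

variable [FiniteDimensional ℝ E]

theorem bilinV_torsion (nab : CovariantDerivative 𝓘(ℝ, E) E (TangentSpace 𝓘(ℝ, E) : M → Type _))
    {Z W : CVField E M} (hZ : CVField.Smooth Z) (hW : CVField.Smooth W) (x : M) :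
    Cplx.bilinV (fun v w => nab.torsion x v w) (Z x) (W x)
      = ccov nab Z W x - ccov nab W Z x - cbracket Z W x := by
  have h := fun {V V' : VField E M} (hV : VField.Smooth V) (hV' : VField.Smooth V') =>
    nab.torsion_apply (hV.diffAt x) (hV'.diffAt x)
  unfold Cplx.bilinV ccov cbracket
  beta_reduce
  rw [h hZ.1 hW.1, h hZ.2 hW.2, h hZ.1 hW.2, h hZ.2 hW.1]
  ext
  · simp; abel
  · simp; abel

theorem bilinV_torsion_swap
    (nab : CovariantDerivative 𝓘(ℝ, E) E (TangentSpace 𝓘(ℝ, E) : M → Type _)) {x : M}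
    (Z W : Cplx (TangentSpace 𝓘(ℝ, E) x)) :
    Cplx.bilinV (fun v w => nab.torsion x v w) Z W
      = -Cplx.bilinV (fun v w => nab.torsion x v w) W Z := by
  unfold Cplx.bilinV
  ext
  · simp only [Cplx.neg_re]
    rw [nab.torsion_antisymm Z.re, nab.torsion_antisymm Z.im]
    abel
  · simp only [Cplx.neg_im]
    rw [nab.torsion_antisymm Z.re, nab.torsion_antisymm Z.im]
    abel

theorem bilinV_torsion_add_left
    (nab : CovariantDerivative 𝓘(ℝ, E) E (TangentSpace 𝓘(ℝ, E) : M → Type _)) {x : M}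
    (Z Z' W : Cplx (TangentSpace 𝓘(ℝ, E) x)) :
    Cplx.bilinV (fun v w => nab.torsion x v w) (Z + Z') W
      = Cplx.bilinV (fun v w => nab.torsion x v w) Z W
        + Cplx.bilinV (fun v w => nab.torsion x v w) Z' W := by
  unfold Cplx.bilinV
  ext
  · simp; abel
  · simp; abel

theorem bilinV_torsion_smul_left
    (nab : CovariantDerivative 𝓘(ℝ, E) E (TangentSpace 𝓘(ℝ, E) : M → Type _)) {x : M}
    (c : ℂ) (Z W : Cplx (TangentSpace 𝓘(ℝ, E) x)) :
    Cplx.bilinV (fun v w => nab.torsion x v w) (c • Z) W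
      = c • Cplx.bilinV (fun v w => nab.torsion x v w) Z W := by
  unfold Cplx.bilinV
  ext
  · simp; module
  · simp; module

variable {C : ContactStructure E M} {θ : OneForm E M}

theorem ContactStructure.IsContactForm.covec_cbracket (hθ : C.IsContactForm θ)
    {Z W : CVField E M} (hZ : CVField.Smooth Z) (hZH : ∀ x, Z x ∈ C.CH x)
    (hW : CVField.Smooth W) (hWH : ∀ x, W x ∈ C.CH x) (x : M) :
    Cplx.covec (θ x).toLinearMap (cbracket Z W x) = -hθ.1.dC x (Z x) (W x) := by
  have h := fun {V V' : VField E M} (hV : VField.Smooth V) (hVH : ∀ x, V x ∈ C.H x)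
    (hV' : VField.Smooth V') (hVH' : ∀ x, V' x ∈ C.H x) =>
    hθ.d_eq_neg_apply_mlieBracket hV hVH hV' hVH' x
  rw [hθ.1.dC_apply, Cplx.bilin,
    h hZ.1 (fun y => (hZH y).1) hW.1 (fun y => (hWH y).1),
    h hZ.2 (fun y => (hZH y).2) hW.2 (fun y => (hWH y).2),
    h hZ.1 (fun y => (hZH y).1) hW.2 (fun y => (hWH y).2),
    h hZ.2 (fun y => (hZH y).2) hW.1 (fun y => (hWH y).1)]
  apply Complex.ext
  · simp [Cplx.covec, cbracket]; ring
  · simp [Cplx.covec, cbracket]; ring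

/-- By `θ([Z, W]) = -dθ(Z, W)`, the bracket of an isotropic pair stays in the complexified `H`,
where it splits into types. -/
theorem ContactStructure.IsContactForm.cbracket_mem_CH (hθ : C.IsContactForm θ)
    {Z W : CVField E M} (hZ : CVField.Smooth Z) (hZH : ∀ x, Z x ∈ C.CH x)
    (hW : CVField.Smooth W) (hWH : ∀ x, W x ∈ C.CH x) {x : M}
    (h : hθ.1.dC x (Z x) (W x) = 0) : cbracket Z W x ∈ C.CH x := by
  have h1 := hθ.covec_cbracket hZ hZH hW hWH x
  rw [h, neg_zero] at h1
  exact ⟨hθ.mem_iff.2 (congrArg Complex.re h1), hθ.mem_iff.2 (congrArg Complex.im h1)⟩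

/-- The flow of a contact field preserves isotropy up to first order. -/
theorem ContactStructure.IsContactField.dC_cbracket {X : VField E M}
    (hX : C.IsContactField X) (hXs : X.Smooth) (hθ : C.IsContactForm θ)
    {Z W : CVField E M} (hZ : CVField.Smooth Z) (hZH : ∀ x, Z x ∈ C.CH x)
    (hW : CVField.Smooth W) (hWH : ∀ x, W x ∈ C.CH x)
    (h : ∀ x, hθ.1.dC x (Z x) (W x) = 0) (x : M) :
    hθ.1.dC x (cbracket (fun y => Cplx.ofReal (X y)) Z x) (W x)
      + hθ.1.dC x (Z x) (cbracket (fun y => Cplx.ofReal (X y)) W x) = 0 := by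
  have : CompleteSpace E := FiniteDimensional.complete ℝ E
  have hre : ∀ y, θ.d y (Z y).re (W y).re = θ.d y (Z y).im (W y).im := fun y =>
    sub_eq_zero.1 (congrArg Complex.re (h y))
  -- The imaginary part of the isotropy condition is a sum; moving the sign into a field makes it an
  -- equality of two values of `dθ`, as `d_mlieBracket_congr` requires.
  have him : ∀ y, θ.d y (Z y).re (W y).im = θ.d y (-(Z y).im) (W y).re := fun y => by
    rw [hθ.1.d_neg_left]
    exact eq_neg_of_add_eq_zero_left (congrArg Complex.im (h y))
  have h1 := hX.d_mlieBracket_congr hXs hθ hZ.1 (fun y => (hZH y).1) hW.1 (fun y => (hWH y).1)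
    hZ.2 (fun y => (hZH y).2) hW.2 (fun y => (hWH y).2) hre x
  have h2 := hX.d_mlieBracket_congr hXs hθ hZ.1 (fun y => (hZH y).1) hW.2 (fun y => (hWH y).2)
    (VField.Smooth.neg hZ.2) (fun y => Submodule.neg_mem _ (hZH y).2) hW.1 (fun y => (hWH y).1)
    him x
  have h3 : mlieBracket 𝓘(ℝ, E) X (fun y => -(Z y).im) x
      = -mlieBracket 𝓘(ℝ, E) X (fun y => (Z y).im) x := by
    have := mlieBracket_const_smul_right (I := 𝓘(ℝ, E)) (V := X) (c := (-1 : ℝ))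
      (hZ.2.diffAt x)
    rw [neg_one_smul, neg_one_smul] at this
    exact this
  rw [h3, hθ.1.d_neg_left, hθ.1.d_neg_left] at h2
  rw [cbracket_ofReal, cbracket_ofReal, hθ.1.dC_apply, hθ.1.dC_apply]
  apply Complex.ext
  · simp only [Cplx.bilin, Complex.add_re, Complex.zero_re]
    linarith
  · simp only [Cplx.bilin, Complex.add_im, Complex.zero_im]
    linarith

/-- On sections of `H`, the function `dθ(V, W)` is `-θ([V, W])`, whose regularity is known. -/
theorem ContactStructure.IsContactForm.mdifferentiableAt_d (hθ : C.IsContactForm θ)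
    {V W : VField E M} (hV : V.Smooth) (hVH : ∀ x, V x ∈ C.H x) (hW : W.Smooth)
    (hWH : ∀ x, W x ∈ C.H x) (x : M) :
    MDifferentiableAt 𝓘(ℝ, E) 𝓘(ℝ, ℝ) (fun y => θ.d y (V y) (W y)) x := by
  have : CompleteSpace E := FiniteDimensional.complete ℝ E
  have h : (fun y => θ.d y (V y) (W y)) = -fun y => θ y (mlieBracket 𝓘(ℝ, E) V W y) := by
    ext y
    exact hθ.d_eq_neg_apply_mlieBracket hV hVH hW hWH y
  rw [h]
  exact (hθ.1.mdifferentiableAt_apply ((hV.mlieBracket hW).diffAt x)).neg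

end ComplexCalculus

/-! ### The Tanaka–Webster connection and the formula for `dθ(W, [X, Z])`. -/

section TanakaWebster

variable {E : Type*} [NormedAddCommGroup E] [NormedSpace ℝ E] [FiniteDimensional ℝ E]
  {M : Type*} [TopologicalSpace M] [ChartedSpace E M] [IsManifold 𝓘(ℝ, E) ∞ M]
  {C : ContactStructure E M} {S : AlmostCR C} {θ : OneForm E M} {T : VField E M}
  {nab : CovariantDerivative 𝓘(ℝ, E) E (TangentSpace 𝓘(ℝ, E) : M → Type _)}

theorem cov_neg (nab : CovariantDerivative 𝓘(ℝ, E) E (TangentSpace 𝓘(ℝ, E) : M → Type _))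
    {Y : VField E M} {x : M} (hY : Y.DiffAt x) (v : TangentSpace 𝓘(ℝ, E) x) :
    nab (fun y => -Y y) x v = -nab Y x v := by
  have h := nab.isCovariantDerivativeOnUniv.smul_const (-1 : ℝ) hY
  rw [neg_one_smul, neg_one_smul] at h
  exact congrArg (fun A => A v) h

theorem cov_add_smul (nab : CovariantDerivative 𝓘(ℝ, E) E (TangentSpace 𝓘(ℝ, E) : M → Type _))
    {Y T : VField E M} {f : M → ℝ} {x : M} (hY : Y.DiffAt x) (hT : T.DiffAt x)
    (hf : MDifferentiableAt 𝓘(ℝ, E) 𝓘(ℝ, ℝ) f x) (v : TangentSpace 𝓘(ℝ, E) x) :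
    nab (fun y => Y y + f y • T y) x v
      = nab Y x v + (f x • nab T x v + mvfderiv 𝓘(ℝ, E) f x v • T x) := by
  have h1 := nab.isCovariantDerivativeOnUniv.add hY (VField.DiffAt.smul hf hT)
  have h2 := nab.isCovariantDerivativeOnUniv.leibniz hT hf
  have h3 : nab (fun y => Y y + f y • T y) x v = _ := congrArg (fun A => A v) h1
  have h4 : nab (fun y => f y • T y) x v = _ := congrArg (fun A => A v) h2
  rw [h3, _root_.add_apply, h4]
  rfl

namespace AlmostCR

theorem IsSection10.mem_CH {Z : CVField E M} (hZ : S.IsSection10 Z) (x : M) : Z x ∈ C.CH x :=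
  ContactStructure.H10_le_CH (hZ.2 x)

namespace IsTanakaWebster

variable (h : S.IsTanakaWebster θ T nab)
include h

theorem ccov_mem_CH {W : CVField E M} (hW : CVField.Smooth W) (hWH : ∀ x, W x ∈ C.CH x)
    (Z : CVField E M) (x : M) : ccov nab Z W x ∈ C.CH x := by
  have h1 := h.preserves _ hW.1 (fun y => (hWH y).1) x
  have h2 := h.preserves _ hW.2 (fun y => (hWH y).2) x
  exact ⟨Submodule.sub_mem _ (h1 _) (h2 _), Submodule.add_mem _ (h2 _) (h1 _)⟩

/-- `J` is parallel, so covariant differentiation preserves its eigenbundles. -/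
theorem ccov_mem_H10 {W : CVField E M} (hW : S.IsSection10 W) (Z : CVField E M) (x : M) :
    ccov nab Z W x ∈ C.H10 x (S.J x) := by
  have h1 : ∀ v, S.J x (nab (fun y => (W y).re) x v) = -nab (fun y => (W y).im) x v := fun v => by
    rw [← h.complex _ hW.1.1 (fun y => (hW.mem_CH y).1), ← cov_neg nab (hW.1.2.diffAt x)]
    simp_rw [(ContactStructure.mem_H10_iff.1 (hW.2 _)).2.1]
  have h2 : ∀ v, S.J x (nab (fun y => (W y).im) x v) = nab (fun y => (W y).re) x v := fun v => by
    rw [← h.complex _ hW.1.2 (fun y => (hW.mem_CH y).2)]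
    simp_rw [(ContactStructure.mem_H10_iff.1 (hW.2 _)).2.2]
  refine ContactStructure.mem_H10_iff.2 ⟨h.ccov_mem_CH hW.1 hW.mem_CH Z x, ?_, ?_⟩
  · simp only [ccov, map_sub, h1, h2]
    abel
  · simp only [ccov, map_add, h1, h2]
    abel

/-- `dθ` is parallel on `H`. -/
theorem mvfderiv_d (hθ : C.IsContactForm θ) {Y V : VField E M} (hY : Y.Smooth)
    (hYH : ∀ x, Y x ∈ C.H x) (hV : V.Smooth) (hVH : ∀ x, V x ∈ C.H x) (x : M)
    (v : TangentSpace 𝓘(ℝ, E) x) :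
    mvfderiv 𝓘(ℝ, E) (fun y => θ.d y (Y y) (V y)) x v
      = θ.d x (nab Y x v) (V x) + θ.d x (Y x) (nab V x v) := by
  have hJ := S.smooth V hV hVH
  have hJH : ∀ y, -S.J y (V y) ∈ C.H y := fun y =>
    Submodule.neg_mem _ ((S.compatible y).maps _ (hVH y))
  have h1 := h.metric Y (fun y => -S.J y (V y)) hY hYH hJ.neg hJH x v
  -- The metric condition is applied to `Y` and `-JV`, because `dθ(Y, V) = h(Y, -JV)`.
  have h2 : ∀ y, ∀ w ∈ C.H y, S.J y (-S.J y w) = w := fun y w hw => by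
    rw [map_neg, (S.compatible y).sq w hw, neg_neg]
  rw [cov_neg nab (hJ.diffAt x), h.complex V hV hVH] at h1
  simp only [levi] at h1
  rw [h2 x _ (hVH x), h2 x _ (h.preserves V hV hVH x v)] at h1
  simp_rw [h2 _ _ (hVH _)] at h1
  exact h1

theorem cderiv_dC (hθ : C.IsContactForm θ) {Y W : CVField E M} (hY : CVField.Smooth Y)
    (hYH : ∀ x, Y x ∈ C.CH x) (hW : CVField.Smooth W) (hWH : ∀ x, W x ∈ C.CH x)
    (Z : CVField E M) (x : M) :
    cderiv (fun y => hθ.1.dC y (W y) (Y y)) (Z x)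
      = hθ.1.dC x (ccov nab Z W x) (Y x) + hθ.1.dC x (W x) (ccov nab Z Y x) := by
  have hd := fun {V V' : VField E M} (hV : V.Smooth) (hVH : ∀ x, V x ∈ C.H x) (hV' : V'.Smooth)
    (hVH' : ∀ x, V' x ∈ C.H x) => hθ.mdifferentiableAt_d hV hVH hV' hVH' x
  have hp := fun {V V' : VField E M} (hV : V.Smooth) (hVH : ∀ x, V x ∈ C.H x) (hV' : V'.Smooth)
    (hVH' : ∀ x, V' x ∈ C.H x) v => h.mvfderiv_d hθ hV hVH hV' hVH' x v
  have d1 := hd hW.1 (fun y => (hWH y).1) hY.1 (fun y => (hYH y).1)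
  have d2 := hd hW.2 (fun y => (hWH y).2) hY.2 (fun y => (hYH y).2)
  have d3 := hd hW.1 (fun y => (hWH y).1) hY.2 (fun y => (hYH y).2)
  have d4 := hd hW.2 (fun y => (hWH y).2) hY.1 (fun y => (hYH y).1)
  have p1 := hp hW.1 (fun y => (hWH y).1) hY.1 (fun y => (hYH y).1)
  have p2 := hp hW.2 (fun y => (hWH y).2) hY.2 (fun y => (hYH y).2)
  have p3 := hp hW.1 (fun y => (hWH y).1) hY.2 (fun y => (hYH y).2)
  have p4 := hp hW.2 (fun y => (hWH y).2) hY.1 (fun y => (hYH y).1)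
  refine (cderiv_mk (d1.sub d2) (d3.add d4) (Z x)).trans ?_
  rw [mvfderiv_sub d1 d2, mvfderiv_add d3 d4]
  simp only [_root_.sub_apply, _root_.add_apply, p1, p2, p3, p4]
  rw [hθ.1.dC_apply, hθ.1.dC_apply]
  simp only [ccov, Cplx.bilin, hθ.1.d_add_left, hθ.1.d_add_right, hθ.1.d_sub_left,
    hθ.1.d_sub_right]
  apply Complex.ext
  · simp only [Complex.add_re]; ring
  · simp only [Complex.add_im]; ring

end IsTanakaWebster

theorem dC_ofReal_reeb (hθ : C.IsContactForm θ) (hT : ContactStructure.IsReeb θ T) {x : M}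
    (W : Cplx (TangentSpace 𝓘(ℝ, E) x)) : hθ.1.dC x W (Cplx.ofReal (T x)) = 0 := by
  rw [hθ.1.dC_swap, hθ.1.dC_apply, neg_eq_zero]
  apply Complex.ext <;> simp [Cplx.bilin, hT.contract, hθ.1.d_zero_left]

/-- The Reeb field is the contact Hamiltonian field of the constant function `1`. This is what makes
the torsion `A` symmetric. -/
theorem isContactField_reeb (hθ : C.IsContactForm θ) (hT : ContactStructure.IsReeb θ T) :
    C.IsContactField T := by
  refine hθ.isContactField hT.smooth fun x v hv => ?_
  have h1 : (fun y => θ y (T y)) = fun _ => 1 := funext hT.apply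
  rw [hT.contract, h1, mvfderiv_const]
  simp

/-- A section of `H^{1,0}` built from a section of `H`. -/
theorem isSection10_mk {V : VField E M} (hV : V.Smooth) (hVH : ∀ x, V x ∈ C.H x) :
    S.IsSection10 fun x => ⟨V x, -S.J x (V x)⟩ :=
  ⟨⟨hV, (S.smooth V hV hVH).neg⟩, fun x => (S.compatible x).mk_mem_H10 (hVH x)⟩

/-- If `dθ(u, ·) = -df` on `H`, then `-i u^{1,0}` represents `df` on `H^{0,1}`, since `h(-i u^{1,0},
V) = -dθ(u, V)`. -/
theorem grad10_eq (hθ : C.IsContactForm θ) {f : M → ℝ} {x : M}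
    (hf : MDifferentiableAt 𝓘(ℝ, E) 𝓘(ℝ, ℝ) f x) {u : TangentSpace 𝓘(ℝ, E) x} (hu : u ∈ C.H x)
    (h : ∀ v ∈ C.H x, θ.d x u v = -mvfderiv 𝓘(ℝ, E) f x v) :
    S.grad10 θ f x
      = (-(Complex.I / 2)) • (⟨u, -S.J x u⟩ : Cplx (TangentSpace 𝓘(ℝ, E) x)) := by
  set G : Cplx (TangentSpace 𝓘(ℝ, E) x) :=
    (-(Complex.I / 2)) • (⟨u, -S.J x u⟩ : Cplx (TangentSpace 𝓘(ℝ, E) x)) with hG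
  have hmem := (S.compatible x).mk_mem_H10 hu
  have hGm : G ∈ C.H10 x (S.J x) := Submodule.smul_mem _ _ hmem
  have hprop : ∀ V ∈ C.H01 x (S.J x), S.clevi θ x G V = cderiv (fun z => (f z : ℂ)) V := by
    intro V hV
    have h1 : hθ.1.dC x (Cplx.ofReal u) V = -cderiv (fun z => (f z : ℂ)) V := by
      rw [cderiv_ofReal hf, hθ.1.dC_apply]
      apply Complex.ext
      · simp [Cplx.bilin, Cplx.covec, hθ.1.d_zero_left, h _ hV.1]
      · simp [Cplx.bilin, Cplx.covec, hθ.1.d_zero_left, h _ hV.2.1]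
    have h2 : (2 : ℂ) • Cplx.ofReal u = (⟨u, -S.J x u⟩ : Cplx (TangentSpace 𝓘(ℝ, E) x))
        + (⟨u, -S.J x u⟩ : Cplx (TangentSpace 𝓘(ℝ, E) x)).conj := by
      ext
      · simp [two_smul]
      · simp
    have h3 : hθ.1.dC x (⟨u, -S.J x u⟩ : Cplx (TangentSpace 𝓘(ℝ, E) x)).conj V = 0 := by
      have h4 := (S.compatible x).dC_H10_H10 hθ hmem (ContactStructure.conj_mem_H10 hV)
      have h5 := hθ.1.dC_conj x (⟨u, -S.J x u⟩ : Cplx (TangentSpace 𝓘(ℝ, E) x)) V.conj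
      rwa [h4, map_zero, Cplx.conj_conj] at h5
    have h6 := congrArg (fun U => hθ.1.dC x U V) h2
    simp only [map_smul, map_add, LinearMap.add_apply, LinearMap.smul_apply, h1, h3, add_zero,
      smul_eq_mul] at h6
    rw [S.clevi_of_mem_H01 hθ.1 _ hV, hG, map_smul, LinearMap.smul_apply, ← h6, smul_eq_mul]
    linear_combination (-cderiv (fun z => (f z : ℂ)) V) * Complex.I_mul_I
  have hex : ∃ G, G ∈ C.H10 x (S.J x) ∧
      ∀ V ∈ C.H01 x (S.J x), S.clevi θ x G V = cderiv (fun z => (f z : ℂ)) V := ⟨G, hGm, hprop⟩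
  obtain ⟨h1, h2⟩ := Classical.epsilon_spec hex
  -- `grad10` is defined by choice, so uniqueness is needed: the difference of two candidates is
  -- Levi-orthogonal to itself.
  refine sub_eq_zero.1 ((S.leviCore hθ x).definite ⟨_, Submodule.sub_mem _ h1 hGm⟩ ?_ |>
    congrArg Subtype.val)
  have hc := ContactStructure.conj_mem_H01 (Submodule.sub_mem _ h1 hGm)
  have h3 := (h2 _ hc).trans (hprop _ hc).symm
  rw [S.clevi_of_mem_H01 hθ.1 _ hc, S.clevi_of_mem_H01 hθ.1 _ hc] at h3
  change S.clevi θ x _ _ = 0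
  rw [S.clevi_of_mem_H01 hθ.1 _ hc, map_sub, LinearMap.sub_apply]
  linear_combination h3

namespace IsTanakaWebster

variable (h : S.IsTanakaWebster θ T nab)
include h

/-- In `τ(T, Z) = ∇_T Z - ∇_Z T - [T, Z]` the first term is in `H^{1,0}`, invisible to `dθ(W, ·)`,
and the second is zero. -/
theorem torsionA_eq (hθ : C.IsContactForm θ) (hT : ContactStructure.IsReeb θ T)
    {Z W : CVField E M} (hZ : S.IsSection10 Z) (hW : S.IsSection10 W) (x : M) :
    S.torsionA θ T nab Z W x
      = Complex.I * hθ.1.dC x (W x) (cbracket (fun y => Cplx.ofReal (T y)) Z x) := by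
  have h1 : ccov nab Z (fun y => Cplx.ofReal (T y)) x = 0 := by
    have h2 : (fun y => (Cplx.ofReal (T y)).im) = (0 : VField E M) := rfl
    have h3 : nab (fun y => (Cplx.ofReal (T y)).im) x = 0 := by
      rw [h2]; exact congrFun nab.zero x
    have h4 : ∀ v, nab (fun y => (Cplx.ofReal (T y)).re) x v = 0 := h.reeb x
    ext
    · simp only [ccov, h3, h4]; simp
    · simp only [ccov, h3, h4]; simp
  unfold torsionA
  rw [S.clevi_of_mem_H01 hθ.1 _ (h.torsion_reeb x _ (hZ.2 x)),
    bilinV_torsion nab (CVField.Smooth.ofReal hT.smooth) hZ.1, h1, map_sub, map_sub,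
    (S.compatible x).dC_H10_H10 hθ (hW.2 x) (h.ccov_mem_H10 hZ _ x), map_zero]
  ring

/-- Isotropy of `H^{1,0}` differentiated along the contact field `T`. It is needed because the
Killing operator contains `A` without symmetrization. -/
theorem torsionA_comm (hθ : C.IsContactForm θ) (hT : ContactStructure.IsReeb θ T)
    {Z W : CVField E M} (hZ : S.IsSection10 Z) (hW : S.IsSection10 W) (x : M) :
    S.torsionA θ T nab Z W x = S.torsionA θ T nab W Z x := by
  have h1 := (isContactField_reeb hθ hT).dC_cbracket hT.smooth hθ hZ.1 hZ.mem_CH hW.1 hW.mem_CH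
    (fun y => (S.compatible y).dC_H10_H10 hθ (hZ.2 y) (hW.2 y)) x
  rw [h.torsionA_eq hθ hT hZ hW, h.torsionA_eq hθ hT hW hZ, hθ.1.dC_swap]
  linear_combination (-Complex.I) * h1

/-- The `(1,0)`-part of the bracket pairs to zero with `V`, so the projection can be dropped. -/
theorem nijenhuis_eq (hθ : C.IsContactForm θ) {Z G : CVField E M} (hZ : S.IsSection10 Z)
    (hG : S.IsSection10 G) {x : M} {V : Cplx (TangentSpace 𝓘(ℝ, E) x)}
    (hV : V ∈ C.H10 x (S.J x)) :
    S.nijenhuis θ x V Z G = Complex.I * hθ.1.dC x V (cbracket Z G x) := by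
  have hb := hθ.cbracket_mem_CH hZ.1 hZ.mem_CH hG.1 hG.mem_CH
    ((S.compatible x).dC_H10_H10 hθ (hZ.2 x) (hG.2 x))
  have h1 := (S.compatible x).proj01_mem hb
  have h2 : hθ.1.dC x V (cbracket Z G x)
      = hθ.1.dC x V (ContactStructure.proj01 (S.J x) (cbracket Z G x)) := by
    conv_lhs => rw [← ContactStructure.proj10_add_proj01 (S.J x) (cbracket Z G x)]
    rw [map_add, (S.compatible x).dC_H10_H10 hθ hV ((S.compatible x).proj10_mem hb), zero_add]
  unfold nijenhuis
  rw [S.proj01_eq, S.clevi_of_mem_H01 hθ.1 _ (Submodule.neg_mem _ h1), h2, map_neg]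
  ring

/-- The infinitesimal deformation of an almost CR structure along a contact field, in terms of
the Tanaka–Webster connection. -/
theorem dC_cbracket_eq (hθ : C.IsContactForm θ) (hT : ContactStructure.IsReeb θ T) {X : VField E M}
    (hX : C.IsContactField X) (hXs : X.Smooth) {f : M → ℝ} (hf : ∀ x, θ x (X x) = f x)
    {Z W : CVField E M} (hZ : S.IsSection10 Z) (hW : S.IsSection10 W) (x : M) :
    -(Complex.I * hθ.1.dC x (W x) (cbracket (fun y => Cplx.ofReal (X y)) Z x))
      = Complex.I * hessian nab f Z W x - S.torsionA θ T nab Z W x * f x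
        + Complex.I * S.nijenhuis θ x (W x) Z (S.grad10 θ f) := by
  have hfX : (fun y => θ y (X y)) = f := funext hf
  have hfs : ContMDiff 𝓘(ℝ, E) 𝓘(ℝ, ℝ) ∞ f := fun y => by
    rw [← hfX]; exact hθ.1.contMDiffAt_apply (hXs y)
  have hfd : ∀ y, MDifferentiableAt 𝓘(ℝ, E) 𝓘(ℝ, ℝ) f y := fun y =>
    (hfs y).mdifferentiableAt (by simp)
  -- The horizontal part of `X`; contracting `dθ` with it gives `-df` on `H`.
  let Y : VField E M := fun y => X y - f y • T y
  have hYs : Y.Smooth := hXs.sub (hT.smooth.smul hfs)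
  have hYH : ∀ y, Y y ∈ C.H y := fun y => by
    rw [hθ.mem_iff]
    simp [Y, hT.apply, hf]
  have hXY : X = fun y => Y y + f y • T y := by ext y; simp [Y]
  have hYd : ∀ y, ∀ v ∈ C.H y, θ.d y (Y y) v = -mvfderiv 𝓘(ℝ, E) f y v := fun y v hv => by
    have := hX θ hθ y v hv
    rw [hfX] at this
    simp only [Y]
    rw [hθ.1.d_sub_left, hθ.1.d_smul_left, hT.contract, this]
    ring
  -- This is `-i Y^{1,0}`, the gradient as an explicit smooth section of `H^{1,0}`; `nijenhuis`
  -- brackets with it, so its pointwise values would not suffice.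
  let G : CVField E M := fun y =>
    ⟨(-(1 / 2) : ℝ) • S.J y (Y y), -S.J y ((-(1 / 2) : ℝ) • S.J y (Y y))⟩
  have hG : S.IsSection10 G :=
    isSection10_mk (VField.Smooth.const_smul _ (S.smooth Y hYs hYH)) fun y =>
      Submodule.smul_mem _ _ ((S.compatible y).maps _ (hYH y))
  have hGim : ∀ y, (G y).im = (-(1 / 2) : ℝ) • Y y := fun y => by
    simp only [G]
    rw [map_smul, (S.compatible y).sq _ (hYH y)]
    module
  have hgrad : S.grad10 θ f = G := by
    ext y
    · rw [grad10_eq hθ (hfd y) (hYH y) (hYd y)]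
      simp [G]
    · rw [grad10_eq hθ (hfd y) (hYH y) (hYd y), hGim]
      simp
  have hYG : Cplx.ofReal (Y x) = Complex.I • G x + (-Complex.I) • (G x).conj := by
    ext
    · simp [hGim]; module
    · simp
  have hsY : CVField.Smooth (fun y => Cplx.ofReal (Y y)) := CVField.Smooth.ofReal hYs
  have hYCH : ∀ y, Cplx.ofReal (Y y) ∈ C.CH y := fun y => ⟨hYH y, Submodule.zero_mem _⟩
  have hdf : ∀ y, ∀ V ∈ C.CH y, cderiv (fun z => (f z : ℂ)) V
      = hθ.1.dC y V (Cplx.ofReal (Y y)) := fun y V hV => by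
    rw [cderiv_ofReal (hfd y), hθ.1.dC_swap, hθ.1.dC_apply]
    apply Complex.ext
    · simp [Cplx.bilin, Cplx.covec, hθ.1.d_zero_left, hYd _ _ hV.1]
    · simp [Cplx.bilin, Cplx.covec, hθ.1.d_zero_left, hYd _ _ hV.2]
  -- Since `Wf = dθ(W, Y)` and `dθ` is parallel on `H`, subtracting `(∇_Z W)f` leaves the derivative
  -- of `Y` only.
  have hhess : hessian nab f Z W x
      = hθ.1.dC x (W x) (ccov nab Z (fun y => Cplx.ofReal (Y y)) x) := by
    unfold hessian
    have h1 : (fun y => cderiv (fun z => (f z : ℂ)) (W y))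
        = fun y => hθ.1.dC y (W y) (Cplx.ofReal (Y y)) :=
      funext fun y => hdf y _ (hW.mem_CH y)
    rw [h1, h.cderiv_dC hθ hsY hYCH hW.1 hW.mem_CH Z x,
      hdf x _ (h.ccov_mem_CH hW.1 hW.mem_CH Z x)]
    ring
  have hcX : ccov nab Z (fun y => Cplx.ofReal (X y)) x
      = ccov nab Z (fun y => Cplx.ofReal (Y y)) x
        + Cplx.covec (mvfderiv 𝓘(ℝ, E) f x).toLinearMap (Z x) • Cplx.ofReal (T x) := by
    have h3 : ∀ V : VField E M, nab (fun y => (Cplx.ofReal (V y)).im) x = 0 := fun V =>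
      congrFun nab.zero x
    have h4 : ∀ v, nab (fun y => (Cplx.ofReal (X y)).re) x v
        = nab Y x v + mvfderiv 𝓘(ℝ, E) f x v • T x := fun v => by
      rw [show (fun y => (Cplx.ofReal (X y)).re) = X from rfl, hXY,
        cov_add_smul nab (hYs.diffAt x) (hT.smooth.diffAt x) (hfd x), h.reeb, smul_zero, zero_add]
    ext
    · simp only [ccov, h3, h4]
      simp [Cplx.covec]
    · simp only [ccov, h3, h4]
      simp [Cplx.covec]
  have htor : Cplx.bilinV (fun v w => nab.torsion x v w) (Cplx.ofReal (X x)) (Z x)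
      = Cplx.bilinV (fun v w => nab.torsion x v w) (Cplx.ofReal (Y x)) (Z x)
        + (f x : ℂ) • Cplx.bilinV (fun v w => nab.torsion x v w) (Cplx.ofReal (T x)) (Z x) := by
    rw [← bilinV_torsion_smul_left, ← bilinV_torsion_add_left]
    congr 1
    ext
    · simp [Y]
    · simp
  -- The `conj G` half of `Y` contributes a multiple of `T`, which `dθ` kills. In `τ(G, Z)` the
  -- covariant derivatives are in `H^{1,0}` and only `[Z, G]` survives.
  have htorY : hθ.1.dC x (W x)
      (Cplx.bilinV (fun v w => nab.torsion x v w) (Cplx.ofReal (Y x)) (Z x))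
      = Complex.I * hθ.1.dC x (W x) (cbracket Z G x) := by
    rw [hYG, bilinV_torsion_add_left, bilinV_torsion_smul_left, bilinV_torsion_smul_left,
      bilinV_torsion_swap nab (G x) (Z x), bilinV_torsion_swap nab (G x).conj (Z x),
      h.torsion_mixed x _ (hZ.2 x) _ (ContactStructure.conj_mem_H01 (hG.2 x)),
      bilinV_torsion nab hZ.1 hG.1]
    simp only [map_add, map_smul, map_neg, map_sub, dC_ofReal_reeb hθ hT,
      (S.compatible x).dC_H10_H10 hθ (hW.2 x) (h.ccov_mem_H10 hG _ x),
      (S.compatible x).dC_H10_H10 hθ (hW.2 x) (h.ccov_mem_H10 hZ _ x), smul_eq_mul]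
    ring
  have hbr := bilinV_torsion nab (CVField.Smooth.ofReal hXs) hZ.1 x
  have hbr' := congrArg (hθ.1.dC x (W x)) hbr
  rw [htor, hcX] at hbr'
  simp only [map_add, map_smul, map_sub, smul_eq_mul, htorY, dC_ofReal_reeb hθ hT,
    (S.compatible x).dC_H10_H10 hθ (hW.2 x) (h.ccov_mem_H10 hZ _ x), ← hhess] at hbr'
  have hA : S.torsionA θ T nab Z W x = -(Complex.I * hθ.1.dC x (W x)
      (Cplx.bilinV (fun v w => nab.torsion x v w) (Cplx.ofReal (T x)) (Z x))) :=
    S.clevi_of_mem_H01 hθ.1 _ (h.torsion_reeb x _ (hZ.2 x))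
  rw [hgrad, h.nijenhuis_eq hθ hZ hG (hW.2 x), hA]
  linear_combination (-Complex.I) * hbr'

/-- The preceding formula is not visibly symmetric in `Z` and `W`, but `dθ(W, [X, Z])` is, by
differentiating isotropy along `X`. Averaging the formula over both orders produces the
symmetrizations in the operator. -/
theorem crKilling_eq (hθ : C.IsContactForm θ) (hT : ContactStructure.IsReeb θ T) {X : VField E M}
    (hX : C.IsContactField X) (hXs : X.Smooth) {f : M → ℝ} (hf : ∀ x, θ x (X x) = f x)
    {Z W : CVField E M} (hZ : S.IsSection10 Z) (hW : S.IsSection10 W) (x : M) :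
    S.crKilling θ T nab f Z W x
      = -(Complex.I * hθ.1.dC x (W x) (cbracket (fun y => Cplx.ofReal (X y)) Z x)) := by
  have h1 := h.dC_cbracket_eq hθ hT hX hXs hf hZ hW x
  have h2 := h.dC_cbracket_eq hθ hT hX hXs hf hW hZ x
  have h3 := hX.dC_cbracket hXs hθ hZ.1 hZ.mem_CH hW.1 hW.mem_CH
    (fun y => (S.compatible y).dC_H10_H10 hθ (hZ.2 y) (hW.2 y)) x
  rw [hθ.1.dC_swap x _ (W x)] at h3
  have h4 := h.torsionA_comm hθ hT hZ hW x
  unfold crKilling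
  linear_combination (-1 / 2) * h1 + (-1 / 2) * h2 + (-Complex.I / 2) * h3
    - (f x / 2) * h4

end IsTanakaWebster

end AlmostCR

end TanakaWebster

/-! ### Differentiating the deformation tensors along the flow. -/

/-- If `B s = c` with `B 0 = 1` and `c 0 = 0`, then `s` and `c` have the same derivative at `0`. -/
theorem hasDerivAt_of_matrix_mulVec_eq {ι : Type*} [Fintype ι] [DecidableEq ι]
    {B : ℝ → Matrix ι ι ℂ} {s c : ℝ → ι → ℂ} {c' : ι → ℂ} (hB : ContinuousAt B 0) (hB0 : B 0 = 1)
    (h : ∀ᶠ t in 𝓝 (0 : ℝ), Matrix.mulVec (B t) (s t) = c t) (hc0 : c 0 = 0)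
    (hc : HasDerivAt c c' 0) : s 0 = 0 ∧ HasDerivAt s c' 0 := by
  have hs0 : s 0 = 0 := by
    have h0 := h.self_of_nhds
    rwa [hB0, Matrix.one_mulVec, hc0] at h0
  refine ⟨hs0, ?_⟩
  have hdet : ContinuousAt (fun t => (B t).det) 0 :=
    (Continuous.matrix_det continuous_id).continuousAt.comp hB
  have hne : ∀ᶠ t in 𝓝 (0 : ℝ), (B t).det ≠ 0 :=
    hdet.eventually_ne (by rw [hB0, Matrix.det_one]; exact one_ne_zero)
  -- Cramer's formula gives a continuous inverse of `B`, so `s(t)/t = B(t)⁻¹ c(t)/t` has the limit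
  -- `c'`. Continuity of `B` suffices and nothing is assumed about `s`.
  have hadj : ContinuousAt (fun t => ((B t).det)⁻¹ • (B t).adjugate) 0 :=
    (hdet.inv₀ (by rw [hB0, Matrix.det_one]; exact one_ne_zero)).smul
      ((Continuous.matrix_adjugate continuous_id).continuousAt.comp hB)
  have hs : ∀ᶠ t in 𝓝 (0 : ℝ), s t = Matrix.mulVec (((B t).det)⁻¹ • (B t).adjugate) (c t) := by
    filter_upwards [h, hne] with t ht hn
    rw [← ht, Matrix.mulVec_mulVec, Matrix.smul_mul, Matrix.adjugate_mul, smul_smul,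
      inv_mul_cancel₀ hn, one_smul, Matrix.one_mulVec]
  rw [hasDerivAt_iff_tendsto_slope_zero] at hc ⊢
  have hmul : Continuous fun q : Matrix ι ι ℂ × (ι → ℂ) => Matrix.mulVec q.1 q.2 :=
    continuous_fst.matrix_mulVec continuous_snd
  have hlim := (hmul.tendsto (_, c')).comp
    ((hadj.tendsto.mono_left nhdsWithin_le_nhds).prodMk_nhds hc)
  have h1 : Matrix.mulVec (((B 0).det)⁻¹ • (B 0).adjugate) c' = c' := by
    rw [hB0, Matrix.det_one, Matrix.adjugate_one, inv_one, one_smul, Matrix.one_mulVec]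
  simp only [h1] at hlim
  refine hlim.congr' ?_
  filter_upwards [hs.filter_mono nhdsWithin_le_nhds] with t ht
  rw [Function.comp_apply, zero_add, hs0, hc0, sub_zero, sub_zero, Matrix.mulVec_smul, ht]

section Deformation

variable {E : Type*} [NormedAddCommGroup E] [NormedSpace ℝ E] [FiniteDimensional ℝ E]
  {M : Type*} [TopologicalSpace M] [ChartedSpace E M] [IsManifold 𝓘(ℝ, E) ∞ M]
  {C : ContactStructure E M} {S : AlmostCR C} {θ : OneForm E M} {T : VField E M}

theorem VField.exists_smooth_eq [T2Space M] (p : M) (v : TangentSpace 𝓘(ℝ, E) p) :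
    ∃ V : VField E M, V.Smooth ∧ V p = v := by
  have : CompleteSpace E := FiniteDimensional.complete ℝ E
  obtain ⟨f⟩ : Nonempty (SmoothBumpFunction 𝓘(ℝ, E) p) := inferInstance
  refine ⟨(f : M → ℝ) • constField p (chartDeriv (E := E) p p v), ?_, ?_⟩
  · refine ContMDiffOn.smul_section_of_tsupport f.contMDiff.contMDiffOn
      (isOpen_extChartAt_source (I := 𝓘(ℝ, E)) p) f.tsupport_subset_extChartAt_source fun q hq => ?_
    exact (constField_smoothAt hq _).contMDiffWithinAt
  · rw [Pi.smul_apply', f.eq_one, one_smul]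
    exact chartDeriv_inverse_apply (mem_extChartAt_source p) v

/-- Extend arbitrarily and subtract `θ(V) T`, which vanishes at `p`. -/
theorem ContactStructure.IsContactForm.exists_smooth_eq [T2Space M] (hθ : C.IsContactForm θ)
    (hT : ContactStructure.IsReeb θ T) {p : M} {v : TangentSpace 𝓘(ℝ, E) p} (hv : v ∈ C.H p) :
    ∃ V : VField E M, V.Smooth ∧ (∀ x, V x ∈ C.H x) ∧ V p = v := by
  obtain ⟨V, hV, hVp⟩ := VField.exists_smooth_eq p v
  have hs : ContMDiff 𝓘(ℝ, E) 𝓘(ℝ, ℝ) ∞ fun y => θ y (V y) := fun y =>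
    hθ.1.contMDiffAt_apply (hV y)
  refine ⟨_, hV.sub (hT.smooth.smul hs), fun x => ?_, ?_⟩
  · rw [hθ.mem_iff]
    simp [hT.apply]
  · simp only [hVp, hθ.mem_iff.1 hv, zero_smul, sub_zero]

theorem AlmostCR.exists_section10_eq [T2Space M] (S : AlmostCR C) (hθ : C.IsContactForm θ)
    (hT : ContactStructure.IsReeb θ T) {p : M} {Z₀ : Cplx (TangentSpace 𝓘(ℝ, E) p)}
    (hZ₀ : Z₀ ∈ C.H10 p (S.J p)) : ∃ Z : CVField E M, S.IsSection10 Z ∧ Z p = Z₀ := by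
  obtain ⟨V, hV, hVH, hVp⟩ := hθ.exists_smooth_eq hT hZ₀.1
  refine ⟨_, AlmostCR.isSection10_mk hV hVH, ?_⟩
  ext
  · exact hVp
  · change -S.J p (V p) = _
    rw [hVp, (ContactStructure.mem_H10_iff.1 hZ₀).2.1, neg_neg]

/-- The pullback of a complex vector field by a diffeomorphism, at `p`. -/
def CVField.pullback (Z : CVField E M) (Φ : M → M) (p : M) : Cplx (TangentSpace 𝓘(ℝ, E) p) :=
  ⟨(mfderiv 𝓘(ℝ, E) 𝓘(ℝ, E) Φ p).inverse (Z (Φ p)).re,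
    (mfderiv 𝓘(ℝ, E) 𝓘(ℝ, E) Φ p).inverse (Z (Φ p)).im⟩

namespace IsFlow

variable {X : VField E M} {𝒟 : Set (ℝ × M)} {Fl : ℝ → M → M}

theorem pullback_zero (h : IsFlow X 𝒟 Fl) (Z : CVField E M) (p : M) :
    Z.pullback (Fl 0) p = Z p := by
  have h0 : Fl 0 = id := funext h.map_zero
  rw [h0]
  unfold CVField.pullback
  rw [mfderiv_id, ContinuousLinearMap.inverse_id]
  rfl

theorem hasDerivAt_cpullback (h : IsFlow X 𝒟 Fl) (hX : X.Smooth) {Z : CVField E M}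
    (hZ : CVField.Smooth Z) (p : M) (α : Cplx (TangentSpace 𝓘(ℝ, E) p) →ₗ[ℂ] ℂ) :
    HasDerivAt (fun t => α (Z.pullback (Fl t) p))
      (α (cbracket (fun y => Cplx.ofReal (X y)) Z p)) 0 := by
  have hs : ∀ (r : ℝ) (u : TangentSpace 𝓘(ℝ, E) p),
      Cplx.ofReal (r • u) = (r : ℂ) • Cplx.ofReal u := fun r u => by
    ext
    · simp
    · simp
  have ha : ∀ u v : TangentSpace 𝓘(ℝ, E) p,
      Cplx.ofReal (u + v) = Cplx.ofReal u + Cplx.ofReal v := fun u v => by ext <;> simp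
  -- The real and imaginary parts of `α` on real vectors are real functionals, to which the
  -- statement for real fields applies.
  let ℓ₁ : TangentSpace 𝓘(ℝ, E) p →ₗ[ℝ] ℝ :=
    { toFun := fun u => (α (Cplx.ofReal u)).re
      map_add' := fun u v => by rw [ha, map_add, Complex.add_re]
      map_smul' := fun r u => by rw [hs, map_smul]; simp }
  let ℓ₂ : TangentSpace 𝓘(ℝ, E) p →ₗ[ℝ] ℝ :=
    { toFun := fun u => (α (Cplx.ofReal u)).im
      map_add' := fun u v => by rw [ha, map_add, Complex.add_im]
      map_smul' := fun r u => by rw [hs, map_smul]; simp }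
  have hα : ∀ U : Cplx (TangentSpace 𝓘(ℝ, E) p), α U
      = ((ℓ₁ U.re : ℂ) + (ℓ₂ U.re : ℂ) * Complex.I)
        + Complex.I * ((ℓ₁ U.im : ℂ) + (ℓ₂ U.im : ℂ) * Complex.I) := fun U => by
    have h1 : U = Cplx.ofReal U.re + Complex.I • Cplx.ofReal U.im := by ext <;> simp
    conv_lhs => rw [h1]
    rw [map_add, map_smul, smul_eq_mul]
    change _ = (((α (Cplx.ofReal U.re)).re : ℂ) + ((α (Cplx.ofReal U.re)).im : ℂ) * Complex.I)
      + Complex.I * (((α (Cplx.ofReal U.im)).re : ℂ) + ((α (Cplx.ofReal U.im)).im : ℂ) * Complex.I)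
    rw [Complex.re_add_im, Complex.re_add_im]
  rw [cbracket_ofReal]
  simp_rw [hα]
  have hre := fun ℓ => (h.hasDerivAt_pullback hX hZ.1 p ℓ).ofReal_comp
  have him := fun ℓ => (h.hasDerivAt_pullback hX hZ.2 p ℓ).ofReal_comp
  exact ((hre ℓ₁).add ((hre ℓ₂).mul_const _)).add
    (((him ℓ₁).add ((him ℓ₂).mul_const _)).const_mul _)

theorem eventually_isCompatibleAt (h : IsFlow X 𝒟 Fl) (S : AlmostCR C) (hXs : X.Smooth)
    (hX : C.IsContactField X) (p : M) :
    ∀ᶠ t in 𝓝 (0 : ℝ), C.IsCompatibleAt p (S.transport (Fl t) p) := by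
  obtain ⟨θ, hθ⟩ := C.exists_isContactForm
  filter_upwards [h.eventually_isInvertible hXs p, h.eventually_conformal hXs hX hθ p]
    with t ht hl
  obtain ⟨l, hl, h1, h2⟩ := hl
  exact (S.compatible (Fl t p)).pullback ht.2 hθ hl h1 h2

/-- `J_t` is the conjugate of `J` by the derivative of the flow, and the inverse derivative maps `H`
to `H` because `θ` is only rescaled. -/
theorem eventually_pullback_mem (h : IsFlow X 𝒟 Fl) (hXs : X.Smooth)
    (hX : C.IsContactField X) {Z : CVField E M} (hZ : S.IsSection10 Z) (p : M) :
    ∀ᶠ t in 𝓝 (0 : ℝ), Z.pullback (Fl t) p ∈ C.H10 p (S.transport (Fl t) p) := by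
  obtain ⟨θ, hθ⟩ := C.exists_isContactForm
  filter_upwards [h.eventually_isInvertible hXs p, h.eventually_conformal hXs hX hθ p]
    with t ht hl
  obtain ⟨l, hl, h1, -⟩ := hl
  have hinv : ∀ v, mfderiv 𝓘(ℝ, E) 𝓘(ℝ, E) (Fl t) p
      ((mfderiv 𝓘(ℝ, E) 𝓘(ℝ, E) (Fl t) p).inverse v) = v := fun v => by
    obtain ⟨e, he⟩ := ht.2
    rw [← he, ContinuousLinearMap.inverse_equiv]
    exact e.apply_symm_apply v
  have hmem : ∀ v ∈ C.H (Fl t p), (mfderiv 𝓘(ℝ, E) 𝓘(ℝ, E) (Fl t) p).inverse v ∈ C.H p := by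
    intro v hv
    have := h1 ((mfderiv 𝓘(ℝ, E) 𝓘(ℝ, E) (Fl t) p).inverse v)
    rw [hinv, hθ.mem_iff.1 hv] at this
    rw [hθ.mem_iff]
    exact (mul_eq_zero.1 this.symm).resolve_left hl.ne'
  have hm := ContactStructure.mem_H10_iff.1 (hZ.2 (Fl t p))
  refine ContactStructure.mem_H10_iff.2 ⟨⟨hmem _ hm.1.1, hmem _ hm.1.2⟩, ?_, ?_⟩
  · change (mfderiv 𝓘(ℝ, E) 𝓘(ℝ, E) (Fl t) p).inverse (S.J _ (mfderiv 𝓘(ℝ, E) 𝓘(ℝ, E) (Fl t) p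
      ((mfderiv 𝓘(ℝ, E) 𝓘(ℝ, E) (Fl t) p).inverse _))) = _
    rw [hinv, hm.2.1, map_neg]
    rfl
  · change (mfderiv 𝓘(ℝ, E) 𝓘(ℝ, E) (Fl t) p).inverse (S.J _ (mfderiv 𝓘(ℝ, E) 𝓘(ℝ, E) (Fl t) p
      ((mfderiv 𝓘(ℝ, E) 𝓘(ℝ, E) (Fl t) p).inverse _))) = _
    rw [hinv, hm.2.2]
    rfl

/-- The derivative of the deformation tensors along the flow of a contact field. -/
theorem hasDerivAt_deformationTensor [T2Space M] (h : IsFlow X 𝒟 Fl) (hXs : X.Smooth)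
    (hX : C.IsContactField X) (hθ : C.IsContactForm θ) (hT : ContactStructure.IsReeb θ T) {p : M}
    {φ : ℝ → (C.H10 p (S.J p) →ₗ[ℂ] C.H01 p (S.J p))}
    (hφ : ∀ᶠ t in 𝓝 (0 : ℝ), C.IsDeformationTensor p (S.J p) (S.transport (Fl t) p) (φ t))
    {Z : CVField E M} (hZ : S.IsSection10 Z) {w : Cplx (TangentSpace 𝓘(ℝ, E) p)}
    (hw : w ∈ C.H10 p (S.J p)) :
    HasDerivAt (fun t => hθ.1.dC p w (φ t ⟨Z p, hZ.2 p⟩))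
      (hθ.1.dC p w (cbracket (fun y => Cplx.ofReal (X y)) Z p)) 0 := by
  have hj := S.compatible p
  have := hj.finiteDimensional_H10
  let b := finBasis ℂ (C.H10 p (S.J p))
  choose Zb hZb hZb' using fun k => S.exists_section10_eq hθ hT (b k).2
  -- Coordinates with respect to `b`, extended to the whole complexified tangent space so that they
  -- can be applied along the flow as fixed functionals.
  choose g hg using fun k => LinearMap.exists_extend (b.coord k)
  have hg' : ∀ k (x : C.H10 p (S.J p)), g k x = b.repr x k := fun k x =>
    congrArg (fun A => A x) (hg k)
  let s : ℝ → Fin (finrank ℂ (C.H10 p (S.J p))) → ℂ := fun t k => hθ.1.dC p w (φ t (b k))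
  -- The relation `φ_t(U^{1,0}) = U^{0,1}` for the pullback `U` of `Y`, expanded in the basis and
  -- paired with `w`, which ignores `U^{1,0}`. Applied to a frame, it is a linear system for the
  -- unknown values `s`.
  have key : ∀ {Y : CVField E M}, S.IsSection10 Y → ∀ᶠ t in 𝓝 (0 : ℝ),
      ∑ k, g k (ContactStructure.proj10 (S.J p) (Y.pullback (Fl t) p)) * s t k
        = hθ.1.dC p w (Y.pullback (Fl t) p) := by
    intro Y hY
    filter_upwards [hφ, h.eventually_pullback_mem hXs hX hY p] with t ht hU
    have hUH := ContactStructure.H10_le_CH hU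
    have h1 := hj.deformationTensor_proj10 ht hU
    conv_rhs => rw [← ContactStructure.proj10_add_proj01 (S.J p) (Y.pullback (Fl t) p)]
    rw [map_add, hj.dC_H10_H10 hθ hw (hj.proj10_mem hUH), zero_add, ← h1]
    let L : C.H10 p (S.J p) →ₗ[ℂ] ℂ := hθ.1.dC p w ∘ₗ (C.H01 p (S.J p)).subtype ∘ₗ φ t
    change _ = L ⟨_, hj.proj10_mem hUH⟩
    conv_rhs => rw [← b.sum_repr ⟨_, hj.proj10_mem hUH⟩, map_sum]
    refine Finset.sum_congr rfl fun k _ => ?_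
    rw [map_smul, ← hg']
    rfl
  have hs := hasDerivAt_of_matrix_mulVec_eq
    (B := fun t => Matrix.of fun a k =>
      g k (ContactStructure.proj10 (S.J p) ((Zb a).pullback (Fl t) p)))
    (s := s) (c := fun t a => hθ.1.dC p w ((Zb a).pullback (Fl t) p))
    (c' := fun a => hθ.1.dC p w (cbracket (fun y => Cplx.ofReal (X y)) (Zb a) p))
    (continuousAt_pi.2 fun a => continuousAt_pi.2 fun k =>
      (h.hasDerivAt_cpullback hXs (hZb a).1 p
        (g k ∘ₗ ContactStructure.proj10 (S.J p))).continuousAt)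
    (by
      ext a k
      rw [Matrix.of_apply, h.pullback_zero, hZb', ContactStructure.proj10_of_mem_H10 (b a).2, hg',
        b.repr_self, Matrix.one_apply, Finsupp.single_apply])
    ((eventually_all.2 fun a => key (hZb a)).mono fun t ht => funext ht)
    (by
      ext a
      change hθ.1.dC p w ((Zb a).pullback (Fl 0) p) = 0
      rw [h.pullback_zero, hZb', hj.dC_H10_H10 hθ hw (b a).2])
    (hasDerivAt_pi.2 fun a => h.hasDerivAt_cpullback hXs (hZb a).1 p (hθ.1.dC p w))
  obtain ⟨hs0, hs1⟩ := hs
  rw [hasDerivAt_pi] at hs1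
  have hZ0 : ∀ k, g k (ContactStructure.proj10 (S.J p) (Z.pullback (Fl 0) p))
      = b.repr ⟨Z p, hZ.2 p⟩ k := fun k => by
    rw [h.pullback_zero, ContactStructure.proj10_of_mem_H10 (hZ.2 p)]
    exact hg' k ⟨Z p, hZ.2 p⟩
  -- Since `s(0) = 0`, differentiating `key` for `Z` leaves only the terms with the derivative of
  -- `s`, taken with the coordinates of `Z` at `p`.
  have hL := HasDerivAt.fun_sum (u := Finset.univ) fun k _ =>
    (h.hasDerivAt_cpullback hXs hZ.1 p (g k ∘ₗ ContactStructure.proj10 (S.J p))).mul (hs1 k)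
  have hR := (h.hasDerivAt_cpullback hXs hZ.1 p (hθ.1.dC p w)).congr_of_eventuallyEq (key hZ)
  have hval := hL.unique hR
  rw [← hval]
  have hsum : HasDerivAt (fun t => ∑ k, b.repr ⟨Z p, hZ.2 p⟩ k * s t k)
      (∑ k, b.repr ⟨Z p, hZ.2 p⟩ k *
        hθ.1.dC p w (cbracket (fun y => Cplx.ofReal (X y)) (Zb k) p)) 0 :=
    HasDerivAt.fun_sum fun k _ => (hs1 k).const_mul _
  refine (hsum.congr_of_eventuallyEq (Eventually.of_forall fun t => ?_)).congr_deriv ?_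
  · let L : C.H10 p (S.J p) →ₗ[ℂ] ℂ := hθ.1.dC p w ∘ₗ (C.H01 p (S.J p)).subtype ∘ₗ φ t
    change L ⟨Z p, hZ.2 p⟩ = _
    conv_lhs => rw [← b.sum_repr ⟨Z p, hZ.2 p⟩, map_sum]
    refine Finset.sum_congr rfl fun k _ => ?_
    rw [map_smul]
    rfl
  · refine Finset.sum_congr rfl fun k _ => ?_
    rw [hs0, Pi.zero_apply, mul_zero, zero_add, LinearMap.comp_apply, hZ0]

end IsFlow

end Deformation

end

/-! ### The main theorem. -/

theorem mainTheorem4 (n : ℕ) {M : Type*} [TopologicalSpace M] [T2Space M]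
    [ChartedSpace (EuclideanSpace ℝ (Fin (2 * n + 1))) M] [IsManifold (𝓡 (2 * n + 1)) ∞ M]
    (C : ContactStructure (EuclideanSpace ℝ (Fin (2 * n + 1))) M) (S : AlmostCR C)
    (F : S.Density n) (X : VField (EuclideanSpace ℝ (Fin (2 * n + 1))) M)
    (hX : S.IsContactHamiltonian F X)
    (𝒟 : Set (ℝ × M)) (Fl : ℝ → M → M) (hFl : IsFlow X 𝒟 Fl) (p : M) :
    (∀ᶠ t in 𝓝 (0 : ℝ), C.IsCompatibleAt p (S.transport (Fl t) p) ∧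
      ∃! φ : C.H10 p (S.J p) →ₗ[ℂ] C.H01 p (S.J p),
        C.IsDeformationTensor p (S.J p) (S.transport (Fl t) p) φ) ∧
    ∀ φ : ℝ → (C.H10 p (S.J p) →ₗ[ℂ] C.H01 p (S.J p)),
      (∀ᶠ t in 𝓝 (0 : ℝ),
        C.IsDeformationTensor p (S.J p) (S.transport (Fl t) p) (φ t)) →
      ∀ (θ : OneForm (EuclideanSpace ℝ (Fin (2 * n + 1))) M) (f : M → ℝ)
        (T : VField (EuclideanSpace ℝ (Fin (2 * n + 1))) M)
        (nab : CovariantDerivative (𝓡 (2 * n + 1)) (EuclideanSpace ℝ (Fin (2 * n + 1)))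
          (TangentSpace (𝓡 (2 * n + 1)) : M → Type _)),
        C.IsContactForm θ → S.Trivializes n F.toFun θ f → ContactStructure.IsReeb θ T →
        S.IsTanakaWebster θ T nab →
        ∀ (Z W : CVField (EuclideanSpace ℝ (Fin (2 * n + 1))) M)
          (hZ : S.IsSection10 Z) (_ : S.IsSection10 W),
          HasDerivAt (fun t => S.clevi θ p (W p) (φ t ⟨Z p, hZ.2 p⟩))
            (S.crKilling θ T nab f Z W p) 0 := by
  have hn : finrank ℝ (EuclideanSpace ℝ (Fin (2 * n + 1))) = 2 * n + 1 := finrank_euclideanSpace_fin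
  have hXc := hX.isContactField
  refine ⟨?_, fun φ hφ θ f T nab hθ hf hT hnab Z W hZ hW => ?_⟩
  · filter_upwards [hFl.eventually_isCompatibleAt S hX.1 hXc p] with t ht
    exact ⟨ht, (S.compatible p).existsUnique_deformationTensor ht⟩
  · rw [hnab.crKilling_eq hθ hT hXc hX.1 (hX.apply_eq hn hθ hf) hZ hW]
    -- The factor `-i` converts `dθ(W, ·)` on `H^{0,1}` into the Levi pairing that lowers the index.
    have h1 := (hFl.hasDerivAt_deformationTensor hX.1 hXc hθ hT hφ hZ (hW.2 p)).const_mul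
      (-Complex.I)
    simp_rw [S.clevi_of_mem_H01 hθ.1 _ (Subtype.prop _)]
    simpa only [neg_mul] using h1
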